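/- Let $n\ge 1$ and let $S\in\mathbb{Z}^{n\times n}$ be positive definite and maximal even, i.e. $S$ is the Gram matrix of an even lattice $\mathbb{Z}^n$ which is not properly contained in another even lattice of the same quadratic space. Put $T[x]=x^{tr}Tx$, $$S_0=\begin{pmatrix}0&0&1\\0&-S&0\\1&0&0\end{pmatrix},\qquad S_1=\begin{pmatrix}0&0&1\\0&S_0&0\\1&0&0\end{pmatrix},\qquad L_0^\sharp=S_0^{-1}\mathbb{Z}^{n+2},$$ $$\mathcal{H}_S=\{w=(\tau,z,\tau')^{tr}=u+iv\in\mathbb{C}^{n+2}:\ S_0[v]>0,\ \operatorname{Im}\tau>0,\ \operatorname{Im}\tau'>0\}.$$ For a real matrix $M=\begin{pmatrix}\alpha&a^{tr}&\beta\\b&K&c\\\gamma&d^{tr}&\delta\end{pmatrix}$ of size $n+4$, a positive integer $k$ and $f:\mathcal{H}_S\to\mathbb{C}$ put $M\{w\}=-\frac{\gamma}{2}S_0[w]+d^{tr}w+\delta$, $M\langle w\rangle=\left(-\frac12S_0[w]b+Kw+c\right)M\{w\}^{-1}$ and $(f|_kM)(w)=f(M\langle w\rangle)M\{w\}^{-k}$.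 Let $\Gamma_S$ be the group of all $M\in I+\mathbb{Z}^{(n+4)\times(n+4)}S_1$ with $M^{tr}S_1M=S_1$, $\det M=1$ and $M\langle\mathcal{H}_S\rangle=\mathcal{H}_S$, and let $\mathcal{M}_k(\Gamma_S)$ be the space of holomorphic $f:\mathcal{H}_S\to\mathbb{C}$ with $f|_kM=f$ for all $M\in\Gamma_S$. Let $\alpha_f(\lambda)$, $\lambda\in L_0^\sharp$, be the coefficients of the Fourier expansion $f(w)=\sum_{\lambda}\alpha_f(\lambda)e^{2\pi i\lambda^{tr}S_0w}$, and put $\alpha_f(\lambda)=0$ for $\lambda\notin L_0^\sharp$. For $\lambda=(m,\mu,l)^{tr}\in L_0^\sharp$ write $\epsilon(\lambda)=\gcd(S_0\lambda)$, and $\lambda\ge0$ if $m\ge0$, $l\ge0$ and $S_0[\lambda]\ge0$. Let $k>0$ be even and $f\in\mathcal{M}_k(\Gamma_S)$. Then the following are equivalent. (i) $f$ belongs to the Maaß space, i.e. for all $0\ne\lambda=(m,\mu,l)^{tr}\in L_0^\sharp$ with $\lambda\ge0$ $$\alpha_f(m,\mu,l)=\sum_{d\mid\epsilon(\lambda)}d^{k-1}\alpha_f(1,\mu/d,lm/d^2).$$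 (ii) $f$ satisfies the $p$-Maaß condition for every prime $p$, i.e. for all integers $r\ge0$ and all $(m,\mu,l)^{tr}\in L_0^\sharp$ with $p\nmid m$ $$\alpha_f(p^rm,\mu,l)=\sum_{\substack{0\le j\le r\\ p^j\mid\epsilon((p^rm,\mu,l)^{tr})}}p^{j(k-1)}\alpha_f(m,p^{-j}\mu,p^{r-2j}l),$$ and for all integers $r\ge0$ and all integers $m$ with $p\nmid m$ $$\alpha_f(0,0,p^rm)=\Big(\sum_{j=0}^rp^{j(k-1)}\Big)\alpha_f(0,0,m).$$ (iii) For all primes $p$ and all $(m,\mu,l)^{tr}\in L_0^\sharp$ $$\alpha_f(pm,\mu,l)+p^{k-1}\alpha_f(m/p,\mu/p,l)=\alpha_f(m,\mu,pl)+p^{k-1}\alpha_f(m,\mu/p,l/p).$$ (iv) $f|_kT_p^\uparrow=f|_kT_p^\downarrow$ for all primes $p$, where, with $M_\lambda=\begin{pmatrix}1&-\lambda^{tr}S_0&-\frac12S_0[\lambda]\\0&I&\lambda\\0&0&1\end{pmatrix}$ (so that $M_\lambda\langle w\rangle=w+\lambda$) and $e_1,\dots,e_{n+2}$ the standard basis of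 $\mathbb{Z}^{n+2}$, $$f|_kT_p^\downarrow=f|_k\operatorname{diag}(p^2,p,\dots,p,1)+\sum_{l=0}^{p-1}f|_k\operatorname{diag}(p,p^2,p,\dots,p,1,p)\,M_{le_{n+2}},$$ $$f|_kT_p^\uparrow=f|_k\operatorname{diag}(p^2,p^2,p,\dots,p,1,1)+\sum_{l=0}^{p-1}f|_k(pI)\,M_{(l/p)e_1}.$$ -/

import Mathlib

namespace OrthMaass

open Matrix

/-- The index set of `R × R^ι × R`: a first coordinate, a middle block and a last coordinate. -/
abbrev Ext (ι : Type) : Type := Unit ⊕ ι ⊕ Unit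

/-- The first index. -/
abbrev fst {ι : Type} : Ext ι := Sum.inl ()

/-- The indices of the middle block. -/
abbrev mid {ι : Type} (i : ι) : Ext ι := Sum.inr (Sum.inl i)

/-- The last index. -/
abbrev lst {ι : Type} : Ext ι := Sum.inr (Sum.inr ())

/-- The column vector `(a, x, b)ᵗʳ`. -/
def colVec {ι R : Type} (a : R) (x : ι → R) (b : R) : Ext ι → R :=
  Sum.elim (fun _ => a) (Sum.elim x (fun _ => b))

/-- The block matrix with rows `(α, aᵗʳ, β)`, `(b, K, c)`, `(γ, dᵗʳ, δ)`. -/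
def blk {ι R : Type} (α : R) (a : ι → R) (β : R) (b : ι → R) (K : Matrix ι ι R) (c : ι → R)
    (γ : R) (d : ι → R) (δ : R) : Matrix (Ext ι) (Ext ι) R :=
  Matrix.of (Sum.elim (fun _ => colVec α a β)
    (Sum.elim (fun i => colVec (b i) (K i) (c i)) (fun _ => colVec γ d δ)))

/-- The symmetric matrix with rows `(0, 0, 1)`, `(0, T, 0)`, `(1, 0, 0)`. -/
def addHyp {ι R : Type} [Zero R] [One R] (T : Matrix ι ι R) : Matrix (Ext ι) (Ext ι) R :=
  blk 0 0 1 0 T 0 1 0 0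

/-- `T[x] = xᵗʳ T x`. -/
def quad {ι R : Type} [Fintype ι] [CommRing R] (T : Matrix ι ι R) (x : ι → R) : R :=
  x ⬝ᵥ (T *ᵥ x)

variable {n : ℕ}

/-- The matrix `S₀`, over the ring `R`. -/
def S0 (R : Type) [CommRing R] (S : Matrix (Fin n) (Fin n) ℤ) :
    Matrix (Ext (Fin n)) (Ext (Fin n)) R :=
  addHyp (-(S.map (Int.cast : ℤ → R)))

/-- The matrix `S₁`, over the ring `R`. -/
def S1 (R : Type) [CommRing R] (S : Matrix (Fin n) (Fin n) ℤ) :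
    Matrix (Ext (Ext (Fin n))) (Ext (Ext (Fin n))) R :=
  addHyp (S0 R S)

/-- `S` is the Gram matrix of a positive definite even lattice which is maximal even, i.e. which is
not properly contained in an even lattice of the same quadratic space. -/
structure IsMaximalEven (S : Matrix (Fin n) (Fin n) ℤ) : Prop where
  posDef : (S.map (Int.cast : ℤ → ℝ)).PosDef
  even : ∀ i, Even (S i i)
  maximal : ∀ Λ : AddSubgroup (Fin n → ℝ),
    (∀ x : Fin n → ℤ, (fun i => (x i : ℝ)) ∈ Λ) →
    (∀ x ∈ Λ, ∃ a : ℤ, quad (S.map (Int.cast : ℤ → ℝ)) x = 2 * (a : ℝ)) →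
    ∀ x ∈ Λ, ∃ y : Fin n → ℤ, x = fun i => (y i : ℝ)

/-- The orthogonal half-space: `w = (τ, z, τ')ᵗʳ = u + iv` with `S₀[v] > 0` and `τ`, `τ'` in the
upper half-plane. -/
def halfSpace (S : Matrix (Fin n) (Fin n) ℤ) : Set (Ext (Fin n) → ℂ) :=
  {w | 0 < quad (S0 ℝ S) (fun i => (w i).im) ∧ 0 < (w fst).im ∧ 0 < (w lst).im}

/-- The factor of automorphy `M{w} = -(γ/2) S₀[w] + dᵗʳ w + δ`. -/
noncomputable def autFactor (S : Matrix (Fin n) (Fin n) ℤ)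
    (M : Matrix (Ext (Ext (Fin n))) (Ext (Ext (Fin n))) ℝ) (w : Ext (Fin n) → ℂ) : ℂ :=
  -((M lst fst : ℂ) / 2) * quad (S0 ℂ S) w + ∑ j, (M lst (mid j) : ℂ) * w j + (M lst lst : ℂ)

/-- The action `M⟨w⟩ = (-(1/2) S₀[w] b + K w + c) M{w}⁻¹`. -/
noncomputable def act (S : Matrix (Fin n) (Fin n) ℤ)
    (M : Matrix (Ext (Ext (Fin n))) (Ext (Ext (Fin n))) ℝ) (w : Ext (Fin n) → ℂ) :
    Ext (Fin n) → ℂ := fun i =>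
  (-(1 / 2) * quad (S0 ℂ S) w * (M (mid i) fst : ℂ) + ∑ j, (M (mid i) (mid j) : ℂ) * w j
    + (M (mid i) lst : ℂ)) * (autFactor S M w)⁻¹

/-- `SO⁺(S₁; ℝ)`: the matrices in `SO(S₁; ℝ)` mapping the half-space onto itself. -/
def SOPlus (S : Matrix (Fin n) (Fin n) ℤ) :
    Set (Matrix (Ext (Ext (Fin n))) (Ext (Ext (Fin n))) ℝ) :=
  {M | Mᵀ * S1 ℝ S * M = S1 ℝ S ∧ M.det = 1 ∧ act S M '' halfSpace S = halfSpace S}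

/-- The discriminant kernel `Γ_S`: the `M` in `SO⁺(S₁; ℝ)` with `M ∈ I + ℤ^{(n+4)×(n+4)} S₁`. -/
def discKernel (S : Matrix (Fin n) (Fin n) ℤ) :
    Set (Matrix (Ext (Ext (Fin n))) (Ext (Ext (Fin n))) ℝ) :=
  {M | M ∈ SOPlus S ∧ ∃ X : Matrix (Ext (Ext (Fin n))) (Ext (Ext (Fin n))) ℤ,
    M = 1 + X.map (Int.cast : ℤ → ℝ) * S1 ℝ S}

/-- `(f |_k M)(w) = f(M⟨w⟩) M{w}^{-k}`, without a normalizing factor. -/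
noncomputable def slash (S : Matrix (Fin n) (Fin n) ℤ) (k : ℕ) (f : (Ext (Fin n) → ℂ) → ℂ)
    (M : Matrix (Ext (Ext (Fin n))) (Ext (Ext (Fin n))) ℝ) (w : Ext (Fin n) → ℂ) : ℂ :=
  f (act S M w) * (autFactor S M w ^ k)⁻¹

/-- `f` (only its values on the half-space matter) is a modular form of weight `k` for `Γ_S`. -/
structure IsModularForm (S : Matrix (Fin n) (Fin n) ℤ) (k : ℕ) (f : (Ext (Fin n) → ℂ) → ℂ) :
    Prop where
  holo : DifferentiableOn ℂ f (halfSpace S)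
  slash_eq : ∀ M ∈ discKernel S, ∀ w ∈ halfSpace S, slash S k f M w = f w

/-- The dual lattice `L₀^♯ = S₀⁻¹ ℤ^{n+2}`. -/
def dualLattice (S : Matrix (Fin n) (Fin n) ℤ) : Set (Ext (Fin n) → ℝ) :=
  {v | ∃ g : Ext (Fin n) → ℤ, S0 ℝ S *ᵥ v = fun i => (g i : ℝ)}

/-- `λ ≥ 0`: first and last coordinate nonnegative and `S₀[λ] ≥ 0`. -/
def IsNonneg (S : Matrix (Fin n) (Fin n) ℤ) (v : Ext (Fin n) → ℝ) : Prop :=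
  0 ≤ v fst ∧ 0 ≤ v lst ∧ 0 ≤ quad (S0 ℝ S) v

/-- The point `u + i (1, 0, 1)ᵗʳ` of the half-space, for real `u`. -/
noncomputable def basePoint (u : Ext (Fin n) → ℝ) : Ext (Fin n) → ℂ :=
  fun i => (u i : ℂ) + Complex.I * colVec 1 0 1 i

open Classical in
/-- The Fourier coefficient `α_f(λ)` in `f(w) = ∑ α_f(λ) exp(2πi λᵗʳ S₀ w)`, recovered by
integration over a period cell at imaginary part `(1, 0, 1)ᵗʳ`; by convention `α_f(λ) = 0` for `λ`
outside the dual lattice. -/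
noncomputable def fourierCoeff (S : Matrix (Fin n) (Fin n) ℤ) (f : (Ext (Fin n) → ℂ) → ℂ)
    (v : Ext (Fin n) → ℝ) : ℂ :=
  if v ∈ dualLattice S then
    ∫ u in Set.Icc (0 : Ext (Fin n) → ℝ) 1, f (basePoint u) *
      Complex.exp (-(2 * Real.pi * Complex.I *
        ((fun i => (v i : ℂ)) ⬝ᵥ (S0 ℂ S *ᵥ basePoint u))))
  else 0

/-- `ε(λ) = gcd(S₀ λ)`, for `λ` in the dual lattice (where the entries of `S₀ λ` are integers). -/
noncomputable def epsilon (S : Matrix (Fin n) (Fin n) ℤ) (v : Ext (Fin n) → ℝ) : ℕ :=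
  Finset.univ.gcd fun i => ⌊(S0 ℝ S *ᵥ v) i⌋.natAbs

/-- `f` belongs to the Maaß space of weight `k`. -/
def InMaassSpace (S : Matrix (Fin n) (Fin n) ℤ) (k : ℕ) (f : (Ext (Fin n) → ℂ) → ℂ) : Prop :=
  IsModularForm S k f ∧
  ∀ (m l : ℝ) (μ : Fin n → ℝ), colVec m μ l ∈ dualLattice S → IsNonneg S (colVec m μ l) →
    colVec m μ l ≠ 0 →
    fourierCoeff S f (colVec m μ l) = ∑ d ∈ (epsilon S (colVec m μ l)).divisors,
      (d : ℂ) ^ (k - 1) * fourierCoeff S f (colVec 1 (fun i => μ i / d) (l * m / (d : ℝ) ^ 2))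

open Classical in
/-- The `p`-Maaß condition. In the first relation the index `j` runs over those `0 ≤ j ≤ r` for
which `p ^ j` divides `(p ^ r m, μ, l)` in the dual lattice, i.e. `p ^ j ∣ ε((p ^ r m, μ, l))`. -/
def PMaassCondition (S : Matrix (Fin n) (Fin n) ℤ) (k p : ℕ) (f : (Ext (Fin n) → ℂ) → ℂ) : Prop :=
  (∀ (r : ℕ) (m l : ℤ) (μ : Fin n → ℝ), colVec (m : ℝ) μ (l : ℝ) ∈ dualLattice S → ¬ (p : ℤ) ∣ m →
    fourierCoeff S f (colVec ((p : ℝ) ^ r * m) μ l) =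
      ∑ j ∈ (Finset.range (r + 1)).filter
          (fun j => ((p : ℝ) ^ j)⁻¹ • colVec ((p : ℝ) ^ r * m) μ (l : ℝ) ∈ dualLattice S),
        (p : ℂ) ^ (j * (k - 1)) *
          fourierCoeff S f (colVec (m : ℝ) (fun i => μ i / (p : ℝ) ^ j)
            ((p : ℝ) ^ r * l / (p : ℝ) ^ (2 * j)))) ∧
  (∀ (r : ℕ) (m : ℤ), ¬ (p : ℤ) ∣ m →
    fourierCoeff S f (colVec 0 0 ((p : ℝ) ^ r * m)) =
      (∑ j ∈ Finset.range (r + 1), (p : ℂ) ^ (j * (k - 1))) * fourierCoeff S f (colVec 0 0 (m : ℝ)))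

/-- The three-term relations of the Fourier coefficients at `p`. -/
def CoeffRelation (S : Matrix (Fin n) (Fin n) ℤ) (k p : ℕ) (f : (Ext (Fin n) → ℂ) → ℂ) : Prop :=
  ∀ (m l : ℤ) (μ : Fin n → ℝ), colVec (m : ℝ) μ (l : ℝ) ∈ dualLattice S →
    fourierCoeff S f (colVec ((p : ℝ) * m) μ l) +
        (p : ℂ) ^ (k - 1) * fourierCoeff S f (colVec ((m : ℝ) / p) (fun i => μ i / p) l) =
      fourierCoeff S f (colVec m μ ((p : ℝ) * l)) +
        (p : ℂ) ^ (k - 1) * fourierCoeff S f (colVec m (fun i => μ i / p) ((l : ℝ) / p))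

/-- The translation matrix `M_λ`. -/
noncomputable def transl (S : Matrix (Fin n) (Fin n) ℤ) (v : Ext (Fin n) → ℝ) :
    Matrix (Ext (Ext (Fin n))) (Ext (Ext (Fin n))) ℝ :=
  blk 1 (-(v ᵥ* S0 ℝ S)) (-(1 / 2) * quad (S0 ℝ S) v) 0 1 v 0 0 1

/-- `f | T_p^↓ = f | diag(p², p, …, p, 1) + ∑_{l mod p} f | diag(p, p², p, …, p, 1, p) M_{l e_{n+2}}`. -/
noncomputable def heckeDown (S : Matrix (Fin n) (Fin n) ℤ) (k p : ℕ)
    (f : (Ext (Fin n) → ℂ) → ℂ) (w : Ext (Fin n) → ℂ) : ℂ :=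
  slash S k f (Matrix.diagonal (colVec ((p : ℝ) ^ 2) (fun _ => (p : ℝ)) 1)) w +
    ∑ l ∈ Finset.range p, slash S k f
      (Matrix.diagonal (colVec (p : ℝ) (colVec ((p : ℝ) ^ 2) (fun _ => (p : ℝ)) 1) (p : ℝ)) *
        transl S (colVec 0 0 (l : ℝ))) w

/-- `f | T_p^↑ = f | diag(p², p², p, …, p, 1, 1) + ∑_{l mod p} f | (p I) M_{(l/p) e_1}`. -/
noncomputable def heckeUp (S : Matrix (Fin n) (Fin n) ℤ) (k p : ℕ)
    (f : (Ext (Fin n) → ℂ) → ℂ) (w : Ext (Fin n) → ℂ) : ℂ :=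
  slash S k f (Matrix.diagonal (colVec ((p : ℝ) ^ 2) (colVec ((p : ℝ) ^ 2) (fun _ => (p : ℝ)) 1) 1)) w +
    ∑ l ∈ Finset.range p, slash S k f
      ((p : ℝ) • (1 : Matrix (Ext (Ext (Fin n))) (Ext (Ext (Fin n))) ℝ) *
        transl S (colVec ((l : ℝ) / p) 0 0)) w

end OrthMaass

set_option linter.unusedSectionVars false

/-! Integral translations make `f` periodic on the tube over the cone of `S₀`, so `f` has an
absolutely convergent and unique expansion (`hasSum_tubeCoeff`, `eq_tubeCoeff`). It is indexed by
the frequency vectors `g = S₀ λ ∈ ℤ^{n+2}`, with `g fst = l` and `g lst = m`. In these terms (iii) ⇔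
(iv) is a comparison of coefficients. After the substitution `τ ↦ pτ` both Hecke images become
series with integral frequencies, the sums over `l mod p` keeping only frequencies divisible by `p`.
Multiplied by `p^{k-1}`, equality of the coefficients is the three-term relation
(`coeffRelation_iff_hecke`).

For (i) ⇒ (iii), put `x = (pm, μ, l)` and `y = (m, μ, pl)`. The relation says that `α(x) - p^{k-1}
α(x/p) = α(y) - p^{k-1} α(y/p)`. By the Maaß relation each side is the part of the divisor sum over
`d` prime to `p` (`maass_sub`), and these parts agree term by term. If `x` is not `≥ 0`, every term
vanishes by the Koecher principle.

For (iii) ⇒ (ii), the three-term relation is a second-order recursion in the exponent of `p`, solved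
by strong induction with a telescoping of sums (`pMaass_of_coeffRelation`).

For (ii) ⇒ (i) with `m > 0`, the prime powers of `m` are stripped off one at a time
(`pMaass_expansion`). For `m = 0` only `λ = (0, 0, l)` is left. There (ii) gives `σ_{k-1}(l)
α(0,0,1)` whereas (i) demands `σ_{k-1}(l) α(1,0,0)`, so the symmetry `α(0,0,1) = α(1,0,0)` is
needed. It is obtained analytically (`boundary_coeff_eq`). The limits of `f` as `τ'` or `τ` tends to
`i∞` have the same constant term and both transform with weight `k` under `y ↦ 1/y`. Their
difference is a multiple of `∑_{l ≥ 1} σ_{k-1}(l) e^{-2πly}`, which decays exponentially at infinity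
and stays bounded below near `0`. This contradicts the transformation law unless the multiple is
zero.

All elements of `Γ_S` that are used are Eichler transvections: translations, transvections of the
lattice of `S₀`, and lower unipotents. The second family also yields the Koecher principle: moving
`g` along a transvection orbit keeps its coefficient fixed, while the Cauchy bound tends to zero as
soon as `g` pairs negatively with an integral isotropic vector of a suitable form. -/

namespace OrthMaass

open MeasureTheory Set Complex

/-! ### Characters, periodic functions and integrals over the torus. -/

section Tube

variable {ι : Type} [Fintype ι]

/-- The complex point `u + i y`. -/
noncomputable def cpt (u y : ι → ℝ) : ι → ℂ := fun i => (u i : ℂ) + I * (y i : ℂ)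

/-- The character `exp (2πi g·w)`. -/
noncomputable def cexpo (g : ι → ℤ) (w : ι → ℂ) : ℂ :=
  Complex.exp (2 * Real.pi * I * ∑ i, (g i : ℂ) * w i)

theorem cexpo_add (g : ι → ℤ) (w w' : ι → ℂ) : cexpo g (w + w') = cexpo g w * cexpo g w' := by
  simp only [cexpo, ← Complex.exp_add]
  congr 1
  simp only [Pi.add_apply, mul_add, Finset.sum_add_distrib]

theorem cexpo_neg (g : ι → ℤ) (w : ι → ℂ) : cexpo (-g) w = (cexpo g w)⁻¹ := by
  simp only [cexpo, ← Complex.exp_neg]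
  congr 1
  simp [Finset.sum_neg_distrib]

theorem cexpo_ne_zero (g : ι → ℤ) (w : ι → ℂ) : cexpo g w ≠ 0 := Complex.exp_ne_zero _

theorem cexpo_int (g a : ι → ℤ) : cexpo g (fun i => (a i : ℂ)) = 1 := by
  rw [cexpo, Complex.exp_eq_one_iff]
  exact ⟨∑ i, g i * a i, by push_cast; ring⟩

theorem norm_cexpo (g : ι → ℤ) (w : ι → ℂ) :
    ‖cexpo g w‖ = Real.exp (-(2 * Real.pi * ∑ i, (g i : ℝ) * (w i).im)) := by
  rw [cexpo, Complex.norm_exp]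
  congr 1
  have : (2 * (Real.pi : ℂ) * I * ∑ i, (g i : ℂ) * w i)
      = ((2 * Real.pi : ℝ) : ℂ) * (I * ∑ i, (g i : ℂ) * w i) := by push_cast; ring
  rw [this, Complex.re_ofReal_mul, Complex.I_mul_re, Complex.im_sum]
  simp

theorem differentiable_cexpo (g : ι → ℤ) : Differentiable ℂ (cexpo g) := by
  unfold cexpo
  fun_prop

theorem continuous_cpt (y : ι → ℝ) : Continuous (fun u => cpt u y) := by
  unfold cpt
  fun_prop

theorem cpt_im (u y : ι → ℝ) (i : ι) : (cpt u y i).im = y i := by simp [cpt]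

theorem cpt_re_im (w : ι → ℂ) : cpt (fun i => (w i).re) (fun i => (w i).im) = w := by
  funext i
  simp [cpt, mul_comm I, Complex.re_add_im]

/-- The function on the torus induced by a periodic function. -/
noncomputable def torusFun (φ : (ι → ℝ) → ℂ) (t : UnitAddTorus ι) : ℂ :=
  φ (fun i => ((AddCircle.equivIoc 1 0 (t i) : Ioc (0 : ℝ) (0 + 1)) : ℝ))

theorem torusFun_mk {φ : (ι → ℝ) → ℂ} (hφ : ∀ (u : ι → ℝ) (a : ι → ℤ), φ (fun i => u i + a i) = φ u)
    (u : ι → ℝ) : torusFun φ (fun i => (u i : UnitAddCircle)) = φ u := by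
  have h : ∀ i, ∃ a : ℤ,
      ((AddCircle.equivIoc 1 0 (u i : UnitAddCircle) : Ioc (0 : ℝ) (0 + 1)) : ℝ) = u i + a := by
    intro i
    have h1 : (((AddCircle.equivIoc 1 0 (u i : UnitAddCircle) : Ioc (0 : ℝ) (0 + 1)) : ℝ) :
        UnitAddCircle) = (u i : UnitAddCircle) :=
      AddCircle.coe_equivIoc (a := (0 : ℝ)) (y := (u i : UnitAddCircle))
    have h2 := (QuotientAddGroup.eq_iff_sub_mem).1 h1
    obtain ⟨a, ha⟩ := AddSubgroup.mem_zmultiples_iff.1 h2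
    refine ⟨a, ?_⟩
    simp only [zsmul_eq_mul, mul_one] at ha
    linarith
  choose a ha using h
  unfold torusFun
  rw [← hφ u a]
  congr 1
  funext i
  exact ha i

theorem continuous_torusFun {φ : (ι → ℝ) → ℂ}
    (hφ : ∀ (u : ι → ℝ) (a : ι → ℤ), φ (fun i => u i + a i) = φ u) (hc : Continuous φ) :
    Continuous (torusFun φ) := by
  have hq : IsOpenQuotientMap (Pi.map (fun (_ : ι) (x : ℝ) => (x : UnitAddCircle))) :=
    IsOpenQuotientMap.piMap fun _ => QuotientAddGroup.isOpenQuotientMap_mk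
  rw [hq.isQuotientMap.continuous_iff]
  convert hc using 1
  funext u
  exact torusFun_mk hφ u

theorem integral_Ioc_eq_Icc (a : ι → ℝ) (φ : (ι → ℝ) → ℂ) :
    ∫ x in {x : ι → ℝ | ∀ i, x i ∈ Ioc (a i) (a i + 1)}, φ x = ∫ x in Icc a (a + 1), φ x := by
  have h : {x : ι → ℝ | ∀ i, x i ∈ Ioc (a i) (a i + 1)}
      = Set.pi univ fun i => Ioc (a i) ((a + 1) i) := by
    ext x; simp
  rw [h]
  exact setIntegral_congr_set (by
    simpa [volume_pi] using (Measure.univ_pi_Ioc_ae_eq_Icc (μ := fun _ : ι => (volume : Measure ℝ))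
      (f := a) (g := a + 1)))

theorem mFourier_mk (g : ι → ℤ) (u : ι → ℝ) :
    UnitAddTorus.mFourier g (fun i => (u i : UnitAddCircle)) = cexpo g (fun i => (u i : ℂ)) := by
  simp only [UnitAddTorus.mFourier, ContinuousMap.coe_mk, cexpo, Finset.mul_sum, Complex.exp_sum]
  refine Finset.prod_congr rfl fun i _ => ?_
  rw [fourier_coe_apply]
  congr 1
  push_cast
  ring

theorem mFourierCoeff_torusFun {φ : (ι → ℝ) → ℂ}
    (hφ : ∀ (u : ι → ℝ) (a : ι → ℤ), φ (fun i => u i + a i) = φ u) (g : ι → ℤ) (a : ι → ℝ) :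
    UnitAddTorus.mFourierCoeff (torusFun φ) g =
      ∫ u in Icc a (a + 1), φ u * cexpo (-g) (fun i => (u i : ℂ)) := by
  rw [UnitAddTorus.mFourierCoeff_eq_integral _ _ a, integral_Ioc_eq_Icc]
  congr 1
  funext u
  rw [torusFun_mk hφ, mFourier_mk, smul_eq_mul, mul_comm]

/-- Both integrals are the zeroth Fourier coefficient of the same function on the torus, computed on
two period cells. No regularity of `φ` is needed. -/
theorem integral_translate {φ : (ι → ℝ) → ℂ}
    (hφ : ∀ (u : ι → ℝ) (a : ι → ℤ), φ (fun i => u i + a i) = φ u) (a : ι → ℝ) :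
    ∫ u in Icc (0 : ι → ℝ) 1, φ (u + a) = ∫ u in Icc (0 : ι → ℝ) 1, φ u := by
  have h1 := mFourierCoeff_torusFun hφ 0 a
  have h2 := mFourierCoeff_torusFun hφ 0 0
  have hz : ∀ w : ι → ℂ, cexpo (0 : ι → ℤ) w = 1 := fun w => by simp [cexpo]
  simp only [neg_zero, hz, mul_one, zero_add] at h1 h2
  classical
  rw [← h2, h1, ← integral_indicator measurableSet_Icc, ← integral_indicator measurableSet_Icc,
    ← integral_add_right_eq_self ((Icc a (a + 1)).indicator φ) a]
  refine integral_congr_ae (Filter.Eventually.of_forall fun u => ?_)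
  change Set.indicator _ _ u = Set.indicator _ _ (u + a)
  rw [Set.indicator_apply, Set.indicator_apply]
  have : u ∈ Icc (0 : ι → ℝ) 1 ↔ u + a ∈ Icc a (a + 1) := by
    simp [Set.mem_Icc, add_comm a 1]
  simp [this]

end Tube

end OrthMaass

namespace OrthMaass

open MeasureTheory Set Complex

/-! ### Fourier expansion of holomorphic functions on a tube domain. -/

section Tube

variable {ι : Type} [Fintype ι]

/-- The tube domain over `C`. -/
def tube (C : Set (ι → ℝ)) : Set (ι → ℂ) := {w | (fun i => (w i).im) ∈ C}

/-- `f` is invariant under integral translations on the tube over `C`. -/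
def IntPeriodic (C : Set (ι → ℝ)) (f : (ι → ℂ) → ℂ) : Prop :=
  ∀ w ∈ tube C, ∀ a : ι → ℤ, f (fun i => w i + (a i : ℂ)) = f w

theorem cpt_mem_tube {C : Set (ι → ℝ)} {y : ι → ℝ} (hy : y ∈ C) (u : ι → ℝ) : cpt u y ∈ tube C := by
  change (fun i => (cpt u y i).im) ∈ C
  simpa [cpt_im] using hy

theorem IntPeriodic.cpt {C : Set (ι → ℝ)} {f : (ι → ℂ) → ℂ} (hf : IntPeriodic C f) {y : ι → ℝ}
    (hy : y ∈ C) (u : ι → ℝ) (a : ι → ℤ) :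
    f (cpt (fun i => u i + a i) y) = f (cpt u y) := by
  rw [← hf _ (cpt_mem_tube hy u) a]
  congr 1
  funext i
  simp only [OrthMaass.cpt]
  push_cast
  ring

theorem integrable_and_swap {G : (ι → ℝ) → ℝ → ℂ}
    (hG : ContinuousOn (Function.uncurry G) (Icc 0 1 ×ˢ Icc 0 1)) :
    IntegrableOn (fun u => ∫ x in (0 : ℝ)..1, G u x) (Icc 0 1) ∧
      ∫ u in Icc (0 : ι → ℝ) 1, ∫ x in (0 : ℝ)..1, G u x =
        ∫ x in (0 : ℝ)..1, ∫ u in Icc (0 : ι → ℝ) 1, G u x := by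
  have hI : Integrable (Function.uncurry G)
      ((volume.restrict (Icc (0 : ι → ℝ) 1)).prod (volume.restrict (Icc (0 : ℝ) 1))) := by
    rw [Measure.prod_restrict]
    exact hG.integrableOn_compact (isCompact_Icc.prod isCompact_Icc)
  simp only [intervalIntegral.integral_of_le zero_le_one, ← integral_Icc_eq_integral_Ioc]
  exact ⟨hI.integral_prod_left, integral_integral_swap hI⟩

theorem integral_linear_comb {α : Type} [MeasurableSpace α] {μ : Measure α} {a b c d : α → ℂ}
    (ha : Integrable a μ) (hb : Integrable b μ) (hc : Integrable c μ) (hd : Integrable d μ) (t : ℂ) :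
    ∫ u, (a u - b u + t • c u - t • d u) ∂μ
      = (∫ u, a u ∂μ) - (∫ u, b u ∂μ) + t • (∫ u, c u ∂μ) - t • (∫ u, d u ∂μ) := by
  have e1 := integral_sub (f := fun u => a u - b u + t • c u) (g := fun u => t • d u)
    ((ha.sub hb).add (hc.smul t)) (hd.smul t)
  have e2 := integral_add (f := fun u => a u - b u) (g := fun u => t • c u)
    (ha.sub hb) (hc.smul t)
  rw [e1, e2, integral_sub ha hb, integral_smul, integral_smul]

/-- Cauchy's theorem on a unit square in one auxiliary complex variable, averaged over the period
cell. The vertical sides differ by a real translation and cancel after averaging; the horizontal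
sides are the two integrals to be compared. -/
theorem integral_cpt_indep {C : Set (ι → ℝ)} (hC : Convex ℝ C) {F : (ι → ℂ) → ℂ}
    (hF : DifferentiableOn ℂ F (tube C)) (hp : IntPeriodic C F) {y y' : ι → ℝ} (hy : y ∈ C)
    (hy' : y' ∈ C) :
    ∫ u in Icc (0 : ι → ℝ) 1, F (cpt u y) = ∫ u in Icc (0 : ι → ℝ) 1, F (cpt u y') := by
  -- The imaginary part of `s` moves the height along the segment from `y` to `y'`, which convexity
  -- keeps inside `C`; the real part of `s` only translates.
  set γ : (ι → ℝ) → ℂ → (ι → ℂ) := fun u s i => cpt u y i + s * ((y' i - y i : ℝ) : ℂ) with hγ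
  have hmem : ∀ u s, s.im ∈ Icc (0 : ℝ) 1 → γ u s ∈ tube C := by
    intro u s hs
    change (fun i => (γ u s i).im) ∈ C
    have : (fun i => (γ u s i).im) = AffineMap.lineMap y y' s.im := by
      funext i
      simp only [hγ, Complex.add_im, cpt_im, Complex.im_mul_ofReal, AffineMap.lineMap_apply]
      simp
      ring
    rw [this]
    exact hC.lineMap_mem hy hy' hs
  have hγc : Continuous (Function.uncurry γ) := by
    simp only [hγ, cpt]
    fun_prop
  have key : ∀ σ : ℝ → ℂ, Continuous σ → (∀ x ∈ Icc (0 : ℝ) 1, (σ x).im ∈ Icc (0 : ℝ) 1) →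
      ContinuousOn (Function.uncurry fun u x => F (γ u (σ x))) (Icc 0 1 ×ˢ Icc 0 1) := by
    intro σ hσ hm
    have h1 : ContinuousOn (fun q : (ι → ℝ) × ℝ => γ q.1 (σ q.2)) (Icc 0 1 ×ˢ Icc 0 1) :=
      (hγc.comp (by fun_prop : Continuous fun q : (ι → ℝ) × ℝ => (q.1, σ q.2))).continuousOn
    exact hF.continuousOn.comp h1 fun q hq => hmem _ _ (hm _ hq.2)
  have h1 := integrable_and_swap (key (fun x => (x : ℂ)) (by fun_prop) (by simp))
  have h2 := integrable_and_swap (key (fun x => (x : ℂ) + I) (by fun_prop) (by simp))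
  have h3 := integrable_and_swap (key (fun x => 1 + (x : ℂ) * I) (by fun_prop) (by simp))
  have h4 := integrable_and_swap (key (fun x => (x : ℂ) * I) (by fun_prop) (by simp))
  have rect : ∀ u, (∫ x in (0 : ℝ)..1, F (γ u x)) - (∫ x in (0 : ℝ)..1, F (γ u (x + I)))
      + I • (∫ x in (0 : ℝ)..1, F (γ u (1 + x * I)))
      - I • (∫ x in (0 : ℝ)..1, F (γ u (x * I))) = 0 := by
    intro u
    have hd : DifferentiableOn ℂ (fun s => F (γ u s)) (uIcc (0 : ℂ).re (1 + I).re ×ℂ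
        uIcc (0 : ℂ).im (1 + I).im) := by
      refine hF.comp ?_ ?_
      · have : Differentiable ℂ (γ u) := by
          simp only [hγ]
          fun_prop
        exact this.differentiableOn
      · intro s hs
        refine hmem u s ?_
        have := hs.2
        simpa using this
    have := Complex.integral_boundary_rect_eq_zero_of_differentiableOn _ 0 (1 + I) hd
    simpa using this
  have tr : ∀ (v : ι → ℝ), v ∈ C → ∀ b : ι → ℝ,
      ∫ u in Icc (0 : ι → ℝ) 1, F (cpt (u + b) v) = ∫ u in Icc (0 : ι → ℝ) 1, F (cpt u v) :=
    fun v hv b => integral_translate (φ := fun u => F (cpt u v)) (fun u a => hp.cpt hv u a) b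
  have e1 : ∀ x : ℝ, ∫ u in Icc (0 : ι → ℝ) 1, F (γ u x) =
      ∫ u in Icc (0 : ι → ℝ) 1, F (cpt u y) := by
    intro x
    rw [← tr y hy (fun i => x * (y' i - y i))]
    congr 1; funext u; congr 1; funext i
    simp only [hγ, cpt, Pi.add_apply]; push_cast; ring
  have e2 : ∀ x : ℝ, ∫ u in Icc (0 : ι → ℝ) 1, F (γ u (x + I)) =
      ∫ u in Icc (0 : ι → ℝ) 1, F (cpt u y') := by
    intro x
    rw [← tr y' hy' (fun i => x * (y' i - y i))]
    congr 1; funext u; congr 1; funext i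
    simp only [hγ, cpt, Pi.add_apply]; push_cast; ring
  have e3 : ∀ x ∈ uIcc (0 : ℝ) 1, ∫ u in Icc (0 : ι → ℝ) 1, F (γ u (1 + x * I)) =
      ∫ u in Icc (0 : ι → ℝ) 1, F (γ u (x * I)) := by
    intro x hx
    have hx' : x ∈ Icc (0 : ℝ) 1 := by simpa using hx
    have hv : (fun i => y i + x * (y' i - y i)) ∈ C := by
      have := hmem 0 (x * I) (by simpa using hx')
      change (fun i => (γ 0 (x * I) i).im) ∈ C at this
      simpa [hγ, cpt] using this
    have hg : ∀ u, γ u (x * I) = cpt u (fun i => y i + x * (y' i - y i)) := by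
      intro u; funext i
      simp only [hγ, cpt]; push_cast; ring
    have hg' : ∀ u, γ u (1 + x * I) = cpt (u + (fun i => (y' i - y i)))
        (fun i => y i + x * (y' i - y i)) := by
      intro u; funext i
      simp only [hγ, cpt, Pi.add_apply]; push_cast; ring
    simp only [hg, hg']
    exact tr _ hv _
  have tot : ∫ u in Icc (0 : ι → ℝ) 1, ((∫ x in (0 : ℝ)..1, F (γ u x))
      - (∫ x in (0 : ℝ)..1, F (γ u (x + I))) + I • (∫ x in (0 : ℝ)..1, F (γ u (1 + x * I)))
      - I • (∫ x in (0 : ℝ)..1, F (γ u (x * I)))) = 0 := by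
    simp only [rect]; simp
  have i1 := h1.1; have i2 := h2.1; have i3 := h3.1; have i4 := h4.1
  unfold IntegrableOn at i1 i2 i3 i4
  rw [integral_linear_comb i1 i2 i3 i4, h1.2, h2.2, h3.2, h4.2,
    intervalIntegral.integral_congr (fun x hx => e3 x hx)] at tot
  simp only [e1, e2] at tot
  simp only [add_sub_cancel_right] at tot
  simpa [sub_eq_zero] using tot

/-- The Fourier coefficient at `g`, computed at height `y`. -/
noncomputable def tubeCoeff (f : (ι → ℂ) → ℂ) (y : ι → ℝ) (g : ι → ℤ) : ℂ :=
  ∫ u in Icc (0 : ι → ℝ) 1, f (cpt u y) * cexpo (-g) (cpt u y)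

theorem intPeriodic_cexpo (C : Set (ι → ℝ)) (g : ι → ℤ) : IntPeriodic C (cexpo g) := by
  intro w _ a
  have := cexpo_add g w (fun i => (a i : ℂ))
  rw [cexpo_int, mul_one] at this
  exact this

theorem tubeCoeff_indep {C : Set (ι → ℝ)} (hC : Convex ℝ C) {f : (ι → ℂ) → ℂ}
    (hf : DifferentiableOn ℂ f (tube C)) (hp : IntPeriodic C f) {y y' : ι → ℝ} (hy : y ∈ C)
    (hy' : y' ∈ C) (g : ι → ℤ) : tubeCoeff f y g = tubeCoeff f y' g :=
  integral_cpt_indep hC (F := fun w => f w * cexpo (-g) w)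
    (hf.mul (differentiable_cexpo _).differentiableOn)
    (fun w hw a => by beta_reduce; rw [hp w hw a, intPeriodic_cexpo C (-g) w hw a]) hy hy'

theorem norm_tubeCoeff_le {C : Set (ι → ℝ)} {f : (ι → ℂ) → ℂ}
    (hf : DifferentiableOn ℂ f (tube C)) {y : ι → ℝ} (hy : y ∈ C) :
    ∃ B : ℝ, 0 ≤ B ∧ ∀ g : ι → ℤ,
      ‖tubeCoeff f y g‖ ≤ B * Real.exp (2 * Real.pi * ∑ i, (g i : ℝ) * y i) := by
  have hc : Continuous fun u => f (cpt u y) :=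
    hf.continuousOn.comp_continuous (continuous_cpt y) fun u => cpt_mem_tube hy u
  obtain ⟨B, hB⟩ := (isCompact_Icc (a := (0 : ι → ℝ)) (b := 1)).exists_bound_of_continuousOn
    hc.continuousOn
  have hB0 : 0 ≤ B := (norm_nonneg _).trans (hB 0 (by simp))
  refine ⟨B * volume.real (Icc (0 : ι → ℝ) 1), by positivity, fun g => ?_⟩
  have := norm_setIntegral_le_of_norm_le_const (μ := volume) (s := Icc (0 : ι → ℝ) 1)
    (f := fun u => f (cpt u y) * cexpo (-g) (cpt u y))
    (C := B * Real.exp (2 * Real.pi * ∑ i, (g i : ℝ) * y i)) isCompact_Icc.measure_lt_top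
    (fun u hu => by
      rw [norm_mul, norm_cexpo]
      simp only [cpt_im, Pi.neg_apply, Int.cast_neg, neg_mul, Finset.sum_neg_distrib, mul_neg,
        neg_neg]
      gcongr
      exact hB u hu)
  refine this.trans (le_of_eq ?_)
  ring

theorem summable_prod_pi {h : ℤ → ℝ} (h0 : ∀ n, 0 ≤ h n) (hs : Summable h) :
    Summable fun g : ι → ℤ => ∏ i, h (g i) := by
  classical
  refine summable_of_sum_le (c := ∏ _i : ι, ∑' n, h n)
    (fun g => Finset.prod_nonneg fun i _ => h0 _) fun s => ?_
  calc ∑ g ∈ s, ∏ i, h (g i)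
      ≤ ∑ g ∈ Fintype.piFinset (fun i => s.image fun g => g i), ∏ i, h (g i) := by
        refine Finset.sum_le_sum_of_subset_of_nonneg (fun g hg => ?_)
          fun g _ _ => Finset.prod_nonneg fun i _ => h0 _
        rw [Fintype.mem_piFinset]
        exact fun i => Finset.mem_image_of_mem _ hg
    _ = ∏ i, ∑ n ∈ s.image (fun g => g i), h n := by
        rw [Finset.prod_univ_sum]
    _ ≤ ∏ _i : ι, ∑' n, h n :=
        Finset.prod_le_prod (fun i _ => Finset.sum_nonneg fun n _ => h0 n)
          fun i _ => hs.sum_le_tsum _ fun n _ => h0 n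

theorem summable_exp_neg_abs {c : ℝ} (hc : 0 < c) :
    Summable fun n : ℤ => Real.exp (-(c * |(n : ℝ)|)) := by
  have h : Summable fun n : ℕ => Real.exp (-(c * n)) := by
    have := Real.summable_exp_nat_mul_iff.2 (neg_lt_zero.2 hc)
    refine this.congr fun n => ?_
    congr 1; ring
  refine Summable.of_nat_of_neg ?_ ?_ <;> simpa using h

/-- The coefficients do not depend on the height, so the trivial bound may be taken at any corner of
a small cube around `y`. Choosing the corner by the signs of `g` gains the factor `exp (-2πδ |g i|)`
in every coordinate. -/
theorem summable_tubeCoeff {C : Set (ι → ℝ)} (ho : IsOpen C) (hC : Convex ℝ C) {f : (ι → ℂ) → ℂ}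
    (hf : DifferentiableOn ℂ f (tube C)) (hp : IntPeriodic C f) {y₀ y : ι → ℝ} (hy₀ : y₀ ∈ C)
    (hy : y ∈ C) :
    Summable fun g : ι → ℤ =>
      ‖tubeCoeff f y₀ g‖ * Real.exp (-(2 * Real.pi * ∑ i, (g i : ℝ) * y i)) := by
  classical
  obtain ⟨ε, hε, hb⟩ := Metric.isOpen_iff.1 ho y hy
  set δ := ε / 2 with hδ
  have hδ0 : 0 < δ := by positivity
  -- The corners of the cube. There are finitely many, so the sum of their bounds serves all `g` at
  -- once.
  set σ : (ι → Bool) → ι → ℝ := fun s i => y i + (if s i then δ else -δ) with hσ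
  have hmem : ∀ s, σ s ∈ C := by
    intro s
    refine hb ?_
    rw [Metric.mem_ball]
    refine lt_of_le_of_lt ((dist_pi_le_iff hδ0.le).2 fun i => ?_) (half_lt_self hε)
    rw [Real.dist_eq]
    by_cases h : s i <;> simp [hσ, h, abs_of_pos hδ0]
  choose B hB0 hB using fun s => norm_tubeCoeff_le hf (hmem s)
  refine Summable.of_nonneg_of_le (fun g => by positivity) (fun g => ?_)
    (((summable_prod_pi (ι := ι) (fun n => (Real.exp_pos _).le)
      (summable_exp_neg_abs (c := 2 * Real.pi * δ) (by positivity))).mul_left (∑ s, B s)))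
  set s : ι → Bool := fun i => decide (g i < 0) with hs
  have h1 := hB s g
  rw [tubeCoeff_indep hC hf hp (hmem s) hy₀] at h1
  have h2 : B s ≤ ∑ s, B s := Finset.single_le_sum (fun s _ => hB0 s) (Finset.mem_univ s)
  have h3 : ∀ i, (g i : ℝ) * σ s i = g i * y i - δ * |(g i : ℝ)| := by
    intro i
    by_cases h : g i < 0
    · have : (g i : ℝ) < 0 := by exact_mod_cast h
      simp only [hσ, hs, h, decide_true, if_true, abs_of_neg this]; ring
    · have : 0 ≤ (g i : ℝ) := by exact_mod_cast (not_lt.1 h)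
      simp only [hσ, hs, h, decide_false, abs_of_nonneg this]
      simp only [Bool.false_eq_true, if_false]; ring
  calc ‖tubeCoeff f y₀ g‖ * Real.exp (-(2 * Real.pi * ∑ i, (g i : ℝ) * y i))
      ≤ (B s * Real.exp (2 * Real.pi * ∑ i, (g i : ℝ) * σ s i)) *
          Real.exp (-(2 * Real.pi * ∑ i, (g i : ℝ) * y i)) := by gcongr
    _ = B s * ∏ i, Real.exp (-(2 * Real.pi * δ * |(g i : ℝ)|)) := by
        rw [mul_assoc, ← Real.exp_add, ← Real.exp_sum]
        congr 2
        simp only [h3, Finset.sum_sub_distrib, Finset.sum_neg_distrib, ← Finset.mul_sum]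
        ring
    _ ≤ _ := by
        gcongr

/-- At the fixed height of `w` the function lives on the torus. Its Fourier series is absolutely
summable and hence converges pointwise; the height enters each coefficient only through the factor
`cexpo g (cpt 0 y)`. -/
theorem hasSum_tubeCoeff {C : Set (ι → ℝ)} (ho : IsOpen C) (hC : Convex ℝ C) {f : (ι → ℂ) → ℂ}
    (hf : DifferentiableOn ℂ f (tube C)) (hp : IntPeriodic C f) {y₀ : ι → ℝ} (hy₀ : y₀ ∈ C)
    {w : ι → ℂ} (hw : w ∈ tube C) :
    HasSum (fun g : ι → ℤ => tubeCoeff f y₀ g * cexpo g w) (f w) := by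
  set y : ι → ℝ := fun i => (w i).im with hyd
  have hy : y ∈ C := hw
  set φ : (ι → ℝ) → ℂ := fun u => f (cpt u y) with hφ
  have hper : ∀ (u : ι → ℝ) (a : ι → ℤ), φ (fun i => u i + a i) = φ u := fun u a => hp.cpt hy u a
  have hc : Continuous φ :=
    hf.continuousOn.comp_continuous (continuous_cpt y) fun u => cpt_mem_tube hy u
  have hsplit : ∀ u, cpt u y = (fun i => (u i : ℂ)) + cpt 0 y := by
    intro u; funext i; simp [cpt]
  have hco : ∀ g, UnitAddTorus.mFourierCoeff (torusFun φ) g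
      = tubeCoeff f y₀ g * cexpo g (cpt 0 y) := by
    intro g
    rw [mFourierCoeff_torusFun hper g 0, ← tubeCoeff_indep hC hf hp hy hy₀, tubeCoeff,
      ← integral_mul_const, zero_add]
    congr 1
    funext u
    rw [hsplit u, cexpo_add, cexpo_neg g (cpt 0 y), ← hsplit u]
    simp only [hφ]
    field_simp [cexpo_ne_zero]
  let Φ : C(UnitAddTorus ι, ℂ) := ⟨torusFun φ, continuous_torusFun hper hc⟩
  have hsum : Summable (UnitAddTorus.mFourierCoeff Φ) := by
    refine Summable.of_norm ?_
    refine (summable_tubeCoeff ho hC hf hp hy₀ hy).congr fun g => ?_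
    change _ = ‖UnitAddTorus.mFourierCoeff (torusFun φ) g‖
    rw [hco, norm_mul, norm_cexpo]
    simp only [cpt_im]
  have := UnitAddTorus.hasSum_mFourier_series_apply_of_summable hsum
    (fun i => ((w i).re : UnitAddCircle))
  have hval : Φ (fun i => ((w i).re : UnitAddCircle)) = f w := by
    change torusFun φ (fun i => ((w i).re : UnitAddCircle)) = f w
    rw [torusFun_mk hper]
    simp only [hφ, hyd, cpt_re_im]
  rw [hval] at this
  convert this using 2 with g
  change _ = UnitAddTorus.mFourierCoeff (torusFun φ) g • _
  rw [hco, mFourier_mk, smul_eq_mul, mul_assoc, mul_comm (cexpo g _), ← cexpo_add, ← hsplit,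
    cpt_re_im]

theorem integral_cexpo {g : ι → ℤ} (hg : g ≠ 0) :
    ∫ u in Icc (0 : ι → ℝ) 1, cexpo g (fun i => (u i : ℂ)) = 0 := by
  classical
  obtain ⟨i, hi⟩ := Function.ne_iff.1 hg
  have hi' : (g i : ℂ) ≠ 0 := by exact_mod_cast hi
  have hper : ∀ (u : ι → ℝ) (a : ι → ℤ), cexpo g (fun j => ((u j + a j : ℝ) : ℂ))
      = cexpo g (fun j => (u j : ℂ)) := by
    intro u a
    have := intPeriodic_cexpo (Set.univ : Set (ι → ℝ)) g (fun j => (u j : ℂ)) (Set.mem_univ _) a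
    rw [← this]
    push_cast; rfl
  have h := integral_translate (φ := fun u => cexpo g (fun j => (u j : ℂ))) hper
    -- Translation by this vector multiplies the character by `-1`, so the integral equals its own
    -- negative.
    (Pi.single i (1 / (2 * (g i : ℝ))))
  set e : ι → ℝ := Pi.single i (1 / (2 * (g i : ℝ))) with he
  have hsh : ∀ u : ι → ℝ, cexpo g (fun j => (((u + e) j : ℝ) : ℂ))
      = - cexpo g (fun j => (u j : ℂ)) := by
    intro u
    have e' : (fun j => (((u + e) j : ℝ) : ℂ))
        = (fun j => (u j : ℂ)) + (fun j => (e j : ℂ)) := by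
      funext j; simp
    rw [e', cexpo_add]
    have : cexpo g (fun j => (e j : ℂ)) = -1 := by
      rw [cexpo, Finset.sum_eq_single i]
      · rw [← Complex.exp_pi_mul_I]
        congr 1
        simp only [he, Pi.single_eq_same]
        push_cast
        field_simp
      · intro j _ hj; simp [he, Pi.single_eq_of_ne hj]
      · simp
    rw [this]; ring
  simp only [hsh] at h
  rw [integral_neg] at h
  exact self_eq_neg.1 h.symm

/-- Uniqueness of coefficients: absolute summability at the single height `y` permits termwise
integration, and orthogonality of characters leaves one term. -/
theorem coeff_eq_integral {b : (ι → ℤ) → ℂ} {y : ι → ℝ} {φ : (ι → ℝ) → ℂ}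
    (hs : Summable fun g : ι → ℤ => ‖b g‖ * Real.exp (-(2 * Real.pi * ∑ i, (g i : ℝ) * y i)))
    (h : ∀ u, HasSum (fun g => b g * cexpo g (cpt u y)) (φ u)) (g : ι → ℤ) :
    ∫ u in Icc (0 : ι → ℝ) 1, φ u * cexpo (-g) (cpt u y) = b g := by
  have hsplit : ∀ u, cpt u y = (fun i => (u i : ℂ)) + cpt 0 y := by
    intro u; funext i; simp [cpt]
  have hterm : ∀ g' u, b g' * cexpo g' (cpt u y) * cexpo (-g) (cpt u y)
      = b g' * cexpo (g' - g) (cpt 0 y) * cexpo (g' - g) (fun i => (u i : ℂ)) := by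
    intro g' u
    have : cexpo g' (cpt u y) * cexpo (-g) (cpt u y) = cexpo (g' - g) (cpt u y) := by
      simp only [cexpo, ← Complex.exp_add, ← mul_add, ← Finset.sum_add_distrib]
      congr 2
      refine Finset.sum_congr rfl fun i _ => ?_
      simp; ring
    rw [mul_assoc, this, hsplit u, cexpo_add]
    ring
  have hmu : volume (Icc (0 : ι → ℝ) 1) = 1 := by
    rw [Real.volume_Icc_pi]; simp
  have hint : ∀ g', Integrable (fun u => b g' * cexpo g' (cpt u y) * cexpo (-g) (cpt u y))
      (volume.restrict (Icc (0 : ι → ℝ) 1)) := by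
    intro g'
    refine Continuous.integrableOn_Icc ?_
    exact ((continuous_const.mul ((differentiable_cexpo g').continuous.comp (continuous_cpt y)))).mul
      ((differentiable_cexpo (-g)).continuous.comp (continuous_cpt y))
  have hn : Summable fun g' => ∫ u in Icc (0 : ι → ℝ) 1,
      ‖b g' * cexpo g' (cpt u y) * cexpo (-g) (cpt u y)‖ := by
    have : ∀ g', ∫ u in Icc (0 : ι → ℝ) 1, ‖b g' * cexpo g' (cpt u y) * cexpo (-g) (cpt u y)‖
        = (‖b g'‖ * Real.exp (-(2 * Real.pi * ∑ i, (g' i : ℝ) * y i))) * ‖cexpo (-g) (cpt 0 y)‖ := by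
      intro g'
      simp only [norm_mul, norm_cexpo, cpt_im]
      rw [setIntegral_const, Measure.real, hmu]
      simp
    simp only [this]
    exact hs.mul_right _
  have key := hasSum_integral_of_summable_integral_norm hint hn
  have hl : ∀ u, ∑' g', b g' * cexpo g' (cpt u y) * cexpo (-g) (cpt u y)
      = φ u * cexpo (-g) (cpt u y) := fun u => ((h u).mul_right _).tsum_eq
  simp only [hl] at key
  refine key.unique ?_
  have hv : ∀ g', ∫ u in Icc (0 : ι → ℝ) 1, b g' * cexpo g' (cpt u y) * cexpo (-g) (cpt u y)
      = if g' = g then b g else 0 := by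
    intro g'
    simp only [hterm]
    rw [integral_const_mul]
    by_cases hg : g' = g
    · subst hg
      simp only [sub_self, if_true]
      have hz : ∀ w : ι → ℂ, cexpo (0 : ι → ℤ) w = 1 := fun w => by simp [cexpo]
      simp only [hz]
      rw [setIntegral_const, Measure.real, hmu]
      simp
    · rw [integral_cexpo (sub_ne_zero.2 hg)]
      simp [hg]
  simp only [hv]
  exact hasSum_ite_eq g (b g)

end Tube

end OrthMaass

namespace OrthMaass

open Matrix

/-! ### Bilinear forms, Eichler transvections and hyperbolic extensions. -/

section Bil

variable {ι R : Type} [Fintype ι] [CommRing R]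

/-- The bilinear form `xᵗʳ T y`. -/
def bil (T : Matrix ι ι R) (x y : ι → R) : R := x ⬝ᵥ (T *ᵥ y)

theorem quad_eq_bil (T : Matrix ι ι R) (x : ι → R) : quad T x = bil T x x := rfl

theorem bil_add_left (T : Matrix ι ι R) (x x' y : ι → R) :
    bil T (x + x') y = bil T x y + bil T x' y := by
  simp [bil, add_dotProduct]

theorem bil_add_right (T : Matrix ι ι R) (x y y' : ι → R) :
    bil T x (y + y') = bil T x y + bil T x y' := by
  simp [bil, mulVec_add, dotProduct_add]

theorem bil_sub_left (T : Matrix ι ι R) (x x' y : ι → R) :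
    bil T (x - x') y = bil T x y - bil T x' y := by
  simp [bil, sub_dotProduct]

theorem bil_sub_right (T : Matrix ι ι R) (x y y' : ι → R) :
    bil T x (y - y') = bil T x y - bil T x y' := by
  simp [bil, mulVec_sub, dotProduct_sub]

theorem bil_smul_left (T : Matrix ι ι R) (r : R) (x y : ι → R) :
    bil T (r • x) y = r * bil T x y := by
  simp [bil, smul_dotProduct]

theorem bil_smul_right (T : Matrix ι ι R) (r : R) (x y : ι → R) :
    bil T x (r • y) = r * bil T x y := by
  simp [bil, mulVec_smul, dotProduct_smul]

theorem bil_neg_left (T : Matrix ι ι R) (x y : ι → R) : bil T (-x) y = -bil T x y := by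
  simp [bil]

theorem bil_neg_right (T : Matrix ι ι R) (x y : ι → R) : bil T x (-y) = -bil T x y := by
  simp [bil, mulVec_neg]

theorem bil_comm {T : Matrix ι ι R} (hT : Tᵀ = T) (x y : ι → R) : bil T x y = bil T y x := by
  rw [bil, dotProduct_mulVec, ← mulVec_transpose, hT, dotProduct_comm, bil]

theorem matrix_ext_bil [DecidableEq ι] {A B : Matrix ι ι R} (h : ∀ x y, bil A x y = bil B x y) :
    A = B := by
  ext i j
  have := h (Pi.single i 1) (Pi.single j 1)
  simpa [bil] using this

theorem bil_conj (T M : Matrix ι ι R) (x y : ι → R) :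
    bil (Mᵀ * T * M) x y = bil T (M *ᵥ x) (M *ᵥ y) := by
  rw [bil, bil, ← mulVec_mulVec, ← mulVec_mulVec, dotProduct_mulVec x, vecMul_transpose]

theorem bil_map {R' : Type} [CommRing R'] (φ : R →+* R') (T : Matrix ι ι R) (x y : ι → R) :
    bil (T.map φ) (fun i => φ (x i)) (fun i => φ (y i)) = φ (bil T x y) := by
  simp [bil, dotProduct, mulVec, map_sum]

/-- The Eichler transvection `x ↦ x + (e, x) a - (a, x) e - c (e, x) e`. -/
def transv [DecidableEq ι] (T : Matrix ι ι R) (e a : ι → R) (c : R) : Matrix ι ι R :=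
  1 + (vecMulVec a e - vecMulVec e a - c • vecMulVec e e) * T

theorem transv_mulVec [DecidableEq ι] (T : Matrix ι ι R) (e a : ι → R) (c : R) (x : ι → R) :
    transv T e a c *ᵥ x =
      x + bil T e x • a - bil T a x • e - (c * bil T e x) • e := by
  rw [transv, add_mulVec, one_mulVec, ← mulVec_mulVec, sub_mulVec, sub_mulVec, smul_mulVec,
    vecMulVec_mulVec, vecMulVec_mulVec, vecMulVec_mulVec]
  ext i
  simp [bil]
  ring

/-- Half the norm of `a` is carried as a separate parameter `c`, so that the transvection exists
over `ℤ` whenever the lattice is even. -/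
theorem transv_orth [DecidableEq ι] {T : Matrix ι ι R} (hT : Tᵀ = T) {e a : ι → R} {c : R}
    (he : quad T e = 0) (hea : bil T e a = 0) (hc : quad T a = 2 * c) :
    (transv T e a c)ᵀ * T * transv T e a c = T := by
  refine matrix_ext_bil fun x y => ?_
  rw [bil_conj, transv_mulVec, transv_mulVec]
  rw [quad_eq_bil] at he hc
  have hae : bil T a e = 0 := by rw [bil_comm hT, hea]
  simp only [bil_add_left, bil_add_right, bil_sub_left, bil_sub_right, bil_smul_left,
    bil_smul_right, he, hea, hae, hc, bil_comm hT x e, bil_comm hT x a]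
  ring

theorem transv_sq [DecidableEq ι] {T : Matrix ι ι R} (hT : Tᵀ = T) {e a : ι → R} {c : R}
    (he : quad T e = 0) (hea : bil T e a = 0) (hc : quad T a = 2 * c) :
    transv T e a c * transv T e a c = transv T e (2 • a) (4 * c) := by
  have h : ∀ x, (transv T e a c * transv T e a c) *ᵥ x = transv T e (2 • a) (4 * c) *ᵥ x := by
    intro x
    rw [quad_eq_bil] at he hc
    have hae : bil T a e = 0 := by rw [bil_comm hT, hea]
    rw [← mulVec_mulVec]
    simp only [transv_mulVec, bil_add_right, bil_sub_right, bil_smul_right, he, hea, hae, hc,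
      two_smul, bil_add_left]
    ext i
    simp
    ring
  exact Matrix.mulVec_injective (funext h)

theorem transv_map [DecidableEq ι] {R' : Type} [CommRing R'] (φ : R →+* R') (T : Matrix ι ι R)
    (e a : ι → R) (c : R) :
    (transv T e a c).map φ = transv (T.map φ) (fun i => φ (e i)) (fun i => φ (a i)) (φ c) := by
  ext i j
  simp [transv, Matrix.mul_apply, vecMulVec_apply, Matrix.one_apply, map_sum, apply_ite φ]

/-- Orthogonality gives determinant `±1`. Over the reals the transvection is the square of the one
with `a / 2`, which excludes `-1`. -/
theorem det_transv [DecidableEq ι] {T : Matrix ι ι ℝ} (hT : Tᵀ = T) (hd : T.det ≠ 0)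
    {e a : ι → ℝ} {c : ℝ}
    (he : quad T e = 0) (hea : bil T e a = 0) (hc : quad T a = 2 * c) :
    (transv T e a c).det = 1 := by
  have h1 := congrArg Matrix.det (transv_orth hT he hea hc)
  rw [det_mul, det_mul, det_transpose] at h1
  have h2 : (transv T e a c).det = (transv T e ((1 / 2 : ℝ) • a) (c / 4)).det ^ 2 := by
    rw [pow_two, ← det_mul, transv_sq hT he]
    · congr 2
      · ext i; simp
      · ring
    · rw [bil_smul_right, hea, mul_zero]
    · rw [quad_eq_bil] at hc ⊢
      rw [bil_smul_right, bil_smul_left, hc]; ring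
  have h3 : (transv T e a c).det ^ 2 = 1 := by
    have : ((transv T e a c).det ^ 2 - 1) * T.det = 0 := by linear_combination h1
    rcases mul_eq_zero.1 this with h | h
    · linarith
    · exact absurd h hd
  have h4 : ((transv T e a c).det - 1) * ((transv T e a c).det + 1) = 0 := by linear_combination h3
  rcases mul_eq_zero.1 h4 with h | h
  · linarith
  · nlinarith [sq_nonneg (transv T e ((1 / 2 : ℝ) • a) (c / 4)).det]

theorem sum_ext (v : Ext ι → R) : ∑ i, v i = v fst + ∑ i, v (mid i) + v lst := by
  simp [Fintype.sum_sum_type, add_assoc]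

@[simp] theorem colVec_fst (a : R) (x : ι → R) (b : R) : colVec a x b fst = a := rfl
@[simp] theorem colVec_mid (a : R) (x : ι → R) (b : R) (i : ι) : colVec a x b (mid i) = x i := rfl
@[simp] theorem colVec_lst (a : R) (x : ι → R) (b : R) : colVec a x b lst = b := rfl

theorem ext_cases {P : Ext ι → Prop} (h1 : P fst) (h2 : ∀ i, P (mid i)) (h3 : P lst) : ∀ i, P i := by
  rintro (⟨⟩ | i | ⟨⟩)
  exacts [h1, h2 i, h3]

theorem colVec_eta (v : Ext ι → R) : colVec (v fst) (fun i => v (mid i)) (v lst) = v :=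
  funext (ext_cases rfl (fun _ => rfl) rfl)

theorem colVec_inj {a a' b b' : R} {x x' : ι → R} :
    colVec a x b = colVec a' x' b' ↔ a = a' ∧ x = x' ∧ b = b' := by
  constructor
  · intro h
    exact ⟨congrFun h fst, funext fun i => congrFun h (mid i), congrFun h lst⟩
  · rintro ⟨rfl, rfl, rfl⟩; rfl

theorem smul_colVec (r a b : R) (x : ι → R) : r • colVec a x b = colVec (r * a) (r • x) (r * b) :=
  funext (ext_cases rfl (fun _ => rfl) rfl)

theorem addHyp_mulVec (T : Matrix ι ι R) (v : Ext ι → R) :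
    addHyp T *ᵥ v = colVec (v lst) (T *ᵥ fun i => v (mid i)) (v fst) := by
  refine funext (ext_cases ?_ (fun i => ?_) ?_)
  · change ∑ j, addHyp T fst j * v j = _
    rw [sum_ext]
    simp [addHyp, blk]
  · change ∑ j, addHyp T (mid i) j * v j = _
    rw [sum_ext]
    simp [addHyp, blk, mulVec, dotProduct]
  · change ∑ j, addHyp T lst j * v j = _
    rw [sum_ext]
    simp [addHyp, blk]

theorem bil_addHyp (T : Matrix ι ι R) (v w : Ext ι → R) :
    bil (addHyp T) v w = v fst * w lst + bil T (fun i => v (mid i)) (fun i => w (mid i))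
      + v lst * w fst := by
  rw [bil, addHyp_mulVec, dotProduct, sum_ext]
  simp [bil, dotProduct]

theorem addHyp_transpose {T : Matrix ι ι R} (hT : Tᵀ = T) : (addHyp T)ᵀ = addHyp T := by
  ext i j
  revert i j
  have h : ∀ i j, T j i = T i j := fun i j => congrFun (congrFun hT i) j
  refine ext_cases (ext_cases ?_ (fun j => ?_) ?_) (fun i => ext_cases ?_ (fun j => ?_) ?_)
    (ext_cases ?_ (fun j => ?_) ?_) <;> simp [addHyp, blk, h]

theorem addHyp_map {R' : Type} [CommRing R'] (φ : R →+* R') (T : Matrix ι ι R) :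
    (addHyp T).map φ = addHyp (T.map φ) := by
  ext i j
  revert i j
  refine ext_cases (ext_cases ?_ (fun j => ?_) ?_) (fun i => ext_cases ?_ (fun j => ?_) ?_)
    (ext_cases ?_ (fun j => ?_) ?_) <;> simp [addHyp, blk]

theorem det_ne_zero_of_bil [DecidableEq ι] {K : Type} [Field K] {T : Matrix ι ι K}
    (h : ∀ v, T *ᵥ v = 0 → v = 0) : T.det ≠ 0 := by
  intro hd
  obtain ⟨v, hv, h0⟩ := Matrix.exists_mulVec_eq_zero_iff.2 hd
  exact hv (h v h0)

theorem addHyp_injective {T : Matrix ι ι R} (h : ∀ v, T *ᵥ v = 0 → v = 0) :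
    ∀ v, addHyp T *ᵥ v = 0 → v = 0 := by
  intro v hv
  rw [addHyp_mulVec] at hv
  rw [← colVec_eta v]
  have h1 := congrFun hv fst
  have h3 := congrFun hv lst
  have h2 : (T *ᵥ fun i => v (mid i)) = 0 := funext fun i => congrFun hv (mid i)
  simp only [colVec_fst, colVec_lst, Pi.zero_apply] at h1 h3
  rw [h1, h3, h _ h2]
  exact funext (ext_cases rfl (fun _ => rfl) rfl)

end Bil

/-! ### Symmetry, definiteness and evenness of the forms `S`, `S₀` and `S₁`. -/

section Forms

variable {n : ℕ} {S : Matrix (Fin n) (Fin n) ℤ}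

theorem S_symm (hS : IsMaximalEven S) : Sᵀ = S := by
  have := hS.posDef.isHermitian
  ext i j
  have h := congrFun (congrFun this i) j
  simp only [conjTranspose_apply, map_apply, star_trivial] at h
  exact_mod_cast h

theorem S0_transpose (R : Type) [CommRing R] (hS : IsMaximalEven S) : (S0 R S)ᵀ = S0 R S := by
  refine addHyp_transpose ?_
  rw [transpose_neg, ← transpose_map, S_symm hS]

theorem S1_transpose (R : Type) [CommRing R] (hS : IsMaximalEven S) : (S1 R S)ᵀ = S1 R S :=
  addHyp_transpose (S0_transpose R hS)

theorem S0_map {R R' : Type} [CommRing R] [CommRing R'] (φ : R →+* R') :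
    (S0 R S).map φ = S0 R' S := by
  rw [S0, addHyp_map, S0]
  congr 1
  ext i j; simp

theorem S1_map {R R' : Type} [CommRing R] [CommRing R'] (φ : R →+* R') :
    (S1 R S).map φ = S1 R' S := by
  rw [S1, addHyp_map, S0_map, S1]

theorem S_pos (hS : IsMaximalEven S) {x : Fin n → ℝ} (hx : x ≠ 0) :
    0 < quad (S.map (Int.cast : ℤ → ℝ)) x := by
  have := hS.posDef.dotProduct_mulVec_pos hx
  simpa [quad] using this

theorem S_nonneg (hS : IsMaximalEven S) (x : Fin n → ℝ) :
    0 ≤ quad (S.map (Int.cast : ℤ → ℝ)) x := by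
  by_cases hx : x = 0
  · subst hx; simp [quad]
  · exact (S_pos hS hx).le

theorem S_injective (hS : IsMaximalEven S) (v : Fin n → ℝ)
    (h : S.map (Int.cast : ℤ → ℝ) *ᵥ v = 0) : v = 0 := by
  by_contra hv
  have := S_pos hS hv
  rw [quad, h] at this
  simp at this

theorem S0_injective (hS : IsMaximalEven S) : ∀ v, S0 ℝ S *ᵥ v = 0 → v = 0 :=
  addHyp_injective fun v hv => S_injective hS v (by rw [neg_mulVec] at hv; simpa using hv)

theorem S1_det_ne_zero (hS : IsMaximalEven S) : (S1 ℝ S).det ≠ 0 :=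
  det_ne_zero_of_bil (addHyp_injective (S0_injective hS))

theorem bil_neg_matrix {ι R : Type} [Fintype ι] [CommRing R] (T : Matrix ι ι R) (x y : ι → R) :
    bil (-T) x y = -bil T x y := by
  simp [bil, neg_mulVec]

theorem bil_S0 {R : Type} [CommRing R] (v w : Ext (Fin n) → R) :
    bil (S0 R S) v w = v fst * w lst + v lst * w fst
      - bil (S.map (Int.cast : ℤ → R)) (fun i => v (mid i)) (fun i => w (mid i)) := by
  rw [S0, bil_addHyp, bil_neg_matrix]; ring

theorem quad_S0 {R : Type} [CommRing R] (v : Ext (Fin n) → R) :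
    quad (S0 R S) v = 2 * v fst * v lst
      - quad (S.map (Int.cast : ℤ → R)) (fun i => v (mid i)) := by
  rw [quad_eq_bil, bil_S0, quad_eq_bil]; ring

theorem S_even (hS : IsMaximalEven S) (x : Fin n → ℤ) : Even (quad S x) := by
  classical
  have hsym : ∀ i j, S j i = S i j := fun i j => congrFun (congrFun (S_symm hS) i) j
  have key : ∀ s : Finset (Fin n), Even (∑ i ∈ s, ∑ j ∈ s, x i * (S i j * x j)) := by
    intro s
    induction s using Finset.induction_on with
    | empty => simp
    | insert a s ha ih =>
      rw [Finset.sum_insert ha, Finset.sum_insert ha]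
      have : ∑ i ∈ s, ∑ j ∈ insert a s, x i * (S i j * x j)
          = ∑ j ∈ s, x a * (S a j * x j) + ∑ i ∈ s, ∑ j ∈ s, x i * (S i j * x j) := by
        rw [← Finset.sum_add_distrib]
        refine Finset.sum_congr rfl fun i _ => ?_
        rw [Finset.sum_insert ha, hsym a i]; ring
      rw [this]
      have e1 : Even (x a * (S a a * x a)) := ((hS.even a).mul_right _).mul_left _
      have : x a * (S a a * x a) + ∑ j ∈ s, x a * (S a j * x j) +
          (∑ j ∈ s, x a * (S a j * x j) + ∑ i ∈ s, ∑ j ∈ s, x i * (S i j * x j))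
          = x a * (S a a * x a) + (∑ j ∈ s, x a * (S a j * x j) + ∑ j ∈ s, x a * (S a j * x j))
            + ∑ i ∈ s, ∑ j ∈ s, x i * (S i j * x j) := by ring
      rw [this]
      exact (e1.add (Even.add_self _)).add ih
  have := key Finset.univ
  convert this using 1
  simp [quad, dotProduct, mulVec, Finset.mul_sum]

theorem S0_even (hS : IsMaximalEven S) (x : Ext (Fin n) → ℤ) : ∃ c, quad (S0 ℤ S) x = 2 * c := by
  obtain ⟨c, hc⟩ := S_even hS (fun i => x (mid i))
  refine ⟨x fst * x lst - c, ?_⟩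
  have : S.map (Int.cast : ℤ → ℤ) = S := by ext; simp
  rw [quad_S0, this, hc]; ring

end Forms

end OrthMaass

namespace OrthMaass

open Matrix

/-! ### The positive cone of `S₀`. -/

section Cone

variable {n : ℕ} {S : Matrix (Fin n) (Fin n) ℤ}

/-- The positive cone of `S₀`. -/
def cone (S : Matrix (Fin n) (Fin n) ℤ) : Set (Ext (Fin n) → ℝ) :=
  {v | 0 < quad (S0 ℝ S) v ∧ 0 < v fst ∧ 0 < v lst}

theorem continuous_quad {ι : Type} [Fintype ι] (T : Matrix ι ι ℝ) : Continuous (quad T) := by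
  unfold quad
  exact continuous_id.dotProduct (continuous_const.matrix_mulVec continuous_id)

theorem isOpen_cone : IsOpen (cone S) :=
  (isOpen_lt continuous_const (continuous_quad _)).inter
    ((isOpen_lt continuous_const (continuous_apply _)).inter
      (isOpen_lt continuous_const (continuous_apply _)))

/-- Positive norm forces the product of the outer coordinates to be positive, since `S` is positive
definite; they therefore share a sign. -/
theorem mem_cone_iff_fst (hS : IsMaximalEven S) {v : Ext (Fin n) → ℝ} (hv : 0 < quad (S0 ℝ S) v) :
    v ∈ cone S ↔ 0 < v fst := by
  refine ⟨fun h => h.2.1, fun h => ⟨hv, h, ?_⟩⟩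
  rw [quad_S0] at hv
  have := S_nonneg hS (fun i => v (mid i))
  by_contra h3
  nlinarith

theorem mem_cone_iff_lst (hS : IsMaximalEven S) {v : Ext (Fin n) → ℝ} (hv : 0 < quad (S0 ℝ S) v) :
    v ∈ cone S ↔ 0 < v lst := by
  refine ⟨fun h => h.2.2, fun h => ⟨hv, ?_, h⟩⟩
  rw [quad_S0] at hv
  have := S_nonneg hS (fun i => v (mid i))
  by_contra h3
  nlinarith

theorem bil_cone_pos (hS : IsMaximalEven S) {v w : Ext (Fin n) → ℝ} (hv : v ∈ cone S)
    (hw : w ∈ cone S) : 0 < bil (S0 ℝ S) v w := by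
  obtain ⟨hv, hv1, hv3⟩ := hv
  obtain ⟨hw, hw1, hw3⟩ := hw
  have hT : (S.map (Int.cast : ℤ → ℝ))ᵀ = S.map (Int.cast : ℤ → ℝ) := by
    rw [← transpose_map, S_symm hS]
  rw [quad_S0] at hv hw
  rw [bil_S0]
  set x := fun i => v (mid i)
  set y := fun i => w (mid i)
  -- The reversed Cauchy–Schwarz inequality in disguise: this combination eliminates the first
  -- coordinates, and its nonnegativity bounds the mixed term `S(x, y)`.
  have h := S_nonneg hS (v fst • y - w fst • x)
  rw [quad_eq_bil] at h hv hw
  simp only [bil_sub_left, bil_sub_right, bil_smul_left, bil_smul_right, bil_comm hT y x] at h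
  have h1 : 0 < v fst * w fst := by positivity
  have h2 : 0 < 2 * (v fst * w fst) * (v fst * w lst + v lst * w fst
      - bil (S.map (Int.cast : ℤ → ℝ)) x y) := by
    nlinarith [mul_pos (mul_pos hv1 hv1) hw, mul_pos (mul_pos hw1 hw1) hv]
  exact pos_of_mul_pos_right h2 (by positivity)

theorem convex_cone (hS : IsMaximalEven S) : Convex ℝ (cone S) := by
  rw [convex_iff_forall_pos]
  intro v hv w hw a b ha hb _
  have hb' := bil_cone_pos hS hv hw
  refine ⟨?_, ?_, ?_⟩
  · rw [quad_eq_bil]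
    simp only [bil_add_left, bil_add_right, bil_smul_left, bil_smul_right,
      bil_comm (S0_transpose ℝ hS) w v]
    have h1 : 0 < bil (S0 ℝ S) v v := hv.1
    have h2 : 0 < bil (S0 ℝ S) w w := hw.1
    positivity
  · have h1 := hv.2.1; have h2 := hw.2.1
    simp only [Pi.add_apply, Pi.smul_apply, smul_eq_mul]; positivity
  · have h1 := hv.2.2; have h2 := hw.2.2
    simp only [Pi.add_apply, Pi.smul_apply, smul_eq_mul]; positivity

theorem basePt_mem_cone : (colVec 1 0 1 : Ext (Fin n) → ℝ) ∈ cone S := by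
  refine ⟨?_, by simp, by simp⟩
  rw [quad_S0]
  simp [quad, dotProduct]

end Cone

/-! ### The action through isotropic vectors, evaluated on transvections. -/

section Lift

variable {n : ℕ} {S : Matrix (Fin n) (Fin n) ℤ}

/-- The complexification of a real vector. -/
def cv {ι : Type} (v : ι → ℝ) : ι → ℂ := fun i => (v i : ℂ)

/-- The isotropic vector `(-S₀[w]/2, w, 1)`. -/
noncomputable def isoLift (S : Matrix (Fin n) (Fin n) ℤ) (w : Ext (Fin n) → ℂ) :
    Ext (Ext (Fin n)) → ℂ := colVec (-(1 / 2) * quad (S0 ℂ S) w) w 1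

/-- The action is linear on the isotropic lift followed by normalization of the last coordinate to
`1`, and the automorphy factor is that last coordinate. Actions of transvections can thus be read
off from `transv_mulVec`. -/
theorem autFactor_eq (M : Matrix (Ext (Ext (Fin n))) (Ext (Ext (Fin n))) ℝ)
    (w : Ext (Fin n) → ℂ) :
    autFactor S M w = (M.map Complex.ofRealHom *ᵥ isoLift S w) lst := by
  change _ = ∑ j, (M.map Complex.ofRealHom) lst j * isoLift S w j
  rw [sum_ext (ι := Ext (Fin n))]
  simp only [autFactor, isoLift, colVec_fst, colVec_mid, colVec_lst, map_apply,
    Complex.ofRealHom_eq_coe]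
  ring

theorem act_eq (M : Matrix (Ext (Ext (Fin n))) (Ext (Ext (Fin n))) ℝ)
    (w : Ext (Fin n) → ℂ) (i : Ext (Fin n)) :
    act S M w i = (M.map Complex.ofRealHom *ᵥ isoLift S w) (mid i) * (autFactor S M w)⁻¹ := by
  change _ = (∑ j, (M.map Complex.ofRealHom) (mid i) j * isoLift S w j) * _
  rw [sum_ext (ι := Ext (Fin n))]
  simp only [act, isoLift, colVec_fst, colVec_mid, colVec_lst, map_apply,
    Complex.ofRealHom_eq_coe]
  ring

theorem transv_isoLift (e a : Ext (Ext (Fin n)) → ℝ) (c : ℝ) (w : Ext (Fin n) → ℂ) :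
    (transv (S1 ℝ S) e a c).map Complex.ofRealHom *ᵥ isoLift S w =
      isoLift S w + bil (S1 ℂ S) (cv e) (isoLift S w) • cv a
        - bil (S1 ℂ S) (cv a) (isoLift S w) • cv e
        - ((c : ℂ) * bil (S1 ℂ S) (cv e) (isoLift S w)) • cv e := by
  rw [transv_map, S1_map, transv_mulVec]
  rfl

theorem bil_S1_lift (e1 : ℂ) (e : Ext (Fin n) → ℂ) (e3 : ℂ) (w : Ext (Fin n) → ℂ) :
    bil (S1 ℂ S) (colVec e1 e e3) (isoLift S w) =
      e1 + bil (S0 ℂ S) e w - 1 / 2 * e3 * quad (S0 ℂ S) w := by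
  rw [S1, bil_addHyp]
  simp only [isoLift, colVec_fst, colVec_mid, colVec_lst]
  ring

theorem cv_colVec {ι : Type} [Fintype ι] (a : ℝ) (x : ι → ℝ) (b : ℝ) :
    cv (colVec a x b) = colVec (a : ℂ) (cv x) (b : ℂ) :=
  funext (ext_cases rfl (fun _ => rfl) rfl)

theorem cv_zero {ι : Type} : cv (0 : ι → ℝ) = 0 := by
  funext i; simp [cv]

theorem bil_cv (x y : Ext (Fin n) → ℝ) :
    bil (S0 ℂ S) (cv x) (cv y) = ((bil (S0 ℝ S) x y : ℝ) : ℂ) := by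
  have := bil_map Complex.ofRealHom (S0 ℝ S) x y
  rw [S0_map] at this
  exact this

theorem bil_cv_im (x : Ext (Fin n) → ℝ) (w : Ext (Fin n) → ℂ) :
    (bil (S0 ℂ S) (cv x) w).im = bil (S0 ℝ S) x (fun i => (w i).im) := by
  have h : w = cv (fun i => (w i).re) + Complex.I • cv (fun i => (w i).im) := by
    funext i; simp [cv, mul_comm Complex.I, Complex.re_add_im]
  conv_lhs => rw [h, bil_add_right, bil_smul_right, bil_cv, bil_cv]
  simp

theorem transl_transv_act (v : Ext (Fin n) → ℝ) (c : ℝ)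
    (w : Ext (Fin n) → ℂ) :
    autFactor S (transv (S1 ℝ S) (colVec 1 0 0) (colVec 0 v 0) c) w = 1 ∧
    act S (transv (S1 ℝ S) (colVec 1 0 0) (colVec 0 v 0) c) w = w + cv v := by
  have h1 : autFactor S (transv (S1 ℝ S) (colVec 1 0 0) (colVec 0 v 0) c) w = 1 := by
    rw [autFactor_eq, transv_isoLift]
    simp [cv_colVec, isoLift]
  refine ⟨h1, ?_⟩
  funext i
  rw [act_eq, h1, transv_isoLift]
  simp only [cv_colVec, cv_zero, bil_S1_lift]
  simp [isoLift, bil]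

theorem linear_transv_act (e a : Ext (Fin n) → ℝ) (c : ℝ) (w : Ext (Fin n) → ℂ) :
    autFactor S (transv (S1 ℝ S) (colVec 0 e 0) (colVec 0 a 0) c) w = 1 ∧
    act S (transv (S1 ℝ S) (colVec 0 e 0) (colVec 0 a 0) c) w =
      transv (S0 ℂ S) (cv e) (cv a) (c : ℂ) *ᵥ w := by
  have h1 : autFactor S (transv (S1 ℝ S) (colVec 0 e 0) (colVec 0 a 0) c) w = 1 := by
    rw [autFactor_eq, transv_isoLift]
    simp [cv_colVec, isoLift]
  refine ⟨h1, ?_⟩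
  funext i
  rw [act_eq, h1, transv_isoLift, transv_mulVec]
  simp only [cv_colVec, bil_S1_lift]
  simp [isoLift]

/-- The action `w ↦ (w + S₀[w] c / 2) / (1 + (c, w))`. -/
noncomputable def invTransl (S : Matrix (Fin n) (Fin n) ℤ) (c : Ext (Fin n) → ℝ)
    (w : Ext (Fin n) → ℂ) : Ext (Fin n) → ℂ :=
  (1 + bil (S0 ℂ S) (cv c) w)⁻¹ • (w + (1 / 2 * quad (S0 ℂ S) w) • cv c)

theorem lower_transv_act (c : Ext (Fin n) → ℝ) (w : Ext (Fin n) → ℂ) :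
    autFactor S (transv (S1 ℝ S) (colVec 0 0 1) (colVec 0 (-c) 0) 0) w
      = 1 + bil (S0 ℂ S) (cv c) w ∧
    act S (transv (S1 ℝ S) (colVec 0 0 1) (colVec 0 (-c) 0) 0) w = invTransl S c w := by
  have hn : cv (-c) = -cv c := by funext i; simp [cv]
  have h1 : autFactor S (transv (S1 ℝ S) (colVec 0 0 1) (colVec 0 (-c) 0) 0) w
      = 1 + bil (S0 ℂ S) (cv c) w := by
    rw [autFactor_eq, transv_isoLift]
    simp only [cv_colVec, cv_zero, bil_S1_lift, hn, bil_neg_left]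
    simp [isoLift]
  refine ⟨h1, ?_⟩
  funext i
  rw [act_eq, h1, transv_isoLift]
  simp only [cv_colVec, cv_zero, bil_S1_lift, hn]
  simp [isoLift, invTransl, bil]
  ring

/-- A transvection is by definition `1 + X S₁` with `X` built from `e`, `a`, `c`, so integral data
satisfy the congruence condition automatically. Only the preservation of the half-space has to be
supplied. -/
theorem transv_mem_discKernel (hS : IsMaximalEven S) {e a : Ext (Ext (Fin n)) → ℤ} {c : ℤ}
    (he : quad (S1 ℤ S) e = 0) (hea : bil (S1 ℤ S) e a = 0) (hc : quad (S1 ℤ S) a = 2 * c)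
    {M : Matrix (Ext (Ext (Fin n))) (Ext (Ext (Fin n))) ℝ}
    (hM : M = transv (S1 ℝ S) (fun i => (e i : ℝ)) (fun i => (a i : ℝ)) (c : ℝ))
    (h1 : ∀ w ∈ halfSpace S, act S M w ∈ halfSpace S)
    (h2 : ∀ w ∈ halfSpace S, ∃ w' ∈ halfSpace S, act S M w' = w) : M ∈ discKernel S := by
  have tr : ∀ x y : Ext (Ext (Fin n)) → ℤ, bil (S1 ℝ S) (fun i => (x i : ℝ)) (fun i => (y i : ℝ))
      = ((bil (S1 ℤ S) x y : ℤ) : ℝ) := by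
    intro x y
    have := bil_map (Int.castRingHom ℝ) (S1 ℤ S) x y
    rw [S1_map] at this
    exact this
  have he' : quad (S1 ℝ S) (fun i => (e i : ℝ)) = 0 := by
    rw [quad_eq_bil] at he ⊢; rw [tr, he]; simp
  have hea' : bil (S1 ℝ S) (fun i => (e i : ℝ)) (fun i => (a i : ℝ)) = 0 := by
    rw [tr, hea]; simp
  have hc' : quad (S1 ℝ S) (fun i => (a i : ℝ)) = 2 * (c : ℝ) := by
    rw [quad_eq_bil] at hc ⊢; rw [tr, hc]; push_cast; ring
  refine ⟨⟨?_, ?_, ?_⟩, vecMulVec a e - vecMulVec e a - c • vecMulVec e e, ?_⟩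
  · rw [hM]; exact transv_orth (S1_transpose ℝ hS) he' hea' hc'
  · rw [hM]; exact det_transv (S1_transpose ℝ hS) (S1_det_ne_zero hS) he' hea' hc'
  · refine Set.Subset.antisymm ?_ fun w hw => ?_
    · rintro _ ⟨w, hw, rfl⟩
      exact h1 w hw
    · obtain ⟨w', hw', h⟩ := h2 w hw
      exact ⟨w', hw', h⟩
  · rw [hM, transv]
    congr 2
    ext i j
    simp [vecMulVec_apply, -zsmul_eq_mul]

end Lift

/-! ### Three families of elements of the discriminant kernel. -/

section Mem

variable {n : ℕ} {S : Matrix (Fin n) (Fin n) ℤ}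

theorem bil_int_cast (x y : Ext (Fin n) → ℤ) :
    bil (S0 ℝ S) (fun i => (x i : ℝ)) (fun i => (y i : ℝ)) = ((bil (S0 ℤ S) x y : ℤ) : ℝ) := by
  have := bil_map (Int.castRingHom ℝ) (S0 ℤ S) x y
  rw [S0_map] at this
  exact this

theorem quad_int_cast (x : Ext (Fin n) → ℤ) :
    quad (S0 ℝ S) (fun i => (x i : ℝ)) = ((quad (S0 ℤ S) x : ℤ) : ℝ) := bil_int_cast x x

theorem cast_colVec {ι : Type} [Fintype ι] (a : ℤ) (x : ι → ℤ) (b : ℤ) :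
    (fun i => ((colVec a x b i : ℤ) : ℝ)) = colVec (a : ℝ) (fun i => (x i : ℝ)) (b : ℝ) :=
  funext (ext_cases rfl (fun _ => rfl) rfl)

theorem bil_S1_colVec {R : Type} [CommRing R] (a b a' b' : R) (x x' : Ext (Fin n) → R) :
    bil (S1 R S) (colVec a x b) (colVec a' x' b') = a * b' + bil (S0 R S) x x' + b * a' := by
  rw [S1, bil_addHyp]; rfl

theorem add_real_mem_halfSpace {w : Ext (Fin n) → ℂ} (hw : w ∈ halfSpace S)
    (v : Ext (Fin n) → ℝ) : w + cv v ∈ halfSpace S := by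
  have : (fun i => ((w + cv v) i).im) = fun i => (w i).im := by
    funext i; simp [cv]
  change (fun i => ((w + cv v) i).im) ∈ cone S
  rw [this]
  exact hw

theorem transl_mem (hS : IsMaximalEven S) (v : Ext (Fin n) → ℤ) :
    ∃ M ∈ discKernel S, ∀ w, autFactor S M w = 1 ∧ act S M w = w + cv (fun i => (v i : ℝ)) := by
  obtain ⟨c, hc⟩ := S0_even hS v
  set v' : Ext (Fin n) → ℝ := fun i => (v i : ℝ) with hv'
  have hact := fun w => transl_transv_act (S := S) v' c w
  refine ⟨_, transv_mem_discKernel hS (e := colVec 1 0 0) (a := colVec 0 v 0) (c := c)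
    ?_ ?_ ?_ (M := transv (S1 ℝ S) (colVec 1 0 0) (colVec 0 v' 0) c) ?_ (fun w hw => ?_)
    fun w hw => ?_, hact⟩
  · rw [quad_eq_bil, bil_S1_colVec]; simp [bil]
  · rw [bil_S1_colVec]; simp [bil]
  · rw [quad_eq_bil, bil_S1_colVec, ← quad_eq_bil, hc]; simp
  · simp only [cast_colVec]
    congr
    · simp
    · funext i; simp
    · simp
    · simp
    · simp
  · rw [(hact w).2]; exact add_real_mem_halfSpace hw v'
  · refine ⟨w + cv (-v'), add_real_mem_halfSpace hw _, ?_⟩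
    rw [(hact _).2]
    funext i; simp [cv]

/-- Connectedness: scaling `a` by `t` joins the transvection to the identity. Along this path the
norm stays positive, so the first coordinate never vanishes and keeps its sign. -/
theorem transv_mem_cone (hS : IsMaximalEven S) {e a : Ext (Fin n) → ℝ} {c : ℝ}
    (he : quad (S0 ℝ S) e = 0) (hea : bil (S0 ℝ S) e a = 0) (hc : quad (S0 ℝ S) a = 2 * c)
    {v : Ext (Fin n) → ℝ} (hv : v ∈ cone S) : transv (S0 ℝ S) e a c *ᵥ v ∈ cone S := by
  set P : ℝ → Ext (Fin n) → ℝ := fun t => transv (S0 ℝ S) e (t • a) (t ^ 2 * c) *ᵥ v with hP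
  have hq : ∀ t, quad (S0 ℝ S) (P t) = quad (S0 ℝ S) v := by
    intro t
    rw [quad_eq_bil, hP, ← bil_conj, transv_orth (S0_transpose ℝ hS) he, quad_eq_bil]
    · rw [bil_smul_right, hea, mul_zero]
    · rw [quad_eq_bil] at hc ⊢
      rw [bil_smul_right, bil_smul_left, hc]; ring
  have hcont : Continuous fun t => P t fst := by
    simp only [hP, transv_mulVec, bil_smul_left]
    simp only [Pi.add_apply, Pi.sub_apply, Pi.smul_apply, smul_eq_mul]
    fun_prop
  have hne : ∀ t, P t fst ≠ 0 := by
    intro t h0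
    have h := hq t
    have hv1 := hv.1
    rw [← h, quad_S0, h0] at hv1
    have := S_nonneg hS (fun i => P t (mid i))
    nlinarith
  have h0 : 0 < P 0 fst := by
    have : P 0 = v := by
      simp [hP, transv_mulVec, bil]
    rw [this]; exact hv.2.1
  have h1 : 0 < P 1 fst := by
    by_contra h
    obtain ⟨t, ht⟩ := mem_range_of_exists_le_of_exists_ge hcont ⟨1, not_lt.1 h⟩ ⟨0, h0.le⟩
    exact hne t ht
  have e1 : P 1 = transv (S0 ℝ S) e a c *ᵥ v := by simp [hP]
  rw [← e1, mem_cone_iff_fst hS (by rw [hq]; exact hv.1)]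
  exact h1

theorem transv_im (e a : Ext (Fin n) → ℝ) (c : ℝ) (w : Ext (Fin n) → ℂ) :
    (fun i => ((transv (S0 ℂ S) (cv e) (cv a) (c : ℂ) *ᵥ w) i).im)
      = transv (S0 ℝ S) e a c *ᵥ fun i => (w i).im := by
  funext i
  rw [transv_mulVec, transv_mulVec]
  simp only [Pi.add_apply, Pi.sub_apply, Pi.smul_apply, smul_eq_mul, cv, Complex.add_im,
    Complex.sub_im, Complex.im_mul_ofReal, Complex.im_ofReal_mul]
  rw [bil_cv_im, bil_cv_im]

theorem transv_mem_halfSpace (hS : IsMaximalEven S) {e a : Ext (Fin n) → ℝ} {c : ℝ}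
    (he : quad (S0 ℝ S) e = 0) (hea : bil (S0 ℝ S) e a = 0) (hc : quad (S0 ℝ S) a = 2 * c)
    {w : Ext (Fin n) → ℂ} (hw : w ∈ halfSpace S) :
    transv (S0 ℂ S) (cv e) (cv a) (c : ℂ) *ᵥ w ∈ halfSpace S := by
  change (fun i => ((transv (S0 ℂ S) (cv e) (cv a) (c : ℂ) *ᵥ w) i).im) ∈ cone S
  rw [transv_im]
  exact transv_mem_cone hS he hea hc hw

theorem transv_neg_mul {ι R : Type} [Fintype ι] [DecidableEq ι] [CommRing R] {T : Matrix ι ι R}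
    (hT : Tᵀ = T) {e a : ι → R} {c : R}
    (he : quad T e = 0) (hea : bil T e a = 0) (hc : quad T a = 2 * c) (x : ι → R) :
    transv T e a c *ᵥ (transv T e (-a) c *ᵥ x) = x := by
  rw [quad_eq_bil] at he hc
  have hae : bil T a e = 0 := by rw [bil_comm hT, hea]
  simp only [transv_mulVec, bil_add_right, bil_sub_right, bil_smul_right, he, hea, hae, hc,
    bil_neg_left, bil_neg_right]
  ext i
  simp
  ring

theorem linear_transv_mem (hS : IsMaximalEven S) {e a : Ext (Fin n) → ℤ} {c : ℤ}
    (he : quad (S0 ℤ S) e = 0) (hea : bil (S0 ℤ S) e a = 0) (hc : quad (S0 ℤ S) a = 2 * c) :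
    ∃ M ∈ discKernel S, ∀ w, autFactor S M w = 1 ∧ act S M w =
      transv (S0 ℂ S) (fun i => (e i : ℂ)) (fun i => (a i : ℂ)) (c : ℂ) *ᵥ w := by
  set e' : Ext (Fin n) → ℝ := fun i => (e i : ℝ) with he'
  set a' : Ext (Fin n) → ℝ := fun i => (a i : ℝ) with ha'
  have h1 : quad (S0 ℝ S) e' = 0 := by rw [he', quad_int_cast, he]; simp
  have h2 : bil (S0 ℝ S) e' a' = 0 := by rw [he', ha', bil_int_cast, hea]; simp
  have h3 : quad (S0 ℝ S) a' = 2 * (c : ℝ) := by rw [ha', quad_int_cast, hc]; push_cast; ring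
  have hact := fun w => linear_transv_act (S := S) e' a' (c : ℝ) w
  have hce : cv e' = fun i => (e i : ℂ) := by funext i; simp [cv, he']
  have hca : cv a' = fun i => (a i : ℂ) := by funext i; simp [cv, ha']
  have hcc : ((c : ℝ) : ℂ) = (c : ℂ) := by simp
  refine ⟨_, transv_mem_discKernel hS (e := colVec 0 e 0) (a := colVec 0 a 0) (c := c)
    ?_ ?_ ?_ (M := transv (S1 ℝ S) (colVec 0 e' 0) (colVec 0 a' 0) (c : ℝ)) ?_ (fun w hw => ?_)
    fun w hw => ?_, fun w => ?_⟩
  · rw [quad_eq_bil, bil_S1_colVec, ← quad_eq_bil, he]; simp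
  · rw [bil_S1_colVec, hea]; simp
  · rw [quad_eq_bil, bil_S1_colVec, ← quad_eq_bil, hc]; simp
  · simp only [cast_colVec, Int.cast_zero]
    rfl
  · rw [(hact w).2]; exact transv_mem_halfSpace hS h1 h2 h3 hw
  · refine ⟨transv (S0 ℂ S) (cv e') (cv (-a')) ((c : ℝ) : ℂ) *ᵥ w, transv_mem_halfSpace hS h1
      (by rw [bil_neg_right, h2, neg_zero])
      (by rw [quad_eq_bil] at h3 ⊢; rw [bil_neg_right, bil_neg_left, h3]; ring) hw, ?_⟩
    have hn : cv (-a') = -cv a' := by funext i; simp [cv]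
    rw [(hact _).2, hn]
    refine transv_neg_mul (S0_transpose ℂ hS) ?_ ?_ ?_ w
    · rw [quad_eq_bil, bil_cv, ← quad_eq_bil, h1]; simp
    · rw [bil_cv, h2]; simp
    · rw [quad_eq_bil, bil_cv, ← quad_eq_bil, h3]; push_cast; ring
  · rw [← hce, ← hca, ← hcc]
    exact hact w

/-- Entrywise complex conjugation. -/
noncomputable def conjv {ι : Type} (w : ι → ℂ) : ι → ℂ := fun i => (starRingEnd ℂ) (w i)

theorem bil_conjv (x y : Ext (Fin n) → ℂ) :
    bil (S0 ℂ S) (conjv x) (conjv y) = (starRingEnd ℂ) (bil (S0 ℂ S) x y) := by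
  have := bil_map (starRingEnd ℂ) (S0 ℂ S) x y
  rw [S0_map] at this
  exact this

theorem conjv_cv {ι : Type} (x : ι → ℝ) : conjv (cv x) = cv x := by
  funext i; simp [conjv, cv]

/-- With the norm of the imaginary part written through `w` and its conjugate, its behaviour under a
fractional map becomes an algebraic identity. -/
theorem quad_im_eq (hS : IsMaximalEven S) (w : Ext (Fin n) → ℂ) :
    ((quad (S0 ℝ S) (fun i => (w i).im) : ℝ) : ℂ) =
      (2 * bil (S0 ℂ S) w (conjv w) - bil (S0 ℂ S) w w - bil (S0 ℂ S) (conjv w) (conjv w)) / 4 := by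
  have h : cv (fun i => (w i).im) = (-Complex.I / 2) • (w - conjv w) := by
    funext i
    apply Complex.ext <;> simp [cv, conjv] <;> ring
  rw [quad_eq_bil, ← bil_cv, h]
  simp only [bil_smul_left, bil_smul_right, bil_sub_left, bil_sub_right,
    bil_comm (S0_transpose ℂ hS) (conjv w) w]
  linear_combination (bil (S0 ℂ S) w w - 2 * bil (S0 ℂ S) w (conjv w)
    + bil (S0 ℂ S) (conjv w) (conjv w)) / 4 * Complex.I_sq

/-- Write `s = (c, w)` and `D = 1 + t s`. The map sends `S₀[w]` to `S₀[w] / D`, `s` to `s / D`, and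
divides both the norm of the imaginary part and `Im s` by `|D|²`. By `hpos`, positivity of these two
quantities is membership in the half-space. The scalar `t` serves to cover the inverse, `t = -1`. -/
theorem invTransl_mem (hS : IsMaximalEven S) {c : Ext (Fin n) → ℝ} (hc : quad (S0 ℝ S) c = 0)
    (hpos : ∀ v, 0 < quad (S0 ℝ S) v → (v ∈ cone S ↔ 0 < bil (S0 ℝ S) c v)) (t : ℝ)
    {w : Ext (Fin n) → ℂ} (hw : w ∈ halfSpace S) :
    1 + bil (S0 ℂ S) (cv (t • c)) w ≠ 0 ∧ invTransl S (t • c) w ∈ halfSpace S ∧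
      invTransl S (-(t • c)) (invTransl S (t • c) w) = w := by
  have hsm : cv (t • c) = (t : ℂ) • cv c := by funext i; simp [cv]
  set s := bil (S0 ℂ S) (cv c) w with hs
  have hsi : 0 < s.im := by
    rw [hs, bil_cv_im]
    exact (hpos _ hw.1).1 hw
  have hD : bil (S0 ℂ S) (cv (t • c)) w = t * s := by rw [hsm, bil_smul_left]
  have hD0 : 1 + (t : ℂ) * s ≠ 0 := by
    intro h
    have him := congrArg Complex.im h
    have hre := congrArg Complex.re h
    simp at him hre
    rcases him with h | h
    · rw [h] at hre; simp at hre
    · exact hsi.ne' h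
  set D := 1 + (t : ℂ) * s with hDd
  have hDc : (starRingEnd ℂ) D ≠ 0 := by simpa using hD0
  have hcc : bil (S0 ℂ S) (cv c) (cv c) = 0 := by
    rw [bil_cv, ← quad_eq_bil, hc]; simp
  set Q := quad (S0 ℂ S) w with hQ
  have hQ' : bil (S0 ℂ S) w w = Q := rfl
  have hw' : invTransl S (t • c) w = D⁻¹ • (w + (1 / 2 * Q * t) • cv c) := by
    rw [invTransl, hD, hsm, smul_smul]
  have hwc : bil (S0 ℂ S) w (cv c) = s := by rw [bil_comm (S0_transpose ℂ hS)]
  have hcs : bil (S0 ℂ S) (cv c) (D⁻¹ • (w + (1 / 2 * Q * t) • cv c)) = D⁻¹ * s := by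
    rw [bil_smul_right, bil_add_right, bil_smul_right, hcc, mul_zero, add_zero]
  have hqq : bil (S0 ℂ S) (D⁻¹ • (w + (1 / 2 * Q * t) • cv c)) (D⁻¹ • (w + (1 / 2 * Q * t) • cv c))
      = D⁻¹ * Q := by
    simp only [bil_smul_left, bil_smul_right, bil_add_left, bil_add_right, hcc, hwc, hQ', ← hs]
    field_simp
    rw [hDd]; ring
  refine ⟨by rw [hD]; exact hD0, ?_, ?_⟩
  · have hquad : quad (S0 ℝ S) (fun i => (invTransl S (t • c) w i).im)
        = quad (S0 ℝ S) (fun i => (w i).im) / Complex.normSq D := by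
      have e1 := quad_im_eq hS (invTransl S (t • c) w)
      have e2 := quad_im_eq hS w
      have hcw : conjv (D⁻¹ • (w + (1 / 2 * Q * t) • cv c))
          = ((starRingEnd ℂ) D)⁻¹ • (conjv w + (1 / 2 * (starRingEnd ℂ) Q * t) • cv c) := by
        funext i; simp [conjv, cv, map_ofNat]
      have hcw1 : bil (S0 ℂ S) (cv c) (conjv w) = (starRingEnd ℂ) s := by
        rw [← conjv_cv c, bil_conjv]
      rw [hw', bil_conjv, hqq, hcw] at e1
      rw [bil_conjv, hQ'] at e2
      simp only [bil_smul_left, bil_smul_right, bil_add_left, bil_add_right, hcc, hwc, hcw1] at e1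
      have hDs : (starRingEnd ℂ) D = 1 + t * (starRingEnd ℂ) s := by
        rw [hDd]; simp
      have : ((quad (S0 ℝ S) (fun i => (invTransl S (t • c) w i).im) : ℝ) : ℂ)
        = ((quad (S0 ℝ S) (fun i => (w i).im) / Complex.normSq D : ℝ) : ℂ) := by
        rw [Complex.ofReal_div, Complex.normSq_eq_conj_mul_self, hw', e1, e2]
        simp only [map_mul, map_inv₀]
        field_simp
        rw [hDs, hDd]
        ring
      exact_mod_cast this
    have hp : 0 < Complex.normSq D := Complex.normSq_pos.2 hD0
    have hq0 : 0 < quad (S0 ℝ S) (fun i => (invTransl S (t • c) w i).im) := by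
      rw [hquad]
      exact div_pos hw.1 hp
    change (fun i => (invTransl S (t • c) w i).im) ∈ cone S
    rw [hpos _ hq0, ← bil_cv_im, hw', hcs]
    have : (D⁻¹ * s).im = s.im / Complex.normSq D := by
      rw [Complex.mul_im, Complex.inv_re, Complex.inv_im]
      have h1 : D.re = 1 + t * s.re := by simp [hDd]
      have h2 : D.im = t * s.im := by simp [hDd]
      rw [h1, h2]
      field_simp
      ring
    rw [this]
    exact div_pos hsi hp
  · have hneg : cv (-(t • c)) = (-(t : ℂ)) • cv c := by funext i; simp [cv]
    rw [hw', invTransl, hneg, bil_smul_left, hcs, quad_eq_bil, hqq]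
    -- The denominator of the inverse map at the image point is `D⁻¹`, so the two denominators
    -- cancel.
    have : 1 + -(t : ℂ) * (D⁻¹ * s) = D⁻¹ := by
      field_simp; rw [hDd]; ring
    rw [this, inv_inv]
    funext i
    simp only [Pi.smul_apply, Pi.add_apply, smul_eq_mul]
    field_simp
    ring

theorem lower_mem (hS : IsMaximalEven S) {c : Ext (Fin n) → ℤ} (hc : quad (S0 ℤ S) c = 0)
    (hpos : ∀ v, 0 < quad (S0 ℝ S) v →
      (v ∈ cone S ↔ 0 < bil (S0 ℝ S) (fun i => (c i : ℝ)) v)) :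
    ∃ M ∈ discKernel S, ∀ w, autFactor S M w = 1 + bil (S0 ℂ S) (fun i => (c i : ℂ)) w ∧
      act S M w = invTransl S (fun i => (c i : ℝ)) w := by
  set c' : Ext (Fin n) → ℝ := fun i => (c i : ℝ) with hcd
  have h1 : quad (S0 ℝ S) c' = 0 := by rw [hcd, quad_int_cast, hc]; simp
  have hact := fun w => lower_transv_act (S := S) c' w
  have hce : cv c' = fun i => (c i : ℂ) := by funext i; simp [cv, hcd]
  refine ⟨_, transv_mem_discKernel hS (e := colVec 0 0 1) (a := colVec 0 (-c) 0) (c := 0)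
    ?_ ?_ ?_ (M := transv (S1 ℝ S) (colVec 0 0 1) (colVec 0 (-c') 0) 0) ?_ (fun w hw => ?_)
    fun w hw => ?_, fun w => ?_⟩
  · rw [quad_eq_bil, bil_S1_colVec]; simp [bil]
  · rw [bil_S1_colVec]; simp [bil]
  · rw [quad_eq_bil, bil_S1_colVec, bil_neg_left, bil_neg_right, ← quad_eq_bil, hc]; simp
  · simp only [cast_colVec, Int.cast_zero, Int.cast_one]
    congr
    · funext i; simp
    · funext i; simp [hcd]
  · rw [(hact w).2]
    have := (invTransl_mem hS h1 hpos 1 hw).2.1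
    simpa using this
  · have h2 := (invTransl_mem hS h1 hpos (-1) hw).2
    simp only [neg_smul, one_smul, neg_neg] at h2
    exact ⟨_, h2.1, by rw [(hact _).2]; exact h2.2⟩
  · rw [← hce]
    exact hact w

end Mem

end OrthMaass

namespace OrthMaass

open Matrix Filter Topology

/-! ### Invariance of Fourier coefficients and the Koecher principle. -/

section TubeUnique

variable {ι : Type} [Fintype ι]

theorem eq_tubeCoeff {b : (ι → ℤ) → ℂ} {y : ι → ℝ} {f : (ι → ℂ) → ℂ}
    (h : ∀ u, HasSum (fun g => b g * cexpo g (cpt u y)) (f (cpt u y))) (g : ι → ℤ) :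
    tubeCoeff f y g = b g := by
  refine coeff_eq_integral (φ := fun u => f (cpt u y)) ?_ h g
  refine (h 0).summable.norm.congr fun g => ?_
  rw [norm_mul, norm_cexpo]
  simp only [cpt_im]

end TubeUnique

section Coeff

variable {n : ℕ} {S : Matrix (Fin n) (Fin n) ℤ} {k : ℕ} {f : (Ext (Fin n) → ℂ) → ℂ}

/-- The Fourier coefficient of `f` with frequency vector `g = S₀ λ`. -/
noncomputable def freqCoeff (f : (Ext (Fin n) → ℂ) → ℂ) (g : Ext (Fin n) → ℤ) : ℂ :=
  tubeCoeff f (colVec 1 0 1) g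

theorem slash_of_autFactor {M : Matrix (Ext (Ext (Fin n))) (Ext (Ext (Fin n))) ℝ}
    (hf : IsModularForm S k f) (hM : M ∈ discKernel S) {w : Ext (Fin n) → ℂ}
    (hw : w ∈ halfSpace S) (h0 : autFactor S M w ≠ 0) :
    f (act S M w) = autFactor S M w ^ k * f w := by
  have := hf.slash_eq M hM w hw
  rw [slash] at this
  rw [← this]
  field_simp

theorem IsModularForm.intPeriodic (hS : IsMaximalEven S) (hf : IsModularForm S k f) :
    IntPeriodic (cone S) f := by
  intro w hw a
  obtain ⟨M, hM, h⟩ := transl_mem hS a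
  have := slash_of_autFactor hf hM (w := w) hw (by rw [(h w).1]; exact one_ne_zero)
  rw [(h w).1, (h w).2, one_pow, one_mul] at this
  rw [← this]
  congr 1

theorem hasSum_freqCoeff (hS : IsMaximalEven S) (hf : IsModularForm S k f) {w : Ext (Fin n) → ℂ}
    (hw : w ∈ halfSpace S) : HasSum (fun g => freqCoeff f g * cexpo g w) (f w) :=
  hasSum_tubeCoeff isOpen_cone (convex_cone hS) hf.holo (hf.intPeriodic hS) basePt_mem_cone hw

theorem cexpo_mulVec {ι : Type} [Fintype ι] (K : Matrix ι ι ℤ) (g : ι → ℤ) (w : ι → ℂ) :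
    cexpo g (K.map (Int.cast : ℤ → ℂ) *ᵥ w) = cexpo (Kᵀ *ᵥ g) w := by
  rw [cexpo, cexpo]
  congr 2
  change (fun i => (g i : ℂ)) ⬝ᵥ (K.map (Int.cast : ℤ → ℂ) *ᵥ w) = (fun i => ((Kᵀ *ᵥ g) i : ℂ)) ⬝ᵥ w
  rw [dotProduct_mulVec, ← mulVec_transpose]
  congr 1
  funext i
  simp [mulVec, dotProduct]

/-- Substituting `K w` permutes the characters by `Kᵀ`; comparing the two expansions of the same
function gives the invariance. -/
theorem freqCoeff_mulVec {b : (Ext (Fin n) → ℤ) → ℂ} {f : (Ext (Fin n) → ℂ) → ℂ}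
    (hsum : ∀ w ∈ halfSpace S, HasSum (fun g => b g * cexpo g w) (f w))
    {K K' : Matrix (Ext (Fin n)) (Ext (Fin n)) ℤ} (h1 : K * K' = 1) (h2 : K' * K = 1)
    (hmem : ∀ w ∈ halfSpace S, K.map (Int.cast : ℤ → ℂ) *ᵥ w ∈ halfSpace S)
    (hK : ∀ w ∈ halfSpace S, f (K.map (Int.cast : ℤ → ℂ) *ᵥ w) = f w) (g : Ext (Fin n) → ℤ) :
    b (Kᵀ *ᵥ g) = b g := by
  have e1 : ∀ g, tubeCoeff f (colVec 1 0 1) g = b g :=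
    eq_tubeCoeff fun u => hsum _ (cpt_mem_tube basePt_mem_cone u)
  have h1' : K'ᵀ * Kᵀ = 1 := by rw [← transpose_mul, h1, transpose_one]
  have h2' : Kᵀ * K'ᵀ = 1 := by rw [← transpose_mul, h2, transpose_one]
  let E : (Ext (Fin n) → ℤ) ≃ (Ext (Fin n) → ℤ) :=
    { toFun := fun g => K'ᵀ *ᵥ g
      invFun := fun g => Kᵀ *ᵥ g
      left_inv := fun g => by simp [h2']
      right_inv := fun g => by simp [h1'] }
  have e2 : ∀ g, tubeCoeff f (colVec 1 0 1) g = b (K'ᵀ *ᵥ g) := by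
    refine eq_tubeCoeff (b := fun g => b (K'ᵀ *ᵥ g)) fun u => ?_
    have hw : cpt u (colVec 1 0 1) ∈ halfSpace S := cpt_mem_tube basePt_mem_cone u
    have := hsum _ (hmem _ hw)
    rw [hK _ hw] at this
    simp only [cexpo_mulVec] at this
    rw [← E.hasSum_iff] at this
    convert this using 2 with g'
    simp [E, h2']
  have := e2 (Kᵀ *ᵥ g)
  rw [e1] at this
  rw [this, mulVec_mulVec, h1', one_mulVec]

theorem freqCoeff_transv (hS : IsMaximalEven S) (hf : IsModularForm S k f)
    {e a : Ext (Fin n) → ℤ} {c : ℤ}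
    (he : quad (S0 ℤ S) e = 0) (hea : bil (S0 ℤ S) e a = 0) (hc : quad (S0 ℤ S) a = 2 * c)
    (g : Ext (Fin n) → ℤ) :
    freqCoeff f ((transv (S0 ℤ S) e a c)ᵀ *ᵥ g) = freqCoeff f g := by
  obtain ⟨M, hM, h⟩ := linear_transv_mem hS he hea hc
  have hmap : (transv (S0 ℤ S) e a c).map (Int.cast : ℤ → ℂ) =
      transv (S0 ℂ S) (fun i => (e i : ℂ)) (fun i => (a i : ℂ)) (c : ℂ) := by
    have := transv_map (Int.castRingHom ℂ) (S0 ℤ S) e a c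
    rw [S0_map] at this
    exact this
  have hn : quad (S0 ℤ S) (-a) = 2 * c := by
    rw [quad_eq_bil] at hc ⊢; rw [bil_neg_left, bil_neg_right, hc]; ring
  have hea' : bil (S0 ℤ S) e (-a) = 0 := by rw [bil_neg_right, hea, neg_zero]
  have hT := S0_transpose ℤ hS
  refine freqCoeff_mulVec (f := f) (fun w hw => hasSum_freqCoeff hS hf hw)
    (K' := transv (S0 ℤ S) e (-a) c) ?_ ?_ (fun w hw => ?_) (fun w hw => ?_) g
  · refine Matrix.mulVec_injective (funext fun x => ?_)
    rw [← mulVec_mulVec, transv_neg_mul hT he hea hc, one_mulVec]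
  · refine Matrix.mulVec_injective (funext fun x => ?_)
    have := transv_neg_mul hT he hea' hn x
    rw [neg_neg] at this
    rw [← mulVec_mulVec, this, one_mulVec]
  · rw [hmap, ← (h w).2]
    have : act S M '' halfSpace S = halfSpace S := hM.1.2.2
    rw [← this]
    exact ⟨w, hw, rfl⟩
  · rw [hmap, ← (h w).2, slash_of_autFactor hf hM hw (by rw [(h w).1]; exact one_ne_zero), (h w).1,
      one_pow, one_mul]

/-- The transvections with `j a`, `j ∈ ℕ`, move `g` to frequencies with the same coefficient. The
pairing of these with the base height `q` is a quadratic polynomial in `j` whose leading coefficient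
`-Z` is negative. The bound from `norm_tubeCoeff_le` therefore tends to zero. -/
theorem freqCoeff_eq_zero_of_transv (hS : IsMaximalEven S) (hf : IsModularForm S k f)
    {e a g : Ext (Fin n) → ℤ} (he : quad (S0 ℤ S) e = 0) (hea : bil (S0 ℤ S) e a = 0)
    (ha : quad (S0 ℤ S) a < 0) (hy : 0 < e fst + e lst) (hg : g ⬝ᵥ e < 0) : freqCoeff f g = 0 := by
  obtain ⟨c, hc⟩ := S0_even hS a
  have hc0 : c < 0 := by omega
  obtain ⟨B, -, hB⟩ := norm_tubeCoeff_le (C := cone S) hf.holo basePt_mem_cone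
  set q : (Ext (Fin n) → ℤ) := colVec 1 0 1 with hq
  have hey : bil (S0 ℤ S) e q = e fst + e lst := by
    rw [bil_S0]; simp [hq, bil, mulVec, dotProduct]
  set X := g ⬝ᵥ q
  set Y := bil (S0 ℤ S) e q * (g ⬝ᵥ a) - bil (S0 ℤ S) a q * (g ⬝ᵥ e)
  set Z := c * bil (S0 ℤ S) e q * (g ⬝ᵥ e) with hZ
  -- Here the two negative signs, of the norm of `a` and of `g ⬝ᵥ e`, combine.
  have hZ0 : 0 < Z := by
    rw [hZ, hey]
    exact mul_pos_of_neg_of_neg (mul_neg_of_neg_of_pos hc0 hy) hg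
  have key : ∀ j : ℕ, ‖freqCoeff f g‖ ≤
      B * Real.exp (2 * Real.pi * ((X : ℝ) + j * (Y - j * Z))) := by
    intro j
    have h1 := freqCoeff_transv hS hf (a := (j : ℤ) • a) (c := (j : ℤ) ^ 2 * c) he
      (by rw [bil_smul_right, hea, mul_zero])
      (by rw [quad_eq_bil] at hc ⊢; rw [bil_smul_right, bil_smul_left, hc]; ring) g
    rw [← h1]
    refine (hB _).trans (le_of_eq ?_)
    congr 3
    have h2 : ∀ g' : Ext (Fin n) → ℤ, ∑ i, (g' i : ℝ) * (colVec 1 0 1 : Ext (Fin n) → ℝ) i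
        = ((g' ⬝ᵥ q : ℤ) : ℝ) := by
      intro g'
      rw [sum_ext, dotProduct, sum_ext]
      simp [hq]
    rw [h2]
    have h3 : ((transv (S0 ℤ S) e ((j : ℤ) • a) ((j : ℤ) ^ 2 * c))ᵀ *ᵥ g) ⬝ᵥ q
        = X + j * (Y - j * Z) := by
      rw [mulVec_transpose, ← dotProduct_mulVec, transv_mulVec, bil_smul_left]
      simp only [dotProduct_add, dotProduct_sub, dotProduct_smul, smul_eq_mul, X, Y, Z]
      ring
    rw [h3]
    push_cast
    ring
  have hlim : Tendsto (fun j : ℕ => B * Real.exp (2 * Real.pi * ((X : ℝ) + j * (Y - j * Z)))) atTop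
      (𝓝 0) := by
    rw [← mul_zero B]
    refine Tendsto.const_mul _ (Real.tendsto_exp_atBot.comp ?_)
    refine Tendsto.const_mul_atBot (by positivity) (tendsto_atBot_add_const_left _ _ ?_)
    refine Tendsto.atTop_mul_atBot₀ tendsto_natCast_atTop_atTop ?_
    have hZ' : (0 : ℝ) < Z := by exact_mod_cast hZ0
    have : Tendsto (fun j : ℕ => -((j : ℝ) * Z)) atTop atBot :=
      tendsto_neg_atTop_atBot.comp (tendsto_natCast_atTop_atTop.atTop_mul_const hZ')
    simpa [sub_eq_add_neg] using tendsto_atBot_add_const_left _ (Y : ℝ) this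
  have := ge_of_tendsto' hlim key
  exact norm_eq_zero.1 (le_antisymm this (norm_nonneg _))

theorem quad_S_pos (hS : IsMaximalEven S) {x : Fin n → ℤ} (hx : x ≠ 0) : 0 < quad S x := by
  have h := S_pos hS (x := fun i => (x i : ℝ)) (fun h => hx (funext fun i => by
    have := congrFun h i; simpa using this))
  have := bil_map (Int.castRingHom ℝ) S x x
  rw [quad_eq_bil] at h
  have h2 : bil (S.map (Int.cast : ℤ → ℝ)) (fun i => (x i : ℝ)) (fun i => (x i : ℝ))
    = ((bil S x x : ℤ) : ℝ) := this
  rw [h2] at h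
  exact_mod_cast h

theorem map_intCast_self (S : Matrix (Fin n) (Fin n) ℤ) : S.map (Int.cast : ℤ → ℤ) = S := by
  ext; simp

/-- The vector `(s, b y, b²)` is isotropic because `S[y] = 2s`. The witness `a = (S(y, x), b x, 0)`
is orthogonal to it and has norm `-b² S[x] < 0`; any nonzero `x` would do. -/
theorem freqCoeff_eq_zero_of_cusp (hn : 1 ≤ n) (hS : IsMaximalEven S) (hf : IsModularForm S k f)
    {g : Ext (Fin n) → ℤ} {s b : ℤ} {y : Fin n → ℤ} (hs : quad S y = 2 * s) (hb : b ≠ 0)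
    (hg : g ⬝ᵥ colVec s (b • y) (b ^ 2) < 0) : freqCoeff f g = 0 := by
  set x : Fin n → ℤ := Pi.single ⟨0, hn⟩ 1 with hx
  have hx0 : x ≠ 0 := by
    intro h
    have := congrFun h ⟨0, hn⟩
    simp [hx] at this
  have hxq := quad_S_pos hS hx0
  have hb2 : 0 < b ^ 2 := by positivity
  have hs0 : 0 ≤ s := by
    by_cases hy : y = 0
    · rw [hy] at hs; simp [quad] at hs; omega
    · have := quad_S_pos hS hy; omega
  refine freqCoeff_eq_zero_of_transv hS hf (e := colVec s (b • y) (b ^ 2))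
    (a := colVec (bil S y x) (b • x) 0) ?_ ?_ ?_ ?_ hg
  · rw [quad_S0]
    simp only [colVec_fst, colVec_mid, colVec_lst, map_intCast_self]
    have : quad S (fun i => (b • y) i) = b * (b * quad S y) := by
      change bil S (b • y) (b • y) = _
      rw [bil_smul_left, bil_smul_right]; rfl
    rw [this, hs]; ring
  · rw [bil_S0]
    simp only [colVec_fst, colVec_mid, colVec_lst, map_intCast_self]
    have : bil S (fun i => (b • y) i) (fun i => (b • x) i) = b * (b * bil S y x) := by
      change bil S (b • y) (b • x) = _
      rw [bil_smul_left, bil_smul_right]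
    rw [this]; ring
  · rw [quad_S0]
    simp only [colVec_fst, colVec_mid, colVec_lst, map_intCast_self]
    have : quad S (fun i => (b • x) i) = b * (b * quad S x) := by
      change bil S (b • x) (b • x) = _
      rw [bil_smul_left, bil_smul_right]; rfl
    rw [this]
    nlinarith
  · simp only [colVec_fst, colVec_lst]; omega

theorem freqCoeff_eq_zero_of_fst (hn : 1 ≤ n) (hS : IsMaximalEven S) (hf : IsModularForm S k f)
    {g : Ext (Fin n) → ℤ} (hg : g fst < 0) : freqCoeff f g = 0 := by
  set x : Fin n → ℤ := Pi.single ⟨0, hn⟩ 1 with hx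
  have hx0 : x ≠ 0 := by
    intro h
    have := congrFun h ⟨0, hn⟩
    simp [hx] at this
  have hxq := quad_S_pos hS hx0
  refine freqCoeff_eq_zero_of_transv hS hf (e := colVec 1 0 0)
    (a := colVec 0 x 0) ?_ ?_ ?_ ?_ ?_
  · rw [quad_S0]; simp [quad, dotProduct]
  · rw [bil_S0]; simp [bil, dotProduct]
  · rw [quad_S0]
    simp only [colVec_fst, colVec_mid, colVec_lst, map_intCast_self]
    change 2 * 0 * 0 - quad S x < 0
    omega
  · simp
  · rw [dotProduct, sum_ext]; simpa using hg

/-- The Koecher principle. -/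
theorem isNonneg_of_freqCoeff_ne_zero (hn : 1 ≤ n) (hS : IsMaximalEven S)
    (hf : IsModularForm S k f) {v : Ext (Fin n) → ℝ} {g : Ext (Fin n) → ℤ}
    (hg : S0 ℝ S *ᵥ v = fun i => (g i : ℝ)) (h0 : freqCoeff f g ≠ 0) : IsNonneg S v := by
  have hS0 : S0 ℝ S *ᵥ v = colVec (v lst)
      (-(S.map (Int.cast : ℤ → ℝ) *ᵥ fun i => v (mid i))) (v fst) := by
    rw [S0, addHyp_mulVec, neg_mulVec]
  rw [hS0] at hg
  have hm : v fst = g lst := congrFun hg lst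
  have hl : v lst = g fst := congrFun hg fst
  have hμ : S.map (Int.cast : ℤ → ℝ) *ᵥ (fun i => v (mid i)) = fun i => -(g (mid i) : ℝ) := by
    funext i
    have := congrFun hg (mid i)
    simp only [colVec_mid, Pi.neg_apply] at this
    linarith
  set μ : Fin n → ℝ := fun i => v (mid i) with hμd
  have hm0 : 0 ≤ g lst := by
    by_contra h
    refine h0 (freqCoeff_eq_zero_of_cusp hn hS hf (s := 0) (b := 1) (y := 0) (by simp [quad])
      one_ne_zero ?_)
    rw [dotProduct, sum_ext]; simpa using h
  have hl0 : 0 ≤ g fst := by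
    by_contra h
    exact h0 (freqCoeff_eq_zero_of_fst hn hS hf (not_le.1 h))
  refine ⟨by rw [hm]; exact_mod_cast hm0, by rw [hl]; exact_mod_cast hl0, ?_⟩
  by_contra hneg
  rw [quad_S0, not_le, hm, hl] at hneg
  change 2 * (g lst : ℝ) * g fst - quad _ μ < 0 at hneg
  set d := S.det with hd
  have hdpos : 0 < d := by
    have h1 := hS.posDef.det_pos
    have h2 : (S.map (Int.cast : ℤ → ℝ)).det = ((S.det : ℤ) : ℝ) := by
      have := (Int.castRingHom ℝ).map_det S
      exact this.symm
    rw [h2] at h1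
    exact_mod_cast h1
  -- Multiplying `μ` by `det S` clears its denominators, so that `y = d μ` can enter an integral
  -- isotropic vector.
  set y : Fin n → ℤ := S.adjugate *ᵥ fun i => -(g (mid i)) with hy
  have hyμ : (fun i => (y i : ℝ)) = (d : ℝ) • μ := by
    have h1 : S *ᵥ y = d • fun i => -(g (mid i)) := by
      rw [hy, mulVec_mulVec, mul_adjugate, smul_mulVec, one_mulVec]
    have h2 : S.map (Int.cast : ℤ → ℝ) *ᵥ ((fun i => (y i : ℝ)) - (d : ℝ) • μ) = 0 := by
      rw [mulVec_sub, mulVec_smul, hμ]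
      funext i
      have := congrFun h1 i
      have h3 : (S.map (Int.cast : ℤ → ℝ) *ᵥ (fun i => (y i : ℝ))) i = (((S *ᵥ y) i : ℤ) : ℝ) := by
        simp [mulVec, dotProduct]
      simp only [Pi.sub_apply, Pi.smul_apply, smul_eq_mul, Pi.zero_apply]
      rw [h3, this]
      simp
    exact sub_eq_zero.1 (S_injective hS _ h2)
  have hqr : ∀ t : ℤ, ((quad S (t • y) : ℤ) : ℝ) =
      (t * d) ^ 2 * quad (S.map (Int.cast : ℤ → ℝ)) μ := by
    intro t
    have h1 : ((quad S (t • y) : ℤ) : ℝ) = bil (S.map (Int.cast : ℤ → ℝ))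
        (fun i => (((t • y) i : ℤ) : ℝ)) (fun i => (((t • y) i : ℤ) : ℝ)) :=
      (bil_map (Int.castRingHom ℝ) S (t • y) (t • y)).symm
    have h2 : (fun i => (((t • y) i : ℤ) : ℝ)) = ((t : ℝ) * d) • μ := by
      rw [← smul_smul, ← hyμ]
      funext i; simp
    rw [h1, h2, bil_smul_left, bil_smul_right, quad_eq_bil]; ring
  have hgy : ∀ t : ℤ, ((∑ i, g (mid i) * (t • y) i : ℤ) : ℝ) =
      -(t * d * quad (S.map (Int.cast : ℤ → ℝ)) μ) := by
    intro t
    have h2 : ∀ i, (((t • y) i : ℤ) : ℝ) = (t : ℝ) * d * μ i := by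
      intro i
      have := congrFun hyμ i
      simp only [Pi.smul_apply, smul_eq_mul] at this ⊢
      push_cast
      rw [this]; ring
    push_cast [h2]
    rw [quad, hμ, dotProduct, Finset.mul_sum, ← Finset.sum_neg_distrib]
    refine Finset.sum_congr rfl fun i _ => ?_
    ring
  set q := quad (S.map (Int.cast : ℤ → ℝ)) μ with hq
  have hmr : (0 : ℝ) ≤ g lst := by exact_mod_cast hm0
  have hlr : (0 : ℝ) ≤ g fst := by exact_mod_cast hl0
  have hdr : (0 : ℝ) < d := by exact_mod_cast hdpos
  have hqpos : 0 < q := by nlinarith [mul_nonneg hmr hlr]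
  have fin : ∀ b t : ℤ, b ≠ 0 →
      (g fst : ℝ) * ((t * d) ^ 2 * q / 2) - b * (t * d * q) + g lst * b ^ 2 < 0 → False := by
    intro b t hb hlt
    obtain ⟨s, hs⟩ := S_even hS (t • y)
    refine h0 (freqCoeff_eq_zero_of_cusp hn hS hf (s := s) (b := b) (y := t • y)
      (by rw [hs]; ring) hb ?_)
    rw [dotProduct, sum_ext]
    simp only [colVec_fst, colVec_mid, colVec_lst]
    have hsr : (s : ℝ) = (t * d) ^ 2 * q / 2 := by
      have := hqr t
      rw [hs] at this
      push_cast at this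
      linarith
    have h1 : ∑ i, g (mid i) * (b • t • y) i = b * ∑ i, g (mid i) * (t • y) i := by
      rw [Finset.mul_sum]
      refine Finset.sum_congr rfl fun i _ => ?_
      simp only [Pi.smul_apply, smul_eq_mul]; ring
    rw [h1]
    have : ((g fst * s + b * ∑ i, g (mid i) * (t • y) i + g lst * b ^ 2 : ℤ) : ℝ) < 0 := by
      rw [Int.cast_add, Int.cast_add, Int.cast_mul, Int.cast_mul, Int.cast_mul, hgy t, hsr]
      push_cast
      linarith
    exact_mod_cast this
  -- With `b = 1` and `l = 0` the pairing is linear in `t` with negative slope, so a large `t`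
  -- suffices. For `l > 0` the choice `b = l d`, `t = 1` makes the isotropic vector `d² (S[μ]/2, l
  -- μ, l²)`, whose pairing with `g` is `(l d²/2) S₀[λ] < 0`.
  rcases hl0.eq_or_lt with h | h
  · obtain ⟨t, ht⟩ := exists_nat_gt ((g lst : ℝ) / (d * q))
    refine fin 1 t one_ne_zero ?_
    rw [← h]
    rw [div_lt_iff₀ (by positivity)] at ht
    push_cast
    nlinarith
  · have hlr' : (0 : ℝ) < g fst := by exact_mod_cast h
    refine fin (g fst * d) 1 (mul_pos h hdpos).ne' ?_
    push_cast
    have : (g fst : ℝ) * ((1 * d) ^ 2 * q / 2) - g fst * d * (1 * d * q) + g lst * (g fst * d) ^ 2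
        = (g fst * d ^ 2 / 2) * (2 * g lst * g fst - q) := by ring
    rw [this]
    exact mul_neg_of_pos_of_neg (by positivity) hneg

end Coeff

end OrthMaass

namespace OrthMaass

open Matrix

/-! ### Scaling and averaging of Fourier series. -/

section Series

variable {ι : Type} [Fintype ι] [DecidableEq ι]

theorem scale_injective {D : ι → ℤ} (hD : ∀ i, D i ≠ 0) :
    Function.Injective fun (g : ι → ℤ) i => D i * g i := by
  intro g g' h
  funext i
  exact mul_left_cancel₀ (hD i) (congrFun h i)

theorem cexpo_scale (D g : ι → ℤ) (w : ι → ℂ) :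
    cexpo g (fun i => (D i : ℂ) * w i) = cexpo (fun i => D i * g i) w := by
  rw [cexpo, cexpo]
  congr 2
  refine Finset.sum_congr rfl fun i _ => ?_
  push_cast; ring

/-- Extension by zero off the multiples of `D` matches the convention that coefficients vanish
outside the dual lattice. -/
theorem hasSum_scale {D : ι → ℤ} (hD : ∀ i, D i ≠ 0) {b : (ι → ℤ) → ℂ} {w : ι → ℂ} {a : ℂ}
    (h : HasSum (fun g => b g * cexpo g (fun i => (D i : ℂ) * w i)) a) :
    HasSum (fun g => Function.extend (fun (g : ι → ℤ) i => D i * g i) b 0 g * cexpo g w) a := by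
  have hi := scale_injective hD
  rw [← hi.hasSum_iff]
  · convert h using 2 with g
    simp only [Function.comp]
    rw [hi.extend_apply, cexpo_scale]
  · intro g hg
    rw [Function.extend_apply']
    · simp
    · rintro ⟨g', h'⟩; exact hg ⟨g', h'⟩

theorem sum_exp_div {p : ℕ} (hp : p ≠ 0) (a : ℤ) :
    ∑ l ∈ Finset.range p, Complex.exp (2 * Real.pi * Complex.I * ((a : ℂ) * ((l : ℂ) / p)))
      = if (p : ℤ) ∣ a then (p : ℂ) else 0 := by
  have hp' : (p : ℂ) ≠ 0 := by exact_mod_cast hp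
  set ζ := Complex.exp (2 * Real.pi * Complex.I * ((a : ℂ) / p)) with hζ
  have h1 : ∀ l : ℕ, Complex.exp (2 * Real.pi * Complex.I * ((a : ℂ) * ((l : ℂ) / p))) = ζ ^ l := by
    intro l
    rw [hζ, ← Complex.exp_nat_mul]
    congr 1; ring
  have h2 : ζ ^ p = 1 := by
    rw [← h1, Complex.exp_eq_one_iff]
    exact ⟨a, by rw [div_self hp']; ring⟩
  simp only [h1]
  split_ifs with h
  · obtain ⟨c, rfl⟩ := h
    have : ζ = 1 := by
      rw [hζ, Complex.exp_eq_one_iff]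
      refine ⟨c, ?_⟩
      push_cast
      field_simp
    simp [this]
  · have hne : ζ ≠ 1 := by
      intro h1
      rw [hζ, Complex.exp_eq_one_iff] at h1
      obtain ⟨c, hc⟩ := h1
      have h3 : (a : ℂ) / p = c := by
        have h2pi : (2 * Real.pi * Complex.I : ℂ) ≠ 0 := Complex.two_pi_I_ne_zero
        apply mul_left_cancel₀ h2pi
        rw [hc]; ring
      rw [div_eq_iff hp'] at h3
      exact h ⟨c, by have : (a : ℂ) = ((p * c : ℤ) : ℂ) := by
                       rw [h3]; push_cast; ring
                     exact_mod_cast this⟩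
    rw [geom_sum_eq hne, h2]; simp

/-- Orthogonality of the `p`-th roots of unity keeps exactly the frequencies with `p ∣ g i`, each
weighted by `p`. Reindexing by `g i ↦ p g i` absorbs the division of the coordinate by `p`. -/
theorem hasSum_average {p : ℕ} (hp : p ≠ 0) (i : ι) {b : (ι → ℤ) → ℂ} {w : ι → ℂ} {F : ℕ → ℂ}
    (h : ∀ l ∈ Finset.range p,
      HasSum (fun g => b g * cexpo g (Function.update w i ((w i + l) / p))) (F l)) :
    HasSum (fun g => (p : ℂ) * b (Function.update g i (p * g i)) * cexpo g w)
      (∑ l ∈ Finset.range p, F l) := by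
  have hp' : (p : ℂ) ≠ 0 := by exact_mod_cast hp
  have h1 := hasSum_sum h
  have h2 : ∀ (g : ι → ℤ) (l : ℕ), cexpo g (Function.update w i ((w i + l) / p)) =
      cexpo g (Function.update w i (w i / p)) *
        Complex.exp (2 * Real.pi * Complex.I * ((g i : ℂ) * ((l : ℂ) / p))) := by
    intro g l
    rw [cexpo, cexpo, ← Complex.exp_add, ← mul_add, ← Finset.add_sum_erase _ _ (Finset.mem_univ i),
      ← Finset.add_sum_erase _ _ (Finset.mem_univ i)]
    congr 2
    have : ∀ z : ℂ, ∑ x ∈ Finset.univ.erase i, (g x : ℂ) * Function.update w i z x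
        = ∑ x ∈ Finset.univ.erase i, (g x : ℂ) * w x := by
      intro z
      refine Finset.sum_congr rfl fun x hx => ?_
      rw [Function.update_of_ne (Finset.ne_of_mem_erase hx)]
    rw [this, this]
    simp only [Function.update_self]
    ring
  have h3 : ∀ g : ι → ℤ, ∑ l ∈ Finset.range p, b g * cexpo g (Function.update w i ((w i + l) / p))
      = b g * cexpo g (Function.update w i (w i / p)) * if (p : ℤ) ∣ g i then (p : ℂ) else 0 := by
    intro g
    rw [← sum_exp_div hp, Finset.mul_sum]
    refine Finset.sum_congr rfl fun l _ => ?_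
    rw [h2]; ring
  simp only [h3] at h1
  set φ : (ι → ℤ) → (ι → ℤ) := fun g => Function.update g i (p * g i) with hφ
  have hinj : Function.Injective φ := by
    intro g g' h
    funext j
    by_cases hj : j = i
    · subst hj
      have := congrFun h j
      simp only [hφ, Function.update_self] at this
      exact mul_left_cancel₀ (by exact_mod_cast hp) this
    · have := congrFun h j
      simpa only [hφ, Function.update_of_ne hj] using this
  rw [← hinj.hasSum_iff] at h1
  · convert h1 using 2 with g
    simp only [Function.comp, hφ, Function.update_self, dvd_mul_right, if_true]
    have : cexpo (Function.update g i (p * g i)) (Function.update w i (w i / p)) = cexpo g w := by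
      rw [cexpo, cexpo]
      congr 2
      refine Finset.sum_congr rfl fun j _ => ?_
      by_cases hj : j = i
      · subst hj
        simp only [Function.update_self]
        push_cast; field_simp
      · simp only [Function.update_of_ne hj]
    rw [this]; ring
  · intro g hg
    rw [if_neg, mul_zero]
    rintro ⟨c, hc⟩
    refine hg ⟨Function.update g i c, ?_⟩
    simp [hφ, hc]

end Series

/-! ### Coefficients on the dual lattice and explicit Hecke operators. -/

section Fourier

variable {n : ℕ} {S : Matrix (Fin n) (Fin n) ℤ} {k : ℕ} {f : (Ext (Fin n) → ℂ) → ℂ}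

theorem basePoint_eq_cpt (u : Ext (Fin n) → ℝ) : basePoint u = cpt u (colVec 1 0 1) := by
  refine funext (ext_cases ?_ (fun i => ?_) ?_) <;> simp [basePoint, cpt]

theorem fourierCoeff_eq (hS : IsMaximalEven S) {v : Ext (Fin n) → ℝ} {g : Ext (Fin n) → ℤ}
    (hg : S0 ℝ S *ᵥ v = fun i => (g i : ℝ)) : fourierCoeff S f v = freqCoeff f g := by
  have hd : v ∈ dualLattice S := ⟨g, hg⟩
  rw [fourierCoeff, if_pos hd, freqCoeff, tubeCoeff]
  congr 1
  funext u
  rw [basePoint_eq_cpt]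
  congr 1
  rw [cexpo]
  congr 1
  have h1 : (fun i => (v i : ℂ)) ⬝ᵥ (S0 ℂ S *ᵥ cpt u (colVec 1 0 1))
      = ∑ i, (g i : ℂ) * cpt u (colVec 1 0 1) i := by
    rw [dotProduct_mulVec, ← mulVec_transpose, S0_transpose ℂ hS]
    have : S0 ℂ S *ᵥ (fun i => (v i : ℂ)) = fun i => (g i : ℂ) := by
      have h2 := S0_map (S := S) Complex.ofRealHom
      funext i
      have h3 := congrFun hg i
      rw [← h2]
      have h4 : ((S0 ℝ S).map Complex.ofRealHom *ᵥ fun i => (v i : ℂ)) i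
          = (((S0 ℝ S *ᵥ v) i : ℝ) : ℂ) := by
        simp [mulVec, dotProduct]
      rw [h4, h3]; simp
    rw [this]; rfl
  rw [h1]
  simp only [Pi.neg_apply, Int.cast_neg, neg_mul, Finset.sum_neg_distrib, mul_neg]

theorem fourierCoeff_of_not_mem {v : Ext (Fin n) → ℝ} (h : v ∉ dualLattice S) :
    fourierCoeff S f v = 0 := if_neg h

theorem fourierCoeff_scale (hS : IsMaximalEven S) {D g : Ext (Fin n) → ℤ} (hD : ∀ i, D i ≠ 0)
    {v' : Ext (Fin n) → ℝ} (h : ∀ i, (g i : ℝ) = D i * (S0 ℝ S *ᵥ v') i) :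
    fourierCoeff S f v' =
      Function.extend (fun (g : Ext (Fin n) → ℤ) i => D i * g i) (freqCoeff f) 0 g := by
  have hi := scale_injective hD
  by_cases hv : v' ∈ dualLattice S
  · obtain ⟨g', hg'⟩ := hv
    have : g = fun i => D i * g' i := by
      funext i
      have := h i
      rw [hg'] at this
      beta_reduce at this
      exact_mod_cast this
    rw [fourierCoeff_eq hS hg', this, hi.extend_apply]
  · rw [fourierCoeff_of_not_mem hv, Function.extend_apply']
    · rfl
    · rintro ⟨g', hg'⟩
      refine hv ⟨g', funext fun i => ?_⟩
      have h1 := h i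
      rw [← hg'] at h1
      push_cast at h1
      have : (D i : ℝ) ≠ 0 := by exact_mod_cast hD i
      exact (mul_left_cancel₀ this h1).symm

theorem S0_mulVec_colVec (m l : ℝ) (μ : Fin n → ℝ) :
    S0 ℝ S *ᵥ colVec m μ l = colVec l (-(S.map (Int.cast : ℤ → ℝ) *ᵥ μ)) m := by
  rw [S0, addHyp_mulVec, neg_mulVec]; rfl

theorem exists_freq (hS : IsMaximalEven S) (g : Ext (Fin n) → ℤ) :
    ∃ μ : Fin n → ℝ, S0 ℝ S *ᵥ colVec (g lst : ℝ) μ (g fst : ℝ) = fun i => (g i : ℝ) := by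
  have hdet : IsUnit (S.map (Int.cast : ℤ → ℝ)).det :=
    isUnit_iff_ne_zero.2 hS.posDef.det_pos.ne'
  refine ⟨(S.map (Int.cast : ℤ → ℝ))⁻¹ *ᵥ fun i => -(g (mid i) : ℝ), ?_⟩
  rw [S0_mulVec_colVec, mulVec_mulVec, mul_nonsing_inv _ hdet, one_mulVec]
  exact funext (ext_cases rfl (fun i => by simp) rfl)

theorem transl_apply_lst (v : Ext (Fin n) → ℝ) :
    transl S v lst fst = 0 ∧ (∀ j, transl S v lst (mid j) = 0) ∧ transl S v lst lst = 1 :=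
  ⟨rfl, fun _ => rfl, rfl⟩

theorem transl_apply_mid (v : Ext (Fin n) → ℝ) (i : Ext (Fin n)) :
    transl S v (mid i) fst = 0 ∧
      (∀ j, transl S v (mid i) (mid j) = (1 : Matrix (Ext (Fin n)) (Ext (Fin n)) ℝ) i j) ∧
      transl S v (mid i) lst = v i :=
  ⟨rfl, fun _ => rfl, rfl⟩

theorem diag_transl_act (d : Ext (Ext (Fin n)) → ℝ) (v : Ext (Fin n) → ℝ) (w : Ext (Fin n) → ℂ) :
    autFactor S (diagonal d * transl S v) w = d lst ∧
    act S (diagonal d * transl S v) w =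
      fun i => (d (mid i) : ℂ) * (w i + v i) * (d lst : ℂ)⁻¹ := by
  have h1 : autFactor S (diagonal d * transl S v) w = d lst := by
    simp only [autFactor, diagonal_mul, transl_apply_lst]
    simp
  refine ⟨h1, ?_⟩
  funext i
  rw [act, h1]
  simp only [diagonal_mul, transl_apply_mid, Matrix.one_apply]
  rw [Finset.sum_eq_single i (fun j _ hj => by simp [Ne.symm hj]) (by simp)]
  simp only [if_true]
  push_cast
  ring

theorem diag_act (d : Ext (Ext (Fin n)) → ℝ) (w : Ext (Fin n) → ℂ) :
    autFactor S (diagonal d) w = d lst ∧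
    act S (diagonal d) w = fun i => (d (mid i) : ℂ) * w i * (d lst : ℂ)⁻¹ := by
  have h1 : autFactor S (diagonal d) w = d lst := by
    simp [autFactor]
  refine ⟨h1, ?_⟩
  funext i
  rw [act, h1]
  have h0 : diagonal d (mid i) fst = 0 := diagonal_apply_ne _ (by simp)
  have h2 : diagonal d (mid i) lst = 0 := diagonal_apply_ne _ (by simp)
  rw [Finset.sum_eq_single i (fun j _ hj => by
    rw [diagonal_apply_ne _ (by simpa using Ne.symm hj)]; simp) (by simp), h0, h2,
    diagonal_apply_eq]
  simp

/-- Everything is expressed in `(pτ, z, τ')` instead of `w`: in this variable both operators have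
integral frequencies, whereas `f | T_p^↓` involves `τ` only through `pτ`. -/
theorem heckeUp_eq (p : ℕ) (hp : p ≠ 0) (w : Ext (Fin n) → ℂ) :
    heckeUp S k p f w = f (fun i => ((colVec (p : ℤ) (fun _ => (p : ℤ)) 1 i : ℤ) : ℂ) *
        Function.update w fst (p * w fst) i) +
      ((p : ℂ) ^ k)⁻¹ * ∑ l ∈ Finset.range p, f (Function.update w fst
        ((Function.update w fst (p * w fst) fst + l) / p)) := by
  have hp' : (p : ℂ) ≠ 0 := by exact_mod_cast hp
  rw [heckeUp, Finset.mul_sum]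
  congr 1
  · rw [slash, (diag_act _ w).1, (diag_act _ w).2]
    simp only [colVec_lst, colVec_mid]
    norm_num
    congr 1
    refine funext (ext_cases ?_ (fun i => ?_) ?_)
    · simp; ring
    · rw [Function.update_of_ne (by simp)]; simp
    · rw [Function.update_of_ne (by simp)]; simp
  · refine Finset.sum_congr rfl fun l _ => ?_
    have : (p : ℝ) • (1 : Matrix (Ext (Ext (Fin n))) (Ext (Ext (Fin n))) ℝ)
        = diagonal fun _ => (p : ℝ) := smul_one_eq_diagonal _
    rw [this, slash, (diag_transl_act _ _ w).1, (diag_transl_act _ _ w).2, mul_comm]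
    congr 1
    · congr 1
      refine funext (ext_cases ?_ (fun i => ?_) ?_)
      · simp; field_simp
      · rw [Function.update_of_ne (by simp)]; simp; field_simp
      · rw [Function.update_of_ne (by simp)]; simp; field_simp

theorem heckeDown_eq (p : ℕ) (hp : p ≠ 0) (w : Ext (Fin n) → ℂ) :
    heckeDown S k p f w = f (fun i => ((colVec (1 : ℤ) (fun _ => (p : ℤ)) (p : ℤ) i : ℤ) : ℂ) *
        Function.update w fst (p * w fst) i) +
      ((p : ℂ) ^ k)⁻¹ * ∑ l ∈ Finset.range p, f (Function.update (Function.update w fst (p * w fst))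
        lst ((Function.update w fst (p * w fst) lst + l) / p)) := by
  have hp' : (p : ℂ) ≠ 0 := by exact_mod_cast hp
  rw [heckeDown, Finset.mul_sum]
  congr 1
  · rw [slash, (diag_act _ w).1, (diag_act _ w).2]
    simp only [colVec_lst, colVec_mid]
    norm_num
    congr 1
    refine funext (ext_cases ?_ (fun i => ?_) ?_)
    · simp
    · rw [Function.update_of_ne (by simp)]; simp
    · rw [Function.update_of_ne (by simp)]; simp
  · refine Finset.sum_congr rfl fun l _ => ?_
    rw [slash, (diag_transl_act _ _ w).1, (diag_transl_act _ _ w).2, mul_comm]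
    congr 1
    · congr 1
      refine funext (ext_cases ?_ (fun i => ?_) ?_)
      · simp; field_simp
      · simp; field_simp
      · simp; field_simp

theorem scale_mem_halfSpace {w w' : Ext (Fin n) → ℂ} (hw : w ∈ halfSpace S) {a b c : ℝ}
    (ha : 0 < a) (hb : 0 < b) (hc : 0 < c) (h : a * c = b ^ 2)
    (h1 : (w' fst).im = a * (w fst).im) (h2 : ∀ i, (w' (mid i)).im = b * (w (mid i)).im)
    (h3 : (w' lst).im = c * (w lst).im) : w' ∈ halfSpace S := by
  obtain ⟨hq, hf, hl⟩ := hw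
  refine ⟨?_, by rw [h1]; positivity, by rw [h3]; positivity⟩
  rw [quad_S0] at hq ⊢
  have : (fun i => (w' (mid i)).im) = b • fun i => (w (mid i)).im := funext h2
  rw [this, quad_eq_bil, bil_smul_left, bil_smul_right, ← quad_eq_bil, h1, h3]
  have : 2 * (a * (w fst).im) * (c * (w lst).im) = (a * c) * (2 * (w fst).im * (w lst).im) := by
    ring
  rw [this, h]
  have hb2 : 0 < b ^ 2 := by positivity
  nlinarith [mul_pos hb2 hq]

end Fourier
end OrthMaass

namespace OrthMaass

open Matrix

/-! ### Fourier expansion of the Hecke images and the equivalence (iii) ⇔ (iv). -/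

section Fourier

variable {n : ℕ} {S : Matrix (Fin n) (Fin n) ℤ} {k : ℕ} {f : (Ext (Fin n) → ℂ) → ℂ}

theorem hasSum_heckeUp (hS : IsMaximalEven S) (hf : IsModularForm S k f) {p : ℕ} (hp : p ≠ 0)
    {w : Ext (Fin n) → ℂ} (hw : w ∈ halfSpace S) :
    HasSum (fun g => (Function.extend
        (fun (g : Ext (Fin n) → ℤ) i => colVec (p : ℤ) (fun _ => (p : ℤ)) 1 i * g i)
        (freqCoeff f) 0 g + ((p : ℂ) ^ k)⁻¹ * (p * freqCoeff f (Function.update g fst (p * g fst)))) *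
          cexpo g (Function.update w fst (p * w fst))) (heckeUp S k p f w) := by
  have hpz : (p : ℤ) ≠ 0 := by exact_mod_cast hp
  have hpc : (p : ℂ) ≠ 0 := by exact_mod_cast hp
  have hp0 : (0 : ℝ) < p := by exact_mod_cast Nat.pos_of_ne_zero hp
  rw [heckeUp_eq p hp]
  have hm : ∀ i, Function.update w fst (p * w fst) (mid i) = w (mid i) :=
    fun i => Function.update_of_ne (by simp) _ _
  have hl : Function.update w fst (p * w fst) lst = w lst := Function.update_of_ne (by simp) _ _
  have hs : Function.update w fst (p * w fst) fst = p * w fst := Function.update_self _ _ _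
  have hu : ∀ z, Function.update w fst z = Function.update (Function.update w fst (p * w fst)) fst z :=
    fun z => by rw [Function.update_idem]
  simp only [fun l : ℕ => hu ((Function.update w fst (p * w fst) fst + l) / p)]
  generalize Function.update w fst (p * w fst) = w' at hm hl hs
  have m1 : (fun i => ((colVec (p : ℤ) (fun _ => (p : ℤ)) 1 i : ℤ) : ℂ) * w' i) ∈ halfSpace S :=
    scale_mem_halfSpace hw (a := p ^ 2) (b := p) (c := 1) (by positivity) hp0 one_pos (by ring)
      (by simp [hs]; ring) (by simp [hm]) (by simp [hl])
  have m2 : ∀ l : ℕ, Function.update w' fst ((w' fst + l) / p) ∈ halfSpace S := by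
    intro l
    refine scale_mem_halfSpace hw (a := 1) (b := 1) (c := 1) one_pos one_pos one_pos (by ring)
        ?_ (fun i => ?_) ?_
    · rw [Function.update_self, hs]
      have : ((p : ℂ) * w fst + l) / p = w fst + ((l / p : ℝ) : ℂ) := by
        push_cast; field_simp
      rw [this]; simp
    · rw [Function.update_of_ne (by simp), hm]; simp
    · rw [Function.update_of_ne (by simp), hl]; simp
  have h1 := hasSum_scale (D := colVec (p : ℤ) (fun _ => (p : ℤ)) 1)
    (ext_cases hpz (fun _ => hpz) one_ne_zero) (hasSum_freqCoeff hS hf m1)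
  have h2 := hasSum_average hp fst fun l _ => hasSum_freqCoeff hS hf (m2 l)
  have h3 := h1.add (h2.mul_left ((p : ℂ) ^ k)⁻¹)
  simp only [← mul_assoc, ← add_mul] at h3 ⊢
  exact h3

theorem hasSum_heckeDown (hS : IsMaximalEven S) (hf : IsModularForm S k f) {p : ℕ} (hp : p ≠ 0)
    {w : Ext (Fin n) → ℂ} (hw : w ∈ halfSpace S) :
    HasSum (fun g => (Function.extend
        (fun (g : Ext (Fin n) → ℤ) i => colVec (1 : ℤ) (fun _ => (p : ℤ)) (p : ℤ) i * g i)
        (freqCoeff f) 0 g + ((p : ℂ) ^ k)⁻¹ * (p * freqCoeff f (Function.update g lst (p * g lst)))) *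
          cexpo g (Function.update w fst (p * w fst))) (heckeDown S k p f w) := by
  have hpz : (p : ℤ) ≠ 0 := by exact_mod_cast hp
  have hp0 : (0 : ℝ) < p := by exact_mod_cast Nat.pos_of_ne_zero hp
  rw [heckeDown_eq p hp]
  have hm : ∀ i, Function.update w fst (p * w fst) (mid i) = w (mid i) :=
    fun i => Function.update_of_ne (by simp) _ _
  have hl : Function.update w fst (p * w fst) lst = w lst := Function.update_of_ne (by simp) _ _
  have hs : Function.update w fst (p * w fst) fst = p * w fst := Function.update_self _ _ _
  generalize Function.update w fst (p * w fst) = w' at hm hl hs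
  have m1 : (fun i => ((colVec (1 : ℤ) (fun _ => (p : ℤ)) (p : ℤ) i : ℤ) : ℂ) * w' i) ∈ halfSpace S :=
    scale_mem_halfSpace hw (a := p) (b := p) (c := p) hp0 hp0 hp0 (by ring)
      (by simp [hs]) (by simp [hm]) (by simp [hl])
  have m2 : ∀ l : ℕ, Function.update w' lst ((w' lst + l) / p) ∈ halfSpace S := by
    intro l
    refine scale_mem_halfSpace hw (a := p) (b := 1) (c := 1 / p) hp0 one_pos (by positivity)
        (by field_simp) ?_ (fun i => ?_) ?_
    · rw [Function.update_of_ne (by simp), hs]; simp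
    · rw [Function.update_of_ne (by simp), hm]; simp
    · rw [Function.update_self, hl]
      have : (w lst + l) / p = ((1 / p : ℝ) : ℂ) * (w lst + ((l : ℝ) : ℂ)) := by
        push_cast; ring
      rw [this, Complex.im_ofReal_mul]; simp
  have h1 := hasSum_scale (D := colVec (1 : ℤ) (fun _ => (p : ℤ)) (p : ℤ))
    (ext_cases one_ne_zero (fun _ => hpz) hpz) (hasSum_freqCoeff hS hf m1)
  have h2 := hasSum_average hp lst fun l _ => hasSum_freqCoeff hS hf (m2 l)
  have h3 := h1.add (h2.mul_left ((p : ℂ) ^ k)⁻¹)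
  simp only [← mul_assoc, ← add_mul] at h3 ⊢
  exact h3

theorem hecke_eq_iff (hS : IsMaximalEven S) (hf : IsModularForm S k f) {p : ℕ} (hp : p ≠ 0) :
    (∀ w ∈ halfSpace S, heckeUp S k p f w = heckeDown S k p f w) ↔
    ∀ g, Function.extend
        (fun (g : Ext (Fin n) → ℤ) i => colVec (p : ℤ) (fun _ => (p : ℤ)) 1 i * g i)
        (freqCoeff f) 0 g + ((p : ℂ) ^ k)⁻¹ * (p * freqCoeff f (Function.update g fst (p * g fst)))
      = Function.extend
        (fun (g : Ext (Fin n) → ℤ) i => colVec (1 : ℤ) (fun _ => (p : ℤ)) (p : ℤ) i * g i)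
        (freqCoeff f) 0 g
          + ((p : ℂ) ^ k)⁻¹ * (p * freqCoeff f (Function.update g lst (p * g lst))) := by
  constructor
  · intro h g
    have hpc : (p : ℂ) ≠ 0 := by exact_mod_cast hp
    -- Undoing `τ ↦ pτ` turns both expansions into ordinary ones, valid at height `(p, 0, 1)`, where
    -- uniqueness applies.
    set F : (Ext (Fin n) → ℂ) → ℂ := fun w => heckeUp S k p f (Function.update w fst (w fst / p))
    have hpt : ∀ u : Ext (Fin n) → ℝ,
        Function.update (cpt u (colVec p 0 1)) fst (cpt u (colVec p 0 1) fst / p)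
        = cpt (Function.update u fst (u fst / p)) (colVec 1 0 1) := by
      intro u
      refine funext (ext_cases ?_ (fun i => ?_) ?_)
      · simp [cpt]; field_simp
      · rw [Function.update_of_ne (by simp)]; simp [cpt]
      · rw [Function.update_of_ne (by simp)]; simp [cpt]
    have hback : ∀ w : Ext (Fin n) → ℂ, Function.update (Function.update w fst (w fst / p)) fst
        (p * (Function.update w fst (w fst / p)) fst) = w := by
      intro w
      rw [Function.update_idem, Function.update_self, mul_div_cancel₀ _ hpc,
        Function.update_eq_self]
    have hmem : ∀ u : Ext (Fin n) → ℝ, cpt u (colVec 1 0 1) ∈ halfSpace S :=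
      fun u => cpt_mem_tube basePt_mem_cone u
    have e1 := eq_tubeCoeff (f := F) (y := colVec p 0 1) (fun u => by
      have := hasSum_heckeUp hS hf hp (hmem (Function.update u fst (u fst / p)))
      rw [← hpt, hback] at this
      exact this) g
    have e2 := eq_tubeCoeff (f := F) (y := colVec p 0 1) (fun u => by
      have := hasSum_heckeDown hS hf hp (hmem (Function.update u fst (u fst / p)))
      rw [← h _ (hmem _), ← hpt, hback] at this
      exact this) g
    rw [← e1, e2]
  · intro h w hw
    have e1 := hasSum_heckeUp hS hf hp hw
    simp only [h] at e1
    exact e1.unique (hasSum_heckeDown hS hf hp hw)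

theorem coeffRelation_iff_hecke (hS : IsMaximalEven S) (hf : IsModularForm S k f) (hk : 0 < k)
    {p : ℕ} (hp : p ≠ 0) :
    CoeffRelation S k p f ↔ ∀ w ∈ halfSpace S, heckeUp S k p f w = heckeDown S k p f w := by
  rw [hecke_eq_iff hS hf hp]
  have hpc : (p : ℂ) ≠ 0 := by exact_mod_cast hp
  have hpr : (p : ℝ) ≠ 0 := by exact_mod_cast hp
  have hpz : (p : ℤ) ≠ 0 := by exact_mod_cast hp
  have key : ∀ (m l : ℤ) (μ : Fin n → ℝ) (g : Ext (Fin n) → ℤ),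
      (S0 ℝ S *ᵥ colVec (m : ℝ) μ (l : ℝ) = fun i => (g i : ℝ)) →
      (fourierCoeff S f (colVec ((p : ℝ) * m) μ l) +
        (p : ℂ) ^ (k - 1) * fourierCoeff S f (colVec ((m : ℝ) / p) (fun i => μ i / p) l) =
      fourierCoeff S f (colVec m μ ((p : ℝ) * l)) +
        (p : ℂ) ^ (k - 1) * fourierCoeff S f (colVec m (fun i => μ i / p) ((l : ℝ) / p)) ↔
      Function.extend
        (fun (g : Ext (Fin n) → ℤ) i => colVec (p : ℤ) (fun _ => (p : ℤ)) 1 i * g i)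
        (freqCoeff f) 0 g + ((p : ℂ) ^ k)⁻¹ * (p * freqCoeff f (Function.update g fst (p * g fst)))
      = Function.extend
        (fun (g : Ext (Fin n) → ℤ) i => colVec (1 : ℤ) (fun _ => (p : ℤ)) (p : ℤ) i * g i)
        (freqCoeff f) 0 g
          + ((p : ℂ) ^ k)⁻¹ * (p * freqCoeff f (Function.update g lst (p * g lst)))) := by
    intro m l μ g hg
    have hdiv : (fun i => μ i / (p : ℝ)) = (p : ℝ)⁻¹ • μ := by
      funext i; simp [div_eq_inv_mul]
    rw [S0_mulVec_colVec] at hg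
    have hg1 : (l : ℝ) = g fst := congrFun hg fst
    have hg2 : ∀ i, -(S.map (Int.cast : ℤ → ℝ) *ᵥ μ) i = g (mid i) := fun i => congrFun hg (mid i)
    have hg3 : (m : ℝ) = g lst := congrFun hg lst
    have e1 : fourierCoeff S f (colVec ((p : ℝ) * m) μ l)
        = freqCoeff f (Function.update g lst (p * g lst)) := by
      refine fourierCoeff_eq hS ?_
      rw [S0_mulVec_colVec]
      refine funext (ext_cases ?_ (fun i => ?_) ?_)
      · rw [Function.update_of_ne (by simp)]; simpa using hg1
      · rw [Function.update_of_ne (by simp)]; simpa using hg2 i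
      · simp [hg3]
    have e2 : fourierCoeff S f (colVec m μ ((p : ℝ) * l))
        = freqCoeff f (Function.update g fst (p * g fst)) := by
      refine fourierCoeff_eq hS ?_
      rw [S0_mulVec_colVec]
      refine funext (ext_cases ?_ (fun i => ?_) ?_)
      · simp [hg1]
      · rw [Function.update_of_ne (by simp)]; simpa using hg2 i
      · rw [Function.update_of_ne (by simp)]; simpa using hg3
    have e3 : fourierCoeff S f (colVec ((m : ℝ) / p) (fun i => μ i / p) l) = Function.extend
        (fun (g : Ext (Fin n) → ℤ) i => colVec (1 : ℤ) (fun _ => (p : ℤ)) (p : ℤ) i * g i)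
        (freqCoeff f) 0 g := by
      refine fourierCoeff_scale hS (ext_cases one_ne_zero (fun _ => hpz) hpz) ?_
      rw [S0_mulVec_colVec, hdiv, mulVec_smul]
      refine ext_cases ?_ (fun i => ?_) ?_
      · simp [hg1]
      · rw [← hg2]; simp; field_simp
      · rw [← hg3]; simp; field_simp
    have e4 : fourierCoeff S f (colVec m (fun i => μ i / p) ((l : ℝ) / p)) = Function.extend
        (fun (g : Ext (Fin n) → ℤ) i => colVec (p : ℤ) (fun _ => (p : ℤ)) 1 i * g i)
        (freqCoeff f) 0 g := by
      refine fourierCoeff_scale hS (ext_cases hpz (fun _ => hpz) one_ne_zero) ?_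
      rw [S0_mulVec_colVec, hdiv, mulVec_smul]
      refine ext_cases ?_ (fun i => ?_) ?_
      · rw [← hg1]; simp; field_simp
      · rw [← hg2]; simp; field_simp
      · simp [hg3]
    rw [e1, e2, e3, e4]
    -- The `p` translates against the slash factor `p^{-k}` leave `p^{-(k-1)}`. Positivity of `k`
    -- makes the truncated subtraction harmless.
    have hpk : (p : ℂ) ^ k = p * (p : ℂ) ^ (k - 1) := by
      rw [← pow_succ', Nat.sub_add_cancel hk]
    have hq : (p : ℂ) ^ (k - 1) ≠ 0 := pow_ne_zero _ hpc
    have hc : ((p : ℂ) ^ k)⁻¹ * p = ((p : ℂ) ^ (k - 1))⁻¹ := by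
      rw [hpk]; field_simp
    rw [← mul_assoc, ← mul_assoc, hc]
    constructor
    · intro h
      field_simp
      linear_combination -h
    · intro h
      field_simp at h
      linear_combination -h
  constructor
  · intro h g
    obtain ⟨μ, hμ⟩ := exists_freq hS g
    exact (key (g lst) (g fst) μ g hμ).1 (h _ _ _ ⟨g, hμ⟩)
  · intro h m l μ hd
    obtain ⟨g, hg⟩ := hd
    exact (key m l μ g hg).2 (h g)

end Fourier

end OrthMaass

namespace OrthMaass

open Matrix Filter Topology

/-! ### The two boundary functions and the equality of their first coefficients. -/

section Siegel

variable {n : ℕ} {S : Matrix (Fin n) (Fin n) ℤ} {k : ℕ} {f : (Ext (Fin n) → ℂ) → ℂ}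

/-- `(x, 0, y)` or `(y, 0, x)`, according to the flag. -/
def flagVec {R : Type} [Zero R] (s : Bool) (x y : R) : Ext (Fin n) → R :=
  cond s (colVec x 0 y) (colVec y 0 x)

theorem flagVec_mem {x y : ℂ} (s : Bool) (hx : 0 < x.im) (hy : 0 < y.im) :
    flagVec s x y ∈ halfSpace S := by
  have h : ∀ a b : ℂ, 0 < a.im → 0 < b.im → (colVec a 0 b : Ext (Fin n) → ℂ) ∈ halfSpace S := by
    intro a b ha hb
    refine ⟨?_, ha, hb⟩
    rw [quad_S0]
    simp [quad, dotProduct]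
    positivity
  cases s
  · exact h _ _ hy hx
  · exact h _ _ hx hy

/-- Periodicity with the translate described coordinatewise, so that it can be checked by cases on
the index. -/
theorem apply_add_int (hS : IsMaximalEven S) (hf : IsModularForm S k f) {w w' : Ext (Fin n) → ℂ}
    (hw : w ∈ halfSpace S) (a : Ext (Fin n) → ℤ) (h : ∀ i, w' i = w i + a i) : f w' = f w := by
  rw [← hf.intPeriodic hS w hw a]
  congr 1
  exact funext h

/-- The inversion `τ ↦ -1/τ` in one outer coordinate, fixing the other, is the lower unipotent `τ ↦
τ/(1 + τ)` between two integral translations. -/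
theorem apply_flagVec_inv (hS : IsMaximalEven S) (hf : IsModularForm S k f) (s : Bool) {y t : ℝ}
    (hy : 0 < y) (ht : 0 < t) :
    f (flagVec s (Complex.I * (y⁻¹ : ℝ)) (Complex.I * t)) =
      (Complex.I * y) ^ k * f (flagVec s (Complex.I * y) (Complex.I * t)) := by
  set c : Ext (Fin n) → ℤ := flagVec s 0 1 with hc
  have hq : quad (S0 ℤ S) c = 0 := by
    rw [quad_S0]
    cases s <;> simp [hc, flagVec, quad, dotProduct]
  have hb : ∀ v : Ext (Fin n) → ℝ, bil (S0 ℝ S) (fun i => (c i : ℝ)) v = cond s (v fst) (v lst) := by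
    intro v
    rw [bil_S0]
    cases s <;> simp [hc, flagVec, bil, dotProduct]
  have hbc : ∀ v : Ext (Fin n) → ℂ, bil (S0 ℂ S) (fun i => (c i : ℂ)) v = cond s (v fst) (v lst) := by
    intro v
    rw [bil_S0]
    cases s <;> simp [hc, flagVec, bil, dotProduct]
  obtain ⟨M, hM, h⟩ := lower_mem hS hq (fun v hv => by
    rw [hb]
    cases s
    · exact mem_cone_iff_lst hS hv
    · exact mem_cone_iff_fst hS hv)
  have hyc : (y : ℂ) ≠ 0 := by exact_mod_cast hy.ne'
  have hIy : Complex.I * y ≠ 0 := mul_ne_zero Complex.I_ne_zero hyc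
  -- The shift by `-1` makes the automorphy factor `1 + (iy - 1) = iy`; the image coordinate is `(iy
  -- - 1)/(iy) = 1 + i/y`.
  set w : Ext (Fin n) → ℂ := flagVec s (Complex.I * y - 1) (Complex.I * t) with hwd
  have hw : w ∈ halfSpace S := flagVec_mem s (by simpa using hy) (by simpa using ht)
  have haut : autFactor S M w = Complex.I * y := by
    rw [(h w).1, hbc]
    cases s <;> simp [hwd, flagVec]
  have key := slash_of_autFactor hf hM hw (by rw [haut]; exact hIy)
  rw [haut, (h w).2] at key
  have hbw : bil (S0 ℂ S) (cv fun i => (c i : ℝ)) w = Complex.I * y - 1 := by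
    have : cv (fun i => (c i : ℝ)) = fun i => (c i : ℂ) := by funext i; simp [cv]
    rw [this, hbc]
    cases s <;> simp [hwd, flagVec]
  have hqw : quad (S0 ℂ S) w = 2 * (Complex.I * y - 1) * (Complex.I * t) := by
    rw [quad_S0]
    cases s
    · simp [hwd, flagVec, quad, dotProduct]; ring
    · simp [hwd, flagVec, quad, dotProduct]
  have hinv : (Complex.I * (y : ℂ))⁻¹ * (Complex.I * y - 1) = Complex.I * ((y⁻¹ : ℝ) : ℂ) + 1 := by
    push_cast
    field_simp
    linear_combination (-1 : ℂ) * Complex.I_sq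
  have hm1 : flagVec (n := n) s (Complex.I * ((y⁻¹ : ℝ) : ℂ)) (Complex.I * t) ∈ halfSpace S :=
    flagVec_mem s (by simpa using hy) (by simpa using ht)
  have hm2 : flagVec (n := n) s (Complex.I * y) (Complex.I * t) ∈ halfSpace S :=
    flagVec_mem s (by simpa using hy) (by simpa using ht)
  have e1 : f (invTransl S (fun i => (c i : ℝ)) w)
      = f (flagVec s (Complex.I * (y⁻¹ : ℝ)) (Complex.I * t)) := by
    refine apply_add_int hS hf hm1 (flagVec s 1 0) fun i => ?_
    rw [invTransl, hbw, hqw]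
    have e : 1 + (Complex.I * (y : ℂ) - 1) = Complex.I * y := by ring
    have e2 : (Complex.I * (y : ℂ))⁻¹ * (Complex.I * t + 1 / 2 * (2 * (Complex.I * y - 1)
        * (Complex.I * t))) = Complex.I * t := by field_simp; ring
    rw [e]
    revert i
    cases s
    · refine ext_cases ?_ (fun i => ?_) ?_
      · simpa [hwd, flagVec, cv, hc] using e2
      · simp [hwd, flagVec, cv, hc]
      · simpa [hwd, flagVec, cv, hc] using hinv
    · refine ext_cases ?_ (fun i => ?_) ?_
      · simpa [hwd, flagVec, cv, hc] using hinv
      · simp [hwd, flagVec, cv, hc]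
      · simpa [hwd, flagVec, cv, hc] using e2
  have e2 : f w = f (flagVec s (Complex.I * y) (Complex.I * t)) := by
    refine apply_add_int hS hf hm2 (flagVec s (-1) 0) ?_
    cases s
    · refine ext_cases ?_ (fun i => ?_) ?_ <;> simp [hwd, flagVec, sub_eq_add_neg]
    · refine ext_cases ?_ (fun i => ?_) ?_ <;> simp [hwd, flagVec, sub_eq_add_neg]
  rw [← e1, key, e2]

/-- If an outer coordinate vanishes, `S₀[λ] ≥ 0` becomes `S[μ] ≤ 0` and definiteness kills `μ`.
Hence each boundary function is a series in a single index. -/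
theorem freq_isNonneg (hn : 1 ≤ n) (hS : IsMaximalEven S) (hf : IsModularForm S k f)
    {g : Ext (Fin n) → ℤ} (h : freqCoeff f g ≠ 0) :
    0 ≤ g fst ∧ 0 ≤ g lst ∧ (g fst = 0 ∨ g lst = 0 → ∀ i, g (mid i) = 0) := by
  obtain ⟨μ, hμ⟩ := exists_freq hS g
  obtain ⟨h1, h2, h3⟩ := isNonneg_of_freqCoeff_ne_zero hn hS hf hμ h
  simp only [colVec_fst, colVec_lst] at h1 h2
  refine ⟨by exact_mod_cast h2, by exact_mod_cast h1, fun h0 i => ?_⟩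
  rw [quad_S0] at h3
  simp only [colVec_fst, colVec_mid, colVec_lst] at h3
  have hz : (g lst : ℝ) * g fst = 0 := by rcases h0 with h | h <;> simp [h]
  have hμ0 : μ = 0 := by
    by_contra hne
    have := S_pos hS hne
    have h4 : 0 ≤ 2 * (g lst : ℝ) * g fst - quad (S.map (Int.cast : ℤ → ℝ)) μ := h3
    nlinarith
  rw [S0_mulVec_colVec, hμ0] at hμ
  have := congrFun hμ (mid i)
  simp at this
  exact_mod_cast this.symm

theorem cexpo_flagVec (g : Ext (Fin n) → ℤ) (s : Bool) (y t : ℝ) :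
    cexpo g (flagVec s (Complex.I * y) (Complex.I * t)) =
      ((Real.exp (-(2 * Real.pi * (cond s (g fst) (g lst) : ℤ) * y))
        * Real.exp (-(2 * Real.pi * (cond s (g lst) (g fst) : ℤ) * t)) : ℝ) : ℂ) := by
  rw [← Real.exp_add, cexpo, Complex.ofReal_exp]
  congr 1
  rw [sum_ext]
  cases s
  · simp [flagVec]
    linear_combination (2 * Real.pi * (g fst * t + g lst * y) : ℂ) * Complex.I_sq
  · simp [flagVec]
    linear_combination (2 * Real.pi * (g fst * y + g lst * t) : ℂ) * Complex.I_sq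

/-- The boundary value of `f` obtained from the Siegel operator. -/
noncomputable def boundaryValue (f : (Ext (Fin n) → ℂ) → ℂ) (s : Bool) (y : ℝ) : ℂ :=
  ∑' l : ℕ, freqCoeff f (flagVec s (l : ℤ) 0) * (Real.exp (-(2 * Real.pi * l * y)) : ℂ)

theorem flagVec_nat_injective (s : Bool) :
    Function.Injective fun l : ℕ => (flagVec s (l : ℤ) 0 : Ext (Fin n) → ℤ) := by
  intro l l' h
  cases s
  · have := congrFun h lst
    simpa [flagVec] using this
  · have := congrFun h fst
    simpa [flagVec] using this

theorem eq_flagVec_of_ne_zero (hn : 1 ≤ n) (hS : IsMaximalEven S) (hf : IsModularForm S k f)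
    {g : Ext (Fin n) → ℤ} (h : freqCoeff f g ≠ 0) (s : Bool)
    (h0 : (cond s (g lst) (g fst) : ℤ) = 0) : ∃ l : ℕ, flagVec s (l : ℤ) 0 = g := by
  obtain ⟨h1, h2, h3⟩ := freq_isNonneg hn hS hf h
  cases s
  · have h0' : g fst = 0 := h0
    refine ⟨(g lst).toNat, funext (ext_cases ?_ (fun i => ?_) ?_)⟩
    · simp [flagVec, h0']
    · simp [flagVec, h3 (Or.inl h0') i]
    · simp [flagVec, h2]
  · have h0' : g lst = 0 := h0
    refine ⟨(g fst).toNat, funext (ext_cases ?_ (fun i => ?_) ?_)⟩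
    · simp [flagVec, h1]
    · simp [flagVec, h3 (Or.inr h0') i]
    · simp [flagVec, h0']

/-- Dominated convergence, with the absolutely convergent series at `t = 1` as majorant. By the
Koecher principle the exponent in `t` is never positive on the support, and only terms with exponent
zero survive. -/
theorem tendsto_boundaryValue (hn : 1 ≤ n) (hS : IsMaximalEven S) (hf : IsModularForm S k f)
    (s : Bool) {y : ℝ} (hy : 0 < y) :
    (Summable fun l : ℕ =>
      freqCoeff f (flagVec s (l : ℤ) 0) * (Real.exp (-(2 * Real.pi * l * y)) : ℂ)) ∧
    Tendsto (fun t : ℝ => f (flagVec s (Complex.I * y) (Complex.I * t))) atTop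
      (𝓝 (boundaryValue f s y)) := by
  have hm : ∀ t : ℝ, 0 < t → flagVec (n := n) s (Complex.I * y) (Complex.I * t) ∈ halfSpace S :=
    fun t ht => flagVec_mem s (by simpa using hy) (by simpa using ht)
  have hsum := fun t ht => hasSum_freqCoeff hS hf (hm t ht)
  simp only [cexpo_flagVec] at hsum
  have hb : ∀ g : Ext (Fin n) → ℤ, freqCoeff f g ≠ 0 → 0 ≤ (cond s (g lst) (g fst) : ℤ) := by
    intro g h
    obtain ⟨h1, h2, -⟩ := freq_isNonneg hn hS hf h
    cases s <;> simpa
  have hs1 : Summable fun g : Ext (Fin n) → ℤ => ‖freqCoeff f g *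
      ((Real.exp (-(2 * Real.pi * (cond s (g fst) (g lst) : ℤ) * y))
        * Real.exp (-(2 * Real.pi * (cond s (g lst) (g fst) : ℤ) * 1)) : ℝ) : ℂ)‖ := by
    simpa using (hsum 1 one_pos).summable.norm
  set G : (Ext (Fin n) → ℤ) → ℂ := fun g => if (cond s (g lst) (g fst) : ℤ) = 0 then
    freqCoeff f g * ((Real.exp (-(2 * Real.pi * (cond s (g fst) (g lst) : ℤ) * y)) : ℝ) : ℂ) else 0
    with hG
  have hlim := tendsto_tsum_of_dominated_convergence (𝓕 := (atTop : Filter ℝ))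
    (f := fun (t : ℝ) (g : Ext (Fin n) → ℤ) => freqCoeff f g *
      ((Real.exp (-(2 * Real.pi * (cond s (g fst) (g lst) : ℤ) * y))
        * Real.exp (-(2 * Real.pi * (cond s (g lst) (g fst) : ℤ) * t)) : ℝ) : ℂ)) (g := G) hs1
    (fun g => by
      by_cases hA : freqCoeff f g = 0
      · simp [hG, hA]
      rcases (hb g hA).eq_or_lt with h | h
      · simp only [hG, ← h]
        simp
      · simp only [hG, h.ne', if_false]
        rw [← mul_zero (freqCoeff f g)]
        refine Tendsto.const_mul _ ?_
        rw [← Complex.ofReal_zero]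
        refine (Complex.continuous_ofReal.tendsto 0).comp ?_
        rw [← mul_zero (Real.exp _)]
        refine Tendsto.const_mul _ (Real.tendsto_exp_neg_atTop_nhds_zero.comp ?_)
        have : (0 : ℝ) < (cond s (g lst) (g fst) : ℤ) := by exact_mod_cast h
        exact tendsto_id.const_mul_atTop (by positivity))
    (by
      filter_upwards [eventually_ge_atTop (1 : ℝ)] with t ht g
      by_cases hA : freqCoeff f g = 0
      · simp [hA]
      have hc : (0 : ℝ) ≤ (cond s (g lst) (g fst) : ℤ) := by exact_mod_cast hb g hA
      rw [norm_mul, norm_mul, Complex.norm_real, Complex.norm_real, Real.norm_of_nonneg (by positivity),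
        Real.norm_of_nonneg (by positivity)]
      gcongr)
  have hinj := flagVec_nat_injective (n := n) s
  have hsupp : ∀ g, g ∉ Set.range (fun l : ℕ => (flagVec s (l : ℤ) 0 : Ext (Fin n) → ℤ)) → G g = 0 := by
    intro g hg
    by_contra h
    have h0 : (cond s (g lst) (g fst) : ℤ) = 0 := by
      by_contra h'
      exact h (by simp [hG, h'])
    have hA : freqCoeff f g ≠ 0 := by
      intro h'
      exact h (by simp [hG, h'])
    exact hg (eq_flagVec_of_ne_zero hn hS hf hA s h0)
  have hGv : ∀ l : ℕ, G (flagVec s (l : ℤ) 0) =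
      freqCoeff f (flagVec s (l : ℤ) 0) * (Real.exp (-(2 * Real.pi * l * y)) : ℂ) := by
    intro l
    cases s <;> simp [hG, flagVec]
  have hGs : Summable G := by
    refine Summable.of_norm_bounded (g := fun g => ‖freqCoeff f g *
      ((Real.exp (-(2 * Real.pi * (cond s (g fst) (g lst) : ℤ) * y))
        * Real.exp (-(2 * Real.pi * (cond s (g lst) (g fst) : ℤ) * 1)) : ℝ) : ℂ)‖) hs1 fun g => ?_
    by_cases h0 : (cond s (g lst) (g fst) : ℤ) = 0
    · simp only [hG, h0, if_true]
      simp
    · simp only [hG, h0, if_false, norm_zero]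
      positivity
  constructor
  · have := hinj.summable_iff hsupp |>.2 hGs
    exact this.congr hGv
  · have e1 : ∑' g, G g = boundaryValue f s y := by
      rw [boundaryValue, ← hinj.tsum_eq]
      · exact tsum_congr hGv
      · intro g hg
        by_contra h
        exact hg (hsupp g h)
    rw [← e1]
    refine hlim.congr' ?_
    filter_upwards [eventually_gt_atTop (0 : ℝ)] with t ht
    exact (hsum t ht).tsum_eq

theorem boundaryValue_inv (hn : 1 ≤ n) (hS : IsMaximalEven S) (hf : IsModularForm S k f)
    (s : Bool) {y : ℝ} (hy : 0 < y) :
    boundaryValue f s y⁻¹ = (Complex.I * y) ^ k * boundaryValue f s y := by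
  have h1 := (tendsto_boundaryValue hn hS hf s (inv_pos.2 hy)).2
  have h2 := ((tendsto_boundaryValue hn hS hf s hy).2).const_mul ((Complex.I * (y : ℂ)) ^ k)
  refine tendsto_nhds_unique h1 (h2.congr' ?_)
  filter_upwards [eventually_gt_atTop (0 : ℝ)] with t ht
  exact (apply_flagVec_inv hS hf s hy ht).symm

/-- For `y ≥ 1`, monotonicity and the missing constant term give `H(1) ≤ H(1/y) = y^k H(y) ≤ y^k
e^{-2π(y-1)} H(1)`. The right side tends to zero. -/
theorem not_weight_transform {σ : ℕ → ℝ} (h0 : σ 0 = 0) (h1 : 0 < σ 1) (hσ : ∀ l, 0 ≤ σ l) {k : ℕ}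
    (hs : ∀ y, 0 < y → Summable fun l : ℕ => σ l * Real.exp (-(2 * Real.pi * l * y)))
    (h : ∀ y, 0 < y → ∑' l : ℕ, σ l * Real.exp (-(2 * Real.pi * l * y⁻¹)) =
      y ^ k * ∑' l : ℕ, σ l * Real.exp (-(2 * Real.pi * l * y))) : False := by
  set H : ℝ → ℝ := fun y => ∑' l : ℕ, σ l * Real.exp (-(2 * Real.pi * l * y)) with hH
  have hpos : 0 < H 1 := (hs 1 one_pos).tsum_pos (fun l => by have := hσ l; positivity) 1
    (by positivity)
  have hlow : ∀ y, 1 ≤ y → H 1 ≤ H y⁻¹ := by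
    intro y hy
    have hy0 : 0 < y := by linarith
    refine (hs 1 one_pos).tsum_le_tsum (fun l => ?_) (hs _ (inv_pos.2 hy0))
    have h2 : y⁻¹ ≤ 1 := inv_le_one_of_one_le₀ hy
    have := hσ l
    gcongr
  have hup : ∀ y, 1 ≤ y → H y ≤ Real.exp (-(2 * Real.pi * (y - 1))) * H 1 := by
    intro y hy
    have hy0 : 0 < y := by linarith
    rw [hH, ← tsum_mul_left]
    refine (hs y hy0).tsum_le_tsum (fun l => ?_) ((hs 1 one_pos).mul_left _)
    rcases Nat.eq_zero_or_pos l with rfl | hl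
    · simp [h0]
    · have hl' : (1 : ℝ) ≤ l := by exact_mod_cast hl
      rw [mul_left_comm, ← Real.exp_add]
      refine mul_le_mul_of_nonneg_left (Real.exp_le_exp.2 ?_) (hσ l)
      have : 0 ≤ 2 * Real.pi * ((l - 1) * (y - 1)) := by
        have := Real.pi_pos
        have : 0 ≤ (l - 1 : ℝ) * (y - 1) := mul_nonneg (by linarith) (by linarith)
        positivity
      nlinarith
  have key : ∀ y : ℝ, 1 ≤ y → 1 ≤ Real.exp (2 * Real.pi) * (y ^ k * Real.exp (-(2 * Real.pi) * y)) := by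
    intro y hy
    have hy0 : 0 < y := by linarith
    have h2 := (hlow y hy).trans ((h y hy0).le.trans (mul_le_mul_of_nonneg_left (hup y hy)
      (by positivity)))
    have h3 : y ^ k * (Real.exp (-(2 * Real.pi * (y - 1))) * H 1)
        = (Real.exp (2 * Real.pi) * (y ^ k * Real.exp (-(2 * Real.pi) * y))) * H 1 := by
      have : Real.exp (-(2 * Real.pi * (y - 1)))
          = Real.exp (2 * Real.pi) * Real.exp (-(2 * Real.pi) * y) := by
        rw [← Real.exp_add]; congr 1; ring
      rw [this]; ring
    rw [h3] at h2
    exact le_of_mul_le_mul_right (by linarith) hpos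
  have hlim : Tendsto (fun y : ℝ => Real.exp (2 * Real.pi) * (y ^ k * Real.exp (-(2 * Real.pi) * y)))
      atTop (𝓝 (Real.exp (2 * Real.pi) * 0)) := by
    refine Tendsto.const_mul _ ?_
    have := tendsto_rpow_mul_exp_neg_mul_atTop_nhds_zero (k : ℝ) (2 * Real.pi) (by positivity)
    simpa using this
  have := ge_of_tendsto hlim ((eventually_ge_atTop (1 : ℝ)).mono key)
  simp at this
  linarith

/-- If both boundary components of `f` have Hecke-multiplicative coefficients, then the two first
coefficients agree. -/
theorem boundary_coeff_eq (hn : 1 ≤ n) (hS : IsMaximalEven S) (hf : IsModularForm S k f)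
    {σ : ℕ → ℝ} (h1 : 0 < σ 1) (hσ : ∀ l, 0 ≤ σ l) {c : Bool → ℂ}
    (hc : ∀ s (l : ℕ), 0 < l → freqCoeff f (flagVec s (l : ℤ) 0) = σ l * c s) :
    c true = c false := by
  by_contra hne
  have hd : c true - c false ≠ 0 := sub_ne_zero.2 hne
  -- Both boundary series have the constant term `freqCoeff f 0`, which cancels in the difference,
  -- whatever `σ 0` may be.
  set τ : ℕ → ℝ := fun l => if l = 0 then 0 else σ l with hτ
  have hz : ∀ s, (flagVec s (((0 : ℕ) : ℤ)) 0 : Ext (Fin n) → ℤ) = 0 := by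
    intro s
    refine funext (ext_cases ?_ (fun i => ?_) ?_) <;> cases s <;> simp [flagVec]
  have hterm : ∀ (y : ℝ) (l : ℕ),
      freqCoeff f (flagVec true (l : ℤ) 0) * (Real.exp (-(2 * Real.pi * l * y)) : ℂ)
        - freqCoeff f (flagVec false (l : ℤ) 0) * (Real.exp (-(2 * Real.pi * l * y)) : ℂ)
      = (c true - c false) * ((τ l * Real.exp (-(2 * Real.pi * l * y)) : ℝ) : ℂ) := by
    intro y l
    rcases Nat.eq_zero_or_pos l with rfl | hl
    · rw [hz, hz]; simp [hτ]
    · rw [hc _ _ hl, hc _ _ hl]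
      simp only [hτ, hl.ne', if_false]
      push_cast
      ring
  have hsm : ∀ y, 0 < y → Summable fun l : ℕ => τ l * Real.exp (-(2 * Real.pi * l * y)) := by
    intro y hy
    have := ((tendsto_boundaryValue hn hS hf true hy).1).sub
      ((tendsto_boundaryValue hn hS hf false hy).1)
    simp only [hterm] at this
    have h2 := (summable_mul_left_iff hd).1 this
    exact_mod_cast h2
  have hval : ∀ y, 0 < y → boundaryValue f true y - boundaryValue f false y =
      (c true - c false) * ((∑' l : ℕ, τ l * Real.exp (-(2 * Real.pi * l * y)) : ℝ) : ℂ) := by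
    intro y hy
    rw [boundaryValue, boundaryValue, ← Summable.tsum_sub (tendsto_boundaryValue hn hS hf true hy).1
      (tendsto_boundaryValue hn hS hf false hy).1, Complex.ofReal_tsum, ← tsum_mul_left]
    exact tsum_congr (hterm y)
  have hτ0 : ∀ l, 0 ≤ τ l := by
    intro l
    simp only [hτ]
    split_ifs
    · exact le_rfl
    · exact hσ l
  refine not_weight_transform (σ := τ) (k := k) (by simp [hτ]) (by simpa [hτ] using h1) hτ0 hsm
    fun y hy => ?_
  have e1 := hval _ (inv_pos.2 hy)
  rw [boundaryValue_inv hn hS hf true hy, boundaryValue_inv hn hS hf false hy, ← mul_sub,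
    hval y hy] at e1
  rw [mul_left_comm] at e1
  -- Passing to norms removes `I ^ k`, leaving the real transformation law.
  have e2 := congrArg norm (mul_left_cancel₀ hd e1).symm
  rw [norm_mul, norm_pow, norm_mul, Complex.norm_I, one_mul, Complex.norm_real, Complex.norm_real,
    Complex.norm_real, Real.norm_of_nonneg (tsum_nonneg fun l => by have := hτ0 l; positivity),
    Real.norm_of_nonneg (tsum_nonneg fun l => by have := hτ0 l; positivity),
    Real.norm_of_nonneg hy.le] at e2
  exact e2

end Siegel

end OrthMaass

namespace OrthMaass

open Matrix

/-! ### Divisibility in the dual lattice and the implication (i) ⇒ (iii). -/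

section Arithmetic

variable {n : ℕ} {S : Matrix (Fin n) (Fin n) ℤ} {k : ℕ} {f : (Ext (Fin n) → ℂ) → ℂ}

theorem mem_dual_iff {m l : ℝ} {μ : Fin n → ℝ} : colVec m μ l ∈ dualLattice S ↔
    (∃ a : ℤ, m = a) ∧ (∃ h : Fin n → ℤ, S.map (Int.cast : ℤ → ℝ) *ᵥ μ = fun i => (h i : ℝ)) ∧
      ∃ b : ℤ, l = b := by
  constructor
  · rintro ⟨g, hg⟩
    rw [S0_mulVec_colVec] at hg
    refine ⟨⟨g lst, congrFun hg lst⟩, ⟨fun i => -g (mid i), funext fun i => ?_⟩,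
      ⟨g fst, congrFun hg fst⟩⟩
    have := congrFun hg (mid i)
    simp only [colVec_mid, Pi.neg_apply] at this
    push_cast
    linarith
  · rintro ⟨⟨a, rfl⟩, ⟨h, hh⟩, ⟨b, rfl⟩⟩
    refine ⟨colVec b (-h) a, ?_⟩
    rw [S0_mulVec_colVec, hh]
    exact funext (ext_cases rfl (fun i => by simp) rfl)

theorem mulVec_div (μ : Fin n → ℝ) (c : ℝ) :
    S.map (Int.cast : ℤ → ℝ) *ᵥ (fun i => μ i / c)
      = fun i => (S.map (Int.cast : ℤ → ℝ) *ᵥ μ) i / c := by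
  have : (fun i => μ i / c) = c⁻¹ • μ := by funext i; simp [div_eq_inv_mul]
  rw [this, mulVec_smul]
  funext i; simp [div_eq_inv_mul]

theorem dvd_epsilon_iff {m l : ℤ} {μ : Fin n → ℝ} {h : Fin n → ℤ}
    (hh : S.map (Int.cast : ℤ → ℝ) *ᵥ μ = fun i => (h i : ℝ)) (d : ℕ) :
    d ∣ epsilon S (colVec (m : ℝ) μ (l : ℝ)) ↔
      (d : ℤ) ∣ m ∧ (∀ i, (d : ℤ) ∣ h i) ∧ (d : ℤ) ∣ l := by
  rw [epsilon, Finset.dvd_gcd_iff, S0_mulVec_colVec, hh]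
  constructor
  · intro H
    refine ⟨?_, fun i => ?_, ?_⟩
    · have := H lst (Finset.mem_univ _)
      simpa [Int.natCast_dvd] using this
    · have := H (mid i) (Finset.mem_univ _)
      simp only [colVec_mid, Pi.neg_apply, ← Int.cast_neg, Int.floor_intCast, Int.natAbs_neg] at this
      exact Int.natCast_dvd.2 this
    · have := H fst (Finset.mem_univ _)
      simpa [Int.natCast_dvd] using this
  · rintro ⟨h1, h2, h3⟩ i -
    revert i
    refine ext_cases ?_ (fun i => ?_) ?_
    · simpa [Int.natCast_dvd] using h3
    · simp only [colVec_mid, Pi.neg_apply, ← Int.cast_neg, Int.floor_intCast, Int.natAbs_neg]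
      exact Int.natCast_dvd.1 (h2 i)
    · simpa [Int.natCast_dvd] using h1

theorem isInt_div_iff {a : ℤ} {d : ℕ} (hd : d ≠ 0) : (∃ b : ℤ, (a : ℝ) / d = b) ↔ (d : ℤ) ∣ a := by
  have hd' : (d : ℝ) ≠ 0 := by exact_mod_cast hd
  constructor
  · rintro ⟨b, hb⟩
    rw [div_eq_iff hd'] at hb
    exact ⟨b, by rw [mul_comm]; exact_mod_cast hb⟩
  · rintro ⟨b, rfl⟩
    exact ⟨b, by push_cast; field_simp⟩

theorem div_mem_dual_iff {m l : ℤ} {μ : Fin n → ℝ} {h : Fin n → ℤ}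
    (hh : S.map (Int.cast : ℤ → ℝ) *ᵥ μ = fun i => (h i : ℝ)) {d : ℕ} (hd : d ≠ 0) :
    colVec ((m : ℝ) / d) (fun i => μ i / d) ((l : ℝ) / d) ∈ dualLattice S ↔
      (d : ℤ) ∣ m ∧ (∀ i, (d : ℤ) ∣ h i) ∧ (d : ℤ) ∣ l := by
  rw [mem_dual_iff, isInt_div_iff hd, isInt_div_iff hd, mulVec_div, hh]
  refine and_congr_right fun _ => and_congr_left fun _ => ?_
  constructor
  · rintro ⟨h', h2⟩ i
    rw [← isInt_div_iff hd]
    exact ⟨h' i, congrFun h2 i⟩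
  · intro H
    choose h' h2 using fun i => (isInt_div_iff hd).2 (H i)
    exact ⟨h', funext h2⟩

theorem dvd_epsilon_iff_mem {m l : ℝ} {μ : Fin n → ℝ} (hv : colVec m μ l ∈ dualLattice S) {d : ℕ}
    (hd : d ≠ 0) : d ∣ epsilon S (colVec m μ l) ↔
      colVec (m / d) (fun i => μ i / d) (l / d) ∈ dualLattice S := by
  obtain ⟨⟨a, rfl⟩, ⟨h, hh⟩, ⟨b, rfl⟩⟩ := mem_dual_iff.1 hv
  rw [dvd_epsilon_iff hh, div_mem_dual_iff hh hd]

theorem epsilon_ne_zero (hS : IsMaximalEven S) {m l : ℝ} {μ : Fin n → ℝ}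
    (hv : colVec m μ l ∈ dualLattice S) (h0 : colVec m μ l ≠ 0) :
    epsilon S (colVec m μ l) ≠ 0 := by
  obtain ⟨⟨a, rfl⟩, ⟨h, hh⟩, ⟨b, rfl⟩⟩ := mem_dual_iff.1 hv
  intro he
  have h1 := (dvd_epsilon_iff (m := a) (l := b) hh 0).1 (by rw [he])
  simp only [Nat.cast_zero, zero_dvd_iff] at h1
  have h2 : μ = 0 := S_injective hS μ (by rw [hh]; funext i; simp [h1.2.1 i])
  apply h0
  rw [h1.1, h1.2.2, h2]
  refine funext (ext_cases ?_ (fun i => ?_) ?_) <;> simp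

theorem koecher (hn : 1 ≤ n) (hS : IsMaximalEven S) (hf : IsModularForm S k f)
    {v : Ext (Fin n) → ℝ} (h : ¬ IsNonneg S v) : fourierCoeff S f v = 0 := by
  by_cases hv : v ∈ dualLattice S
  · obtain ⟨g, hg⟩ := hv
    rw [fourierCoeff_eq hS hg]
    by_contra h0
    exact h (isNonneg_of_freqCoeff_ne_zero hn hS hf hg h0)
  · exact fourierCoeff_of_not_mem hv

theorem quad_div (μ : Fin n → ℝ) (c : ℝ) : quad (S.map (Int.cast : ℤ → ℝ)) (fun i => μ i / c)
    = quad (S.map (Int.cast : ℤ → ℝ)) μ / c ^ 2 := by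
  have : (fun i => μ i / c) = c⁻¹ • μ := by funext i; simp [div_eq_inv_mul]
  rw [this, quad_eq_bil, bil_smul_left, bil_smul_right, quad_eq_bil]
  rw [div_eq_inv_mul, ← inv_pow]; ring

theorem isNonneg_colVec (m l : ℝ) (μ : Fin n → ℝ) : IsNonneg S (colVec m μ l) ↔
    0 ≤ m ∧ 0 ≤ l ∧ quad (S.map (Int.cast : ℤ → ℝ)) μ ≤ 2 * (m * l) := by
  unfold IsNonneg
  rw [quad_S0]
  simp only [colVec_fst, colVec_mid, colVec_lst]
  constructor
  · rintro ⟨h1, h2, h3⟩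
    have h3' : 0 ≤ 2 * m * l - quad (S.map (Int.cast : ℤ → ℝ)) μ := h3
    exact ⟨h1, h2, by linarith⟩
  · rintro ⟨h1, h2, h3⟩
    have h3' : 0 ≤ 2 * m * l - quad (S.map (Int.cast : ℤ → ℝ)) μ := by linarith
    exact ⟨h1, h2, h3'⟩

theorem isNonneg_div {m l c : ℝ} {μ : Fin n → ℝ} (hc : 0 < c) :
    IsNonneg S (colVec (m / c) (fun i => μ i / c) (l / c)) ↔ IsNonneg S (colVec m μ l) := by
  rw [isNonneg_colVec, isNonneg_colVec, quad_div, le_div_iff₀ hc, zero_mul, le_div_iff₀ hc, zero_mul]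
  have : 2 * (m / c * (l / c)) = 2 * (m * l) / c ^ 2 := by field_simp
  rw [this, div_le_div_iff_of_pos_right (by positivity)]

theorem colVec_div_eq_zero_iff {m l c : ℝ} {μ : Fin n → ℝ} (hc : c ≠ 0) :
    colVec (m / c) (fun i => μ i / c) (l / c) = 0 ↔ colVec m μ l = 0 := by
  have h1 : colVec (m / c) (fun i => μ i / c) (l / c) = c⁻¹ • colVec m μ l := by
    rw [smul_colVec]
    simp only [div_eq_inv_mul]
    rfl
  rw [h1, smul_eq_zero_iff_right (inv_ne_zero hc)]

theorem sum_divisors_prime_mul {p e : ℕ} (hp : p.Prime) (he : e ≠ 0) (F : ℕ → ℂ) :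
    ∑ d ∈ (p * e).divisors, F d =
      ∑ d ∈ (p * e).divisors.filter (fun d => ¬ p ∣ d), F d + ∑ d ∈ e.divisors, F (p * d) := by
  rw [← Finset.sum_filter_add_sum_filter_not _ (fun d => p ∣ d), add_comm]
  congr 1
  have : (p * e).divisors.filter (fun d => p ∣ d) = e.divisors.image fun d => p * d := by
    ext d
    simp only [Finset.mem_filter, Nat.mem_divisors, Finset.mem_image]
    constructor
    · rintro ⟨⟨h1, -⟩, ⟨c, rfl⟩⟩
      exact ⟨c, ⟨(Nat.mul_dvd_mul_iff_left hp.pos).1 h1, he⟩, rfl⟩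
    · rintro ⟨c, ⟨h1, -⟩, rfl⟩
      exact ⟨⟨Nat.mul_dvd_mul_left p h1, mul_ne_zero hp.ne_zero he⟩, dvd_mul_right _ _⟩
  rw [this, Finset.sum_image fun a _ b _ h => Nat.eq_of_mul_eq_mul_left hp.pos h]

/-- The divisors of `ε(λ)` that are multiples of `p` are `p d` with `d ∣ ε(λ/p)`; their part of the
sum is the Maaß sum of `λ/p` times `p^{k-1}`. If `p ∤ ε(λ)`, there are none and `λ/p` is not in the
dual lattice. -/
theorem maass_sub (hS : IsMaximalEven S) (hM : InMaassSpace S k f) {p : ℕ} (hp : p.Prime)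
    {m l : ℝ} {μ : Fin n → ℝ} (hv : colVec m μ l ∈ dualLattice S) (h0 : colVec m μ l ≠ 0)
    (hnn : IsNonneg S (colVec m μ l)) :
    fourierCoeff S f (colVec m μ l) -
      (p : ℂ) ^ (k - 1) * fourierCoeff S f (colVec (m / p) (fun i => μ i / p) (l / p)) =
    ∑ d ∈ (epsilon S (colVec m μ l)).divisors.filter (fun d => ¬ p ∣ d),
      (d : ℂ) ^ (k - 1) * fourierCoeff S f (colVec 1 (fun i => μ i / d) (l * m / (d : ℝ) ^ 2)) := by
  have hp0 : (0 : ℝ) < p := by exact_mod_cast hp.pos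
  rw [hM.2 m l μ hv hnn h0]
  by_cases hd : p ∣ epsilon S (colVec m μ l)
  · have hv' := (dvd_epsilon_iff_mem hv hp.ne_zero).1 hd
    have hε : epsilon S (colVec m μ l)
        = p * epsilon S (colVec (m / p) (fun i => μ i / p) (l / p)) := by
      refine Nat.dvd_antisymm ?_ ?_
      · obtain ⟨e, he⟩ := hd
        rw [he]
        refine Nat.mul_dvd_mul_left p ?_
        have he0 : e ≠ 0 := by
          rintro rfl
          exact epsilon_ne_zero hS hv h0 (by simpa using he)
        rw [dvd_epsilon_iff_mem hv' he0]
        have := (dvd_epsilon_iff_mem hv (mul_ne_zero hp.ne_zero he0)).1 (by rw [← he])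
        simpa [div_div] using this
      · have hne := epsilon_ne_zero hS hv' ((colVec_div_eq_zero_iff hp0.ne').not.2 h0)
        rw [dvd_epsilon_iff_mem hv (mul_ne_zero hp.ne_zero hne)]
        have := (dvd_epsilon_iff_mem hv' hne).1 dvd_rfl
        simpa [div_div] using this
    have hne := epsilon_ne_zero hS hv' ((colVec_div_eq_zero_iff hp0.ne').not.2 h0)
    rw [hM.2 _ _ _ hv' ((isNonneg_div hp0).2 hnn) ((colVec_div_eq_zero_iff hp0.ne').not.2 h0), hε,
      sum_divisors_prime_mul hp hne, add_sub_assoc, add_eq_left, sub_eq_zero, Finset.mul_sum]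
    refine Finset.sum_congr rfl fun d _ => ?_
    rw [← mul_assoc, Nat.cast_mul, mul_pow]
    congr 3
    · funext i
      push_cast
      rw [div_div]
    · push_cast
      rw [div_mul_div_comm, div_div]
      congr 1
      ring
  · have hv' := (dvd_epsilon_iff_mem hv hp.ne_zero).not.1 hd
    rw [fourierCoeff_of_not_mem hv', mul_zero, sub_zero]
    refine Finset.sum_congr ?_ fun _ _ => rfl
    ext d
    simp only [Finset.mem_filter, iff_self_and]
    exact fun h hpd => hd (hpd.trans (Nat.dvd_of_mem_divisors h))

theorem coeffRelation_of_maass (hn : 1 ≤ n) (hS : IsMaximalEven S) (hM : InMaassSpace S k f)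
    {p : ℕ} (hp : p.Prime) : CoeffRelation S k p f := by
  intro m l μ hv
  have hp0 : (0 : ℝ) < p := by exact_mod_cast hp.pos
  have hpz : (p : ℤ) ≠ 0 := by exact_mod_cast hp.ne_zero
  obtain ⟨-, ⟨h, hh⟩, -⟩ := mem_dual_iff.1 hv
  have e1 : (p : ℝ) * m = ((p * m : ℤ) : ℝ) := by push_cast; ring
  have e2 : (p : ℝ) * l = ((p * l : ℤ) : ℝ) := by push_cast; ring
  have hx : colVec ((p : ℝ) * m) μ (l : ℝ) ∈ dualLattice S :=
    mem_dual_iff.2 ⟨⟨_, e1⟩, ⟨h, hh⟩, ⟨l, rfl⟩⟩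
  have hy : colVec (m : ℝ) μ ((p : ℝ) * l) ∈ dualLattice S :=
    mem_dual_iff.2 ⟨⟨m, rfl⟩, ⟨h, hh⟩, ⟨_, e2⟩⟩
  -- The two terms carrying `p^{k-1}` are `x/p` and `y/p` for `x = (pm, μ, l)` and `y = (m, μ, pl)`.
  have hx' : ∀ c : ℝ, colVec ((m : ℝ)) (fun i => μ i / p) ((l : ℝ) / p)
      = colVec ((p : ℝ) * m / p) (fun i => μ i / p) ((l : ℝ) / p) := by
    intro c; rw [mul_div_cancel_left₀ _ hp0.ne']
  have hy' : colVec ((m : ℝ) / p) (fun i => μ i / p) (l : ℝ)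
      = colVec ((m : ℝ) / p) (fun i => μ i / p) ((p : ℝ) * l / p) := by
    rw [mul_div_cancel_left₀ _ hp0.ne']
  rw [hx' 0, hy']
  have hnn : IsNonneg S (colVec ((p : ℝ) * m) μ (l : ℝ)) ↔ IsNonneg S (colVec (m : ℝ) μ ((p : ℝ) * l)) := by
    rw [isNonneg_colVec, isNonneg_colVec, mul_nonneg_iff_of_pos_left hp0,
      mul_nonneg_iff_of_pos_left hp0]
    have : (p : ℝ) * m * l = m * (p * l) := by ring
    rw [this]
  by_cases h1 : IsNonneg S (colVec ((p : ℝ) * m) μ (l : ℝ))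
  · have hzero : colVec ((p : ℝ) * m) μ (l : ℝ) = 0 ↔ colVec (m : ℝ) μ ((p : ℝ) * l) = 0 := by
      have hz : (0 : Ext (Fin n) → ℝ) = colVec 0 0 0 :=
        funext (ext_cases rfl (fun _ => rfl) rfl)
      rw [hz, colVec_inj, colVec_inj]
      simp [hp0.ne']
    by_cases h0 : colVec ((p : ℝ) * m) μ (l : ℝ) = 0
    · have hz : (0 : Ext (Fin n) → ℝ) = colVec 0 0 0 :=
        funext (ext_cases rfl (fun _ => rfl) rfl)
      rw [hz, colVec_inj] at h0
      obtain ⟨h2, h3, h4⟩ := h0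
      have h5 : (m : ℝ) = 0 := by simpa [hp0.ne'] using h2
      rw [h3, h4, h5]
      simp
    have r1 := maass_sub hS hM hp hx h0 h1
    have r2 := maass_sub hS hM hp hy (hzero.not.1 h0) (hnn.1 h1)
    -- A divisor prime to `p` does not see which outer coordinate carries the factor `p`, and the
    -- product of the outer coordinates is the same on both sides.
    have r3 : ∑ d ∈ (epsilon S (colVec ((p : ℝ) * m) μ (l : ℝ))).divisors.filter (fun d => ¬ p ∣ d),
        (d : ℂ) ^ (k - 1) * fourierCoeff S f
          (colVec 1 (fun i => μ i / d) ((l : ℝ) * ((p : ℝ) * m) / (d : ℝ) ^ 2)) =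
        ∑ d ∈ (epsilon S (colVec (m : ℝ) μ ((p : ℝ) * l))).divisors.filter (fun d => ¬ p ∣ d),
        (d : ℂ) ^ (k - 1) * fourierCoeff S f
          (colVec 1 (fun i => μ i / d) ((p : ℝ) * l * m / (d : ℝ) ^ 2)) := by
      refine Finset.sum_congr ?_ fun d _ => ?_
      · ext d
        simp only [Finset.mem_filter, Nat.mem_divisors]
        refine and_congr_left fun hpd => ?_
        have hcop : IsCoprime (d : ℤ) (p : ℤ) :=
          Nat.isCoprime_iff_coprime.2 ((Nat.coprime_comm.1 ((hp.coprime_iff_not_dvd).2 hpd)))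
        rw [and_iff_left (epsilon_ne_zero hS hx h0),
          and_iff_left (epsilon_ne_zero hS hy (hzero.not.1 h0)), e1, e2, dvd_epsilon_iff hh,
          dvd_epsilon_iff hh]
        have a1 : (d : ℤ) ∣ p * m ↔ (d : ℤ) ∣ m :=
          ⟨fun h => hcop.dvd_of_dvd_mul_left h, fun h => h.mul_left _⟩
        have a2 : (d : ℤ) ∣ p * l ↔ (d : ℤ) ∣ l :=
          ⟨fun h => hcop.dvd_of_dvd_mul_left h, fun h => h.mul_left _⟩
        rw [a1, a2]
      · congr 4
        ring
    rw [r3] at r1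
    linear_combination r1 - r2
  · have h2 := hnn.not.1 h1
    rw [koecher hn hS hM.1 h1, koecher hn hS hM.1 h2,
      koecher hn hS hM.1 ((isNonneg_div hp0).not.2 h1), koecher hn hS hM.1 ((isNonneg_div hp0).not.2 h2)]

end Arithmetic

end OrthMaass

namespace OrthMaass

open Matrix

/-! ### The implication (iii) ⇒ (ii). -/

section Arithmetic

variable {n : ℕ} {S : Matrix (Fin n) (Fin n) ℤ} {k : ℕ} {f : (Ext (Fin n) → ℂ) → ℂ}

theorem mul_mem_dual {m l : ℤ} {μ : Fin n → ℝ} (h : colVec (m : ℝ) μ (l : ℝ) ∈ dualLattice S)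
    (m' l' : ℤ) : colVec (m' : ℝ) μ (l' : ℝ) ∈ dualLattice S :=
  mem_dual_iff.2 ⟨⟨m', rfl⟩, (mem_dual_iff.1 h).2.1, ⟨l', rfl⟩⟩

theorem mem_dual_of_div {m m' l l' : ℝ} {μ : Fin n → ℝ} (d : ℕ) (hd : d ≠ 0)
    (h : colVec m' (fun i => μ i / (d : ℝ)) l' ∈ dualLattice S)
    (hm : ∃ a : ℤ, m = a) (hl : ∃ a : ℤ, l = a) : colVec m μ l ∈ dualLattice S := by
  refine mem_dual_iff.2 ⟨hm, ?_, hl⟩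
  obtain ⟨h', hh⟩ := (mem_dual_iff.1 h).2.1
  have hd' : (d : ℝ) ≠ 0 := by exact_mod_cast hd
  rw [mulVec_div] at hh
  refine ⟨fun i => d * h' i, funext fun i => ?_⟩
  have := congrFun hh i
  beta_reduce at this
  rw [div_eq_iff hd'] at this
  rw [this]; push_cast; ring

theorem exists_int_of_div {l : ℝ} {d : ℕ} (hd : d ≠ 0) (h : ∃ a : ℤ, l / d = a) :
    ∃ a : ℤ, l = a := by
  obtain ⟨a, ha⟩ := h
  have hd' : (d : ℝ) ≠ 0 := by exact_mod_cast hd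
  rw [div_eq_iff hd'] at ha
  exact ⟨a * d, by rw [ha]; push_cast; ring⟩

open Classical in
-- Of the three divisibility conditions only that on `l` matters: `p^j` divides `p^r m` for `j ≤ r`,
-- and if `μ/p^j` is inadmissible the coefficient is zero anyway.
theorem pMaass_sum_eq {p : ℕ} (hp : p ≠ 0) (r : ℕ) (m : ℤ) (l : ℝ) (μ : Fin n → ℝ) :
    ∑ j ∈ (Finset.range (r + 1)).filter
          (fun j => ((p : ℝ) ^ j)⁻¹ • colVec ((p : ℝ) ^ r * m) μ l ∈ dualLattice S),
        (p : ℂ) ^ (j * (k - 1)) *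
          fourierCoeff S f (colVec (m : ℝ) (fun i => μ i / (p : ℝ) ^ j)
            ((p : ℝ) ^ r * l / (p : ℝ) ^ (2 * j)))
    = ∑ j ∈ Finset.range (r + 1), if ∃ a : ℤ, l / (p : ℝ) ^ j = a then
        (p : ℂ) ^ (j * (k - 1)) *
          fourierCoeff S f (colVec (m : ℝ) (fun i => μ i / (p : ℝ) ^ j)
            ((p : ℝ) ^ r * l / (p : ℝ) ^ (2 * j))) else 0 := by
  have hp' : (p : ℝ) ≠ 0 := by exact_mod_cast hp
  rw [Finset.sum_filter]
  refine Finset.sum_congr rfl fun j hj => ?_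
  have hjr : j ≤ r := Nat.lt_succ_iff.1 (Finset.mem_range.1 hj)
  have hsc : ((p : ℝ) ^ j)⁻¹ • colVec ((p : ℝ) ^ r * m) μ l
      = colVec ((p : ℝ) ^ r * m / (p : ℝ) ^ j) (fun i => μ i / (p : ℝ) ^ j) (l / (p : ℝ) ^ j) := by
    rw [smul_colVec]
    simp only [div_eq_inv_mul]
    rfl
  rw [hsc, mem_dual_iff]
  have hm : ∃ a : ℤ, (p : ℝ) ^ r * m / (p : ℝ) ^ j = a := by
    refine ⟨(p : ℤ) ^ (r - j) * m, ?_⟩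
    have : (p : ℝ) ^ r = (p : ℝ) ^ (r - j) * (p : ℝ) ^ j := by rw [← pow_add, Nat.sub_add_cancel hjr]
    rw [this]; push_cast; field_simp
  by_cases hD : ∃ h : Fin n → ℤ, S.map (Int.cast : ℤ → ℝ) *ᵥ (fun i => μ i / (p : ℝ) ^ j)
      = fun i => (h i : ℝ)
  · simp only [hm, hD, true_and]
  · have : fourierCoeff S f (colVec (m : ℝ) (fun i => μ i / (p : ℝ) ^ j)
            ((p : ℝ) ^ r * l / (p : ℝ) ^ (2 * j))) = 0 :=
      fourierCoeff_of_not_mem fun h => hD (mem_dual_iff.1 h).2.1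
    rw [this]
    simp

open Classical in
-- Real `l` and arbitrary `μ` are allowed so that the induction hypothesis applies to `μ/p` and
-- `l/p` without checking membership in the dual lattice. Outside it both sides vanish.
theorem pMaass_of_coeffRelation {p : ℕ} (hp : p.Prime) (hR : CoeffRelation S k p f) {m : ℤ}
    (hm : ¬ (p : ℤ) ∣ m) (r : ℕ) : ∀ (l : ℝ) (μ : Fin n → ℝ),
    fourierCoeff S f (colVec ((p : ℝ) ^ r * m) μ l) =
      ∑ j ∈ Finset.range (r + 1), if ∃ a : ℤ, l / (p : ℝ) ^ j = a then
        (p : ℂ) ^ (j * (k - 1)) *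
          fourierCoeff S f (colVec (m : ℝ) (fun i => μ i / (p : ℝ) ^ j)
            ((p : ℝ) ^ r * l / (p : ℝ) ^ (2 * j))) else 0 := by
  have hp0 := hp.ne_zero
  have hp' : (p : ℝ) ≠ 0 := by exact_mod_cast hp0
  induction r using Nat.strong_induction_on with
  | _ r ih =>
  intro l μ
  by_cases hv : colVec ((p : ℝ) ^ r * m) μ l ∈ dualLattice S
  swap
  · rw [fourierCoeff_of_not_mem hv, eq_comm]
    refine Finset.sum_eq_zero fun j _ => ?_
    split_ifs with h
    · rw [fourierCoeff_of_not_mem, mul_zero]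
      intro h2
      refine hv ?_
      refine mem_dual_of_div (p ^ j) (pow_ne_zero _ hp0) (by push_cast; exact h2)
        ⟨(p : ℤ) ^ r * m, by push_cast; ring⟩ ?_
      exact exists_int_of_div (pow_ne_zero j hp0) (by push_cast; exact h)
    · rfl
  obtain ⟨-, -, ⟨b, rfl⟩⟩ := mem_dual_iff.1 hv
  match r, ih, hv with
  | 0, _, _ =>
    simp
  | 1, _, hv =>
    have hv1 : colVec (m : ℝ) μ (b : ℝ) ∈ dualLattice S :=
      mul_mem_dual (m := p * m) (by push_cast; simpa using hv) m b
    have := hR m b μ hv1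
    -- Since `p ∤ m`, the first step of the recursion has no second predecessor.
    have h0 : fourierCoeff S f (colVec ((m : ℝ) / p) (fun i => μ i / p) (b : ℝ)) = 0 := by
      refine fourierCoeff_of_not_mem fun h => hm ?_
      exact (isInt_div_iff hp0).1 (mem_dual_iff.1 h).1
    rw [h0, mul_zero, add_zero] at this
    rw [pow_one, this, Finset.sum_range_succ, Finset.sum_range_one]
    have c0 : ∃ a : ℤ, (b : ℝ) / (p : ℝ) ^ 0 = a := ⟨b, by simp⟩
    rw [if_pos c0]
    congr 1
    · simp
    · have hq : (p : ℝ) * b / (p : ℝ) ^ (2 * 1) = b / p := by field_simp; ring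
      split_ifs with h
      · simp only [pow_one, one_mul]
        rw [show (p : ℝ) ^ (2 * 1) = (p : ℝ) ^ 2 by norm_num] at hq
        rw [show (p : ℝ) ^ (2 * 1) = (p : ℝ) ^ 2 by norm_num, hq]
      · rw [fourierCoeff_of_not_mem, mul_zero]
        intro h2
        exact h (by rw [pow_one]; exact (mem_dual_iff.1 h2).2.2)
  | r + 2, ih, hv =>
    have e0 : (p : ℝ) ^ (r + 2) * m = p * (((p : ℤ) ^ (r + 1) * m : ℤ) : ℝ) := by
      push_cast; ring
    have e1 : (((p : ℤ) ^ (r + 1) * m : ℤ) : ℝ) = (p : ℝ) ^ (r + 1) * m := by push_cast; ring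
    have e2 : (((p : ℤ) ^ (r + 1) * m : ℤ) : ℝ) / p = (p : ℝ) ^ r * m := by
      push_cast; field_simp; ring
    have hv1 : colVec (((p : ℤ) ^ (r + 1) * m : ℤ) : ℝ) μ (b : ℝ) ∈ dualLattice S :=
      mul_mem_dual (m := p * ((p : ℤ) ^ (r + 1) * m)) (by
        rw [e0] at hv; push_cast at hv ⊢; exact hv) _ b
    have rel := hR _ b μ hv1
    rw [← e0, e2, e1, ih (r + 1) (by omega), ih (r + 1) (by omega), ih r (by omega)] at rel
    -- All three sums supplied by the induction hypothesis have terms from this one sequence, up to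
    -- a shift of `j`.
    set A : ℕ → ℂ := fun j => (p : ℂ) ^ (j * (k - 1)) *
          fourierCoeff S f (colVec (m : ℝ) (fun i => μ i / (p : ℝ) ^ j)
            ((p : ℝ) ^ (r + 2) * b / (p : ℝ) ^ (2 * j))) with hA
    have s1 : ∀ j, (if ∃ a : ℤ, (p : ℝ) * b / (p : ℝ) ^ j = a then (p : ℂ) ^ (j * (k - 1)) *
          fourierCoeff S f (colVec (m : ℝ) (fun i => μ i / (p : ℝ) ^ j)
            ((p : ℝ) ^ (r + 1) * (p * b) / (p : ℝ) ^ (2 * j))) else 0)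
        = if ∃ a : ℤ, (p : ℝ) * b / (p : ℝ) ^ j = a then A j else 0 := by
      intro j
      have : (p : ℝ) ^ (r + 1) * (p * b) = (p : ℝ) ^ (r + 2) * b := by ring
      rw [this]
    have hpow : ∀ j, (p : ℂ) ^ ((j + 1) * (k - 1))
        = (p : ℂ) ^ (k - 1) * (p : ℂ) ^ (j * (k - 1)) := by
      intro j; rw [← pow_add]; congr 1; ring
    have hmu : ∀ j : ℕ, (fun i => μ i / (p : ℝ) / (p : ℝ) ^ j) = fun i => μ i / (p : ℝ) ^ (j + 1) := by
      intro j; funext i; rw [div_div]; congr 1; ring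
    have s2 : (p : ℂ) ^ (k - 1) * ∑ j ∈ Finset.range (r + 1 + 1),
        (if ∃ a : ℤ, (b : ℝ) / p / (p : ℝ) ^ j = a then (p : ℂ) ^ (j * (k - 1)) *
          fourierCoeff S f (colVec (m : ℝ) (fun i => μ i / p / (p : ℝ) ^ j)
            ((p : ℝ) ^ (r + 1) * (b / p) / (p : ℝ) ^ (2 * j))) else 0)
        = ∑ j ∈ Finset.range (r + 2), if ∃ a : ℤ, (b : ℝ) / (p : ℝ) ^ (j + 1) = a then
            A (j + 1) else 0 := by
      rw [Finset.mul_sum]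
      refine Finset.sum_congr rfl fun j _ => ?_
      have t1 : (b : ℝ) / p / (p : ℝ) ^ j = b / (p : ℝ) ^ (j + 1) := by
        rw [div_div]; congr 1; ring
      have t2 : (p : ℝ) ^ (r + 1) * (b / p) / (p : ℝ) ^ (2 * j)
          = (p : ℝ) ^ (r + 2) * b / (p : ℝ) ^ (2 * (j + 1)) := by
        rw [div_eq_div_iff (by positivity) (by positivity)]; field_simp; ring
      rw [t1, t2, hmu, mul_ite, mul_zero]
      refine if_congr Iff.rfl ?_ rfl
      rw [hA]
      beta_reduce
      rw [hpow]; ring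
    have s3 : (p : ℂ) ^ (k - 1) * ∑ j ∈ Finset.range (r + 1),
        (if ∃ a : ℤ, (b : ℝ) / (p : ℝ) ^ j = a then (p : ℂ) ^ (j * (k - 1)) *
          fourierCoeff S f (colVec (m : ℝ) (fun i => μ i / p / (p : ℝ) ^ j)
            ((p : ℝ) ^ r * b / (p : ℝ) ^ (2 * j))) else 0)
        = ∑ j ∈ Finset.range (r + 1), if ∃ a : ℤ, (b : ℝ) / (p : ℝ) ^ j = a then
            A (j + 1) else 0 := by
      rw [Finset.mul_sum]
      refine Finset.sum_congr rfl fun j _ => ?_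
      have t2 : (p : ℝ) ^ r * b / (p : ℝ) ^ (2 * j)
          = (p : ℝ) ^ (r + 2) * b / (p : ℝ) ^ (2 * (j + 1)) := by
        rw [div_eq_div_iff (by positivity) (by positivity)]; ring
      rw [t2, hmu, mul_ite, mul_zero]
      refine if_congr Iff.rfl ?_ rfl
      rw [hA]
      beta_reduce
      rw [hpow]; ring
    rw [s2, s3] at rel
    simp only [s1] at rel
    -- After splitting off `A 0`, the condition `p^{j+1} ∣ p b` becomes `p^j ∣ b`. The rest of this
    -- sum cancels against the one from `p^r m`.
    rw [Finset.sum_range_succ' _ (r + 1), if_pos ⟨p * b, by simp⟩] at rel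
    have s4 : ∀ j : ℕ, (p : ℝ) * b / (p : ℝ) ^ (j + 1) = b / (p : ℝ) ^ j := by
      intro j
      rw [div_eq_div_iff (by positivity) (by positivity)]; ring
    simp only [s4] at rel
    have goal : ∑ j ∈ Finset.range (r + 2 + 1), (if ∃ a : ℤ, (b : ℝ) / (p : ℝ) ^ j = a then A j else 0)
        = ∑ j ∈ Finset.range (r + 2), (if ∃ a : ℤ, (b : ℝ) / (p : ℝ) ^ (j + 1) = a then
            A (j + 1) else 0) + A 0 := by
      rw [Finset.sum_range_succ', if_pos ⟨b, by simp⟩]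
    rw [show fourierCoeff S f (colVec ((p : ℝ) ^ (r + 2) * m) μ b) =
      ∑ j ∈ Finset.range (r + 2 + 1), (if ∃ a : ℤ, (b : ℝ) / (p : ℝ) ^ j = a then A j else 0) by
        rw [goal]; linear_combination rel]

/-- At `m = 0`, `μ = 0` both terms on the left of the relation are multiples of `α(0, 0, l)`. The
resulting two-step recursion in the exponent of `p` is solved by the geometric sum. -/
theorem zero_coeff_of_coeffRelation {p : ℕ} (hp : p.Prime) (hR : CoeffRelation S k p f) {m : ℤ}
    (hm : ¬ (p : ℤ) ∣ m) (r : ℕ) :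
    fourierCoeff S f (colVec 0 0 ((p : ℝ) ^ r * m)) =
      (∑ j ∈ Finset.range (r + 1), (p : ℂ) ^ (j * (k - 1))) *
        fourierCoeff S f (colVec 0 0 (m : ℝ)) := by
  have hp' : (p : ℝ) ≠ 0 := by exact_mod_cast hp.ne_zero
  have hz : (fun i => (0 : Fin n → ℝ) i / (p : ℝ)) = 0 := by funext i; simp
  have rel : ∀ l : ℤ, fourierCoeff S f (colVec 0 0 (l : ℝ))
      + (p : ℂ) ^ (k - 1) * fourierCoeff S f (colVec 0 0 (l : ℝ))
      = fourierCoeff S f (colVec 0 0 ((p : ℝ) * l))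
      + (p : ℂ) ^ (k - 1) * fourierCoeff S f (colVec 0 0 ((l : ℝ) / p)) := by
    intro l
    have := hR 0 l 0 (mem_dual_iff.2 ⟨⟨0, rfl⟩, ⟨0, by simp; rfl⟩, ⟨l, rfl⟩⟩)
    rw [hz] at this
    simpa using this
  induction r using Nat.strong_induction_on with
  | _ r ih =>
  match r, ih with
  | 0, _ => simp
  | 1, _ =>
    have := rel m
    rw [fourierCoeff_of_not_mem (v := colVec 0 0 ((m : ℝ) / p)), mul_zero, add_zero] at this
    · rw [pow_one, ← this, Finset.sum_range_succ, Finset.sum_range_one]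
      simp only [zero_mul, pow_zero, one_mul]
      ring
    · intro h
      exact hm ((isInt_div_iff hp.ne_zero).1 (mem_dual_iff.1 h).2.2)
  | r + 2, ih =>
    have := rel ((p : ℤ) ^ (r + 1) * m)
    have e1 : (((p : ℤ) ^ (r + 1) * m : ℤ) : ℝ) = (p : ℝ) ^ (r + 1) * m := by push_cast; ring
    have e2 : (p : ℝ) ^ (r + 1) * m / p = (p : ℝ) ^ r * m := by field_simp; ring
    have e3 : (p : ℝ) * ((p : ℝ) ^ (r + 1) * m) = (p : ℝ) ^ (r + 2) * m := by ring
    rw [e1, e2, e3, ih (r + 1) (by omega), ih r (by omega)] at this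
    rw [Finset.sum_range_succ _ (r + 2), Finset.sum_range_succ _ (r + 1)]
    rw [Finset.sum_range_succ _ (r + 1)] at this
    have hpow : (p : ℂ) ^ ((r + 2) * (k - 1))
        = (p : ℂ) ^ (k - 1) * (p : ℂ) ^ ((r + 1) * (k - 1)) := by
      rw [← pow_add]; congr 1; ring
    rw [hpow]
    linear_combination -this

theorem pMaassCondition_of_coeffRelation {p : ℕ} (hp : p.Prime) (hR : CoeffRelation S k p f) :
    PMaassCondition S k p f := by
  refine ⟨fun r m l μ _ hm => ?_, fun r m hm => zero_coeff_of_coeffRelation hp hR hm r⟩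
  rw [pMaass_sum_eq hp.ne_zero]
  exact pMaass_of_coeffRelation hp hR hm r l μ

end Arithmetic

end OrthMaass

namespace OrthMaass

open Matrix

/-! ### The implication (ii) ⇒ (i). -/

section Maass

variable {n : ℕ} {S : Matrix (Fin n) (Fin n) ℤ} {k : ℕ} {f : (Ext (Fin n) → ℂ) → ℂ}

theorem sum_divisors_prime_pow_mul {p M : ℕ} (hp : p.Prime) (hM : ¬ p ∣ M) (r : ℕ) (F : ℕ → ℂ) :
    ∑ d ∈ (p ^ r * M).divisors, F d =
      ∑ j ∈ Finset.range (r + 1), ∑ d ∈ M.divisors, F (p ^ j * d) := by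
  have hc : (p ^ r).Coprime M := Nat.Coprime.pow_left r ((hp.coprime_iff_not_dvd).2 hM)
  rw [Nat.divisors_mul, Finset.mul_def, Finset.sum_image hc.mul_injOn_divisors,
    Finset.sum_product, Nat.sum_divisors_prime_pow hp]

open Classical in
-- Write `M = p^r N` with `p ∤ N`: the condition at `p` reduces to first coordinate `N`, and the
-- divisors of `M` are the products `p^j d` with `d ∣ N`. As before, only integrality of `l/d` is
-- recorded.
theorem pMaass_expansion (hp : ∀ p : ℕ, p.Prime → PMaassCondition S k p f) {M : ℕ} (hM : M ≠ 0) :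
    ∀ (l : ℝ) (μ : Fin n → ℝ), fourierCoeff S f (colVec (M : ℝ) μ l) =
      ∑ d ∈ M.divisors, if ∃ a : ℤ, l / (d : ℝ) = a then
        (d : ℂ) ^ (k - 1) *
          fourierCoeff S f (colVec 1 (fun i => μ i / (d : ℝ)) (l * M / (d : ℝ) ^ 2)) else 0 := by
  induction M using Nat.strong_induction_on with
  | _ M ih =>
  intro l μ
  by_cases hv : colVec (M : ℝ) μ l ∈ dualLattice S
  swap
  · rw [fourierCoeff_of_not_mem hv, eq_comm]
    refine Finset.sum_eq_zero fun d hd => ?_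
    have hd0 : d ≠ 0 := (Nat.pos_of_mem_divisors hd).ne'
    split_ifs with h
    · rw [fourierCoeff_of_not_mem, mul_zero]
      exact fun h2 => hv (mem_dual_of_div d hd0 h2 ⟨M, by simp⟩ (exists_int_of_div hd0 h))
    · rfl
  obtain ⟨-, -, ⟨b, rfl⟩⟩ := mem_dual_iff.1 hv
  by_cases h1 : M = 1
  · subst h1
    simp
  obtain ⟨p, hpp, hpM⟩ := Nat.exists_prime_and_dvd h1
  obtain ⟨r, N, hpN, rfl⟩ := Nat.exists_eq_pow_mul_and_not_dvd hM p hpp.ne_one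
  have hN : N ≠ 0 := fun h => hpN (h ▸ dvd_zero p)
  have hr : r ≠ 0 := by
    rintro rfl
    exact hpN (by simpa using hpM)
  have hlt : N < p ^ r * N :=
    lt_mul_of_one_lt_left (Nat.pos_of_ne_zero hN) (Nat.one_lt_pow hr hpp.one_lt)
  have hp0 : (p : ℝ) ≠ 0 := by exact_mod_cast hpp.ne_zero
  have hv' : colVec (((N : ℤ) : ℤ) : ℝ) μ (b : ℝ) ∈ dualLattice S :=
    mul_mem_dual (m := ((p ^ r * N : ℕ) : ℤ)) (by exact_mod_cast hv) N b
  have key := (hp p hpp).1 r N b μ hv' (by exact_mod_cast hpN)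
  rw [pMaass_sum_eq hpp.ne_zero] at key
  rw [sum_divisors_prime_pow_mul hpp hpN]
  have e0 : ((p ^ r * N : ℕ) : ℝ) = (p : ℝ) ^ r * ((N : ℤ) : ℝ) := by push_cast; ring
  rw [e0, key]
  refine Finset.sum_congr rfl fun j hj => ?_
  have hjr : j ≤ r := Nat.lt_succ_iff.1 (Finset.mem_range.1 hj)
  have hpj : p ^ j ≠ 0 := pow_ne_zero _ hpp.ne_zero
  have c1 : (∃ a : ℤ, (b : ℝ) / (p : ℝ) ^ j = a) ↔ ((p ^ j : ℕ) : ℤ) ∣ b := by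
    rw [← isInt_div_iff hpj]; push_cast; rfl
  rw [Int.cast_natCast, ih N hlt hN]
  split_ifs with hb
  · obtain ⟨b', hb'⟩ := c1.1 hb
    rw [Finset.mul_sum]
    refine Finset.sum_congr rfl fun d hd => ?_
    have hd0 : d ≠ 0 := (Nat.pos_of_mem_divisors hd).ne'
    have hdr : (d : ℝ) ≠ 0 := by exact_mod_cast hd0
    have hcop : IsCoprime (d : ℤ) ((p ^ (r - j) : ℕ) : ℤ) :=
      Nat.isCoprime_iff_coprime.2 (Nat.Coprime.pow_right _ (Nat.coprime_comm.1
        ((hpp.coprime_iff_not_dvd).2 fun h => hpN (h.trans (Nat.dvd_of_mem_divisors hd)))))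
    have hbr : (b : ℝ) = (p : ℝ) ^ j * b' := by rw [hb']; push_cast; ring
    have hpr : (p : ℝ) ^ r = (p : ℝ) ^ (r - j) * (p : ℝ) ^ j := by
      rw [← pow_add, Nat.sub_add_cancel hjr]
    -- With `b = p^j b'` both sides say `d ∣ b'`; the surplus factor `p^{r-j}` on the left is prime
    -- to `d`.
    have c2 : (∃ a : ℤ, (p : ℝ) ^ r * b / (p : ℝ) ^ (2 * j) / d = a) ↔
        ∃ a : ℤ, (b : ℝ) / ((p ^ j * d : ℕ) : ℝ) = a := by
      have t1 : (p : ℝ) ^ r * b / (p : ℝ) ^ (2 * j) = (((p ^ (r - j) : ℕ) * b' : ℤ) : ℝ) := by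
        rw [hbr, hpr, two_mul, pow_add]; push_cast; field_simp
      have t2 : (b : ℝ) / ((p ^ j * d : ℕ) : ℝ) = (b' : ℝ) / d := by
        rw [hbr]; push_cast; field_simp
      rw [t1, t2, isInt_div_iff hd0, isInt_div_iff hd0]
      exact ⟨fun h => hcop.dvd_of_dvd_mul_left h, fun h => h.mul_left _⟩
    have e1 : (fun i => μ i / (p : ℝ) ^ j / (d : ℝ)) = fun i => μ i / ((p ^ j * d : ℕ) : ℝ) := by
      funext i; rw [div_div]; push_cast; rfl
    have e2 : (p : ℝ) ^ r * b / (p : ℝ) ^ (2 * j) * N / (d : ℝ) ^ 2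
        = b * ((p : ℝ) ^ r * N) / ((p ^ j * d : ℕ) : ℝ) ^ 2 := by
      rw [two_mul, pow_add]; push_cast; field_simp
    have e3 : ((p ^ j * d : ℕ) : ℂ) ^ (k - 1) = (p : ℂ) ^ (j * (k - 1)) * (d : ℂ) ^ (k - 1) := by
      push_cast; rw [mul_pow, pow_mul]
    rw [mul_ite, mul_zero, e1, e2, e3, mul_assoc]
    exact if_congr c2 rfl rfl
  · refine (Finset.sum_eq_zero fun d hd => if_neg ?_).symm
    have hd0 : d ≠ 0 := (Nat.pos_of_mem_divisors hd).ne'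
    rw [isInt_div_iff (mul_ne_zero hpj hd0)]
    intro h
    exact hb (c1.2 (dvd_trans (by push_cast; exact dvd_mul_right _ _) h))

theorem maass_of_pMaass_of_pos (hS : IsMaximalEven S)
    (hp : ∀ p : ℕ, p.Prime → PMaassCondition S k p f) {M : ℕ} (hM : M ≠ 0) {l : ℝ} {μ : Fin n → ℝ}
    (hv : colVec (M : ℝ) μ l ∈ dualLattice S) :
    fourierCoeff S f (colVec (M : ℝ) μ l) =
      ∑ d ∈ (epsilon S (colVec (M : ℝ) μ l)).divisors, (d : ℂ) ^ (k - 1) *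
        fourierCoeff S f (colVec 1 (fun i => μ i / d) (l * M / (d : ℝ) ^ 2)) := by
  classical
  have h0 : colVec (M : ℝ) μ l ≠ 0 := fun h => hM (by
    have := congrFun h fst
    simpa using this)
  have hε := epsilon_ne_zero hS hv h0
  rw [pMaass_expansion hp hM]
  symm
  rw [← Finset.sum_filter]
  obtain ⟨-, ⟨h, hh⟩, ⟨b, rfl⟩⟩ := mem_dual_iff.1 hv
  have hM' : (M : ℝ) = ((M : ℤ) : ℝ) := by simp
  refine Finset.sum_subset (fun d hd => ?_) fun d hd hd' => ?_
  · have hd0 : d ≠ 0 := (Nat.pos_of_mem_divisors hd).ne'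
    have hde := Nat.dvd_of_mem_divisors hd
    rw [hM', dvd_epsilon_iff hh] at hde
    rw [Finset.mem_filter, Nat.mem_divisors, isInt_div_iff hd0]
    exact ⟨⟨by exact_mod_cast hde.1, hM⟩, hde.2.2⟩
  · rw [Finset.mem_filter] at hd
    obtain ⟨hdM, hl⟩ := hd
    have hd0 : d ≠ 0 := (Nat.pos_of_mem_divisors hdM).ne'
    rw [fourierCoeff_of_not_mem, mul_zero]
    intro h2
    refine hd' (Nat.mem_divisors.2 ⟨(dvd_epsilon_iff_mem hv hd0).2 ?_, hε⟩)
    refine mem_dual_iff.2 ⟨?_, (mem_dual_iff.1 h2).2.1, hl⟩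
    rw [hM', isInt_div_iff hd0]
    exact_mod_cast Nat.dvd_of_mem_divisors hdM

theorem epsilon_mul_zero (l : ℕ) : epsilon S (colVec 0 0 (l : ℝ)) = l ∧
    epsilon S (colVec (l : ℝ) 0 0) = l := by
  have hz : S.map (Int.cast : ℤ → ℝ) *ᵥ 0 = fun i => (((0 : Fin n → ℤ) i : ℤ) : ℝ) := by
    simp; rfl
  constructor <;> refine Nat.dvd_left_iff_eq.1 fun d => ?_
  · have := dvd_epsilon_iff (S := S) (m := 0) (l := l) hz d
    simpa [Int.natCast_dvd_natCast] using this
  · have := dvd_epsilon_iff (S := S) (m := l) (l := 0) hz d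
    simpa [Int.natCast_dvd_natCast] using this

theorem coeff_zero_lst (hp : ∀ p : ℕ, p.Prime → PMaassCondition S k p f) {l : ℕ} (hl : l ≠ 0) :
    fourierCoeff S f (colVec 0 0 (l : ℝ)) =
      (∑ d ∈ l.divisors, (d : ℂ) ^ (k - 1)) * fourierCoeff S f (colVec 0 0 1) := by
  induction l using Nat.strong_induction_on with
  | _ l ih =>
  by_cases h1 : l = 1
  · subst h1
    simp
  obtain ⟨p, hpp, hpl⟩ := Nat.exists_prime_and_dvd h1
  obtain ⟨r, N, hpN, rfl⟩ := Nat.exists_eq_pow_mul_and_not_dvd hl p hpp.ne_one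
  have hN : N ≠ 0 := fun h => hpN (h ▸ dvd_zero p)
  have hr : r ≠ 0 := by
    rintro rfl
    exact hpN (by simpa using hpl)
  have hlt : N < p ^ r * N :=
    lt_mul_of_one_lt_left (Nat.pos_of_ne_zero hN) (Nat.one_lt_pow hr hpp.one_lt)
  have key := (hp p hpp).2 r N (by exact_mod_cast hpN)
  rw [Int.cast_natCast, ih N hlt hN, ← mul_assoc] at key
  rw [sum_divisors_prime_pow_mul hpp hpN, Nat.cast_mul, Nat.cast_pow, key, Finset.sum_mul_sum]
  congr 1
  refine Finset.sum_congr rfl fun j _ => Finset.sum_congr rfl fun d _ => ?_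
  push_cast
  rw [mul_pow, pow_mul]

/-- The case `μ = 0`, `l = 0` of the expansion for positive first coordinate, where every term
involves the same coefficient. -/
theorem coeff_zero_fst (hS : IsMaximalEven S) (hp : ∀ p : ℕ, p.Prime → PMaassCondition S k p f)
    {l : ℕ} (hl : l ≠ 0) :
    fourierCoeff S f (colVec (l : ℝ) 0 0) =
      (∑ d ∈ l.divisors, (d : ℂ) ^ (k - 1)) * fourierCoeff S f (colVec 1 0 0) := by
  have hv : colVec (l : ℝ) (0 : Fin n → ℝ) 0 ∈ dualLattice S :=
    mem_dual_iff.2 ⟨⟨l, by simp⟩, ⟨0, by simp; rfl⟩, ⟨0, by simp⟩⟩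
  rw [maass_of_pMaass_of_pos hS hp hl hv, (epsilon_mul_zero l).2, Finset.sum_mul]
  refine Finset.sum_congr rfl fun d _ => ?_
  congr 3
  · funext i; simp
  · simp

/-- Both boundary series have coefficients `σ_{k-1}(l)` times a constant, so the analytic comparison
applies. The frequency `S₀ λ` interchanges the outer coordinates of `λ`, hence the swapped flags. -/
theorem boundary_coeff_symm (hn : 1 ≤ n) (hS : IsMaximalEven S) (hf : IsModularForm S k f)
    (hp : ∀ p : ℕ, p.Prime → PMaassCondition S k p f) :
    fourierCoeff S f (colVec 0 0 1) = fourierCoeff S f (colVec 1 0 0) := by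
  have hcoef : ∀ s (l : ℕ), freqCoeff f (flagVec s (l : ℤ) 0)
      = fourierCoeff S f (flagVec s 0 (l : ℝ)) := by
    intro s l
    refine (fourierCoeff_eq hS ?_).symm
    cases s
    all_goals
      simp only [flagVec, cond_true, cond_false]
      rw [S0_mulVec_colVec]
      exact funext (ext_cases (by simp) (fun i => by simp) (by simp))
  have key := boundary_coeff_eq hn hS hf (σ := fun l => ∑ d ∈ l.divisors, (d : ℝ) ^ (k - 1))
    (c := fun s => fourierCoeff S f (flagVec s 0 1)) (by simp)
    (fun l => Finset.sum_nonneg fun d _ => by positivity) (fun s l hl => by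
      rw [hcoef]
      push_cast
      cases s
      · exact coeff_zero_fst hS hp hl.ne'
      · exact coeff_zero_lst hp hl.ne')
  exact key

theorem inMaassSpace_of_pMaass (hn : 1 ≤ n) (hS : IsMaximalEven S) (hf : IsModularForm S k f)
    (hp : ∀ p : ℕ, p.Prime → PMaassCondition S k p f) : InMaassSpace S k f := by
  refine ⟨hf, fun m l μ hv hnn h0 => ?_⟩
  obtain ⟨⟨a, rfl⟩, -, ⟨b, rfl⟩⟩ := mem_dual_iff.1 hv
  obtain ⟨ha, hb, hq⟩ := (isNonneg_colVec _ _ _).1 hnn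
  lift a to ℕ using (by exact_mod_cast ha)
  lift b to ℕ using (by exact_mod_cast hb)
  simp only [Int.cast_natCast] at *
  by_cases ha0 : a = 0
  · subst ha0
    -- For `m = 0` the condition `λ ≥ 0` forces `S[μ] ≤ 0`.
    have hμ : μ = 0 := by
      by_contra hne
      have := S_pos hS hne
      simp only [Nat.cast_zero, zero_mul, mul_zero] at hq
      exact absurd hq (not_le.2 this)
    subst hμ
    have hb0 : b ≠ 0 := by
      rintro rfl
      exact h0 (funext (ext_cases (by simp) (fun i => by simp) (by simp)))
    rw [Nat.cast_zero, coeff_zero_lst hp hb0, (epsilon_mul_zero b).1,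
      boundary_coeff_symm hn hS hf hp, Finset.sum_mul]
    refine Finset.sum_congr rfl fun d _ => ?_
    congr 3
    · funext i; simp
    · simp
  · exact maass_of_pMaass_of_pos hS hp ha0 hv

end Maass

end OrthMaass

theorem theorem2 (n : ℕ) (hn : 1 ≤ n) (S : Matrix (Fin n) (Fin n) ℤ)
    (hS : OrthMaass.IsMaximalEven S) (k : ℕ) (hk0 : 0 < k) (hk : Even k)
    (f : (OrthMaass.Ext (Fin n) → ℂ) → ℂ) (hf : OrthMaass.IsModularForm S k f) :
    List.TFAE [
      OrthMaass.InMaassSpace S k f,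
      ∀ p : ℕ, p.Prime → OrthMaass.PMaassCondition S k p f,
      ∀ p : ℕ, p.Prime → OrthMaass.CoeffRelation S k p f,
      ∀ p : ℕ, p.Prime → ∀ w ∈ OrthMaass.halfSpace S,
        OrthMaass.heckeUp S k p f w = OrthMaass.heckeDown S k p f w] := by
  tfae_have 1 → 3 := fun h p hp => OrthMaass.coeffRelation_of_maass hn hS h hp
  tfae_have 3 → 2 := fun h p hp => OrthMaass.pMaassCondition_of_coeffRelation hp (h p hp)
  tfae_have 2 → 1 := fun h => OrthMaass.inMaassSpace_of_pMaass hn hS hf h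
  tfae_have 3 ↔ 4 := forall₂_congr fun p hp =>
    OrthMaass.coeffRelation_iff_hecke hS hf hk0 hp.ne_zero
  tfae_finish
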